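/- Let $\mathrm{VAR}$ be a countably infinite set of variables. Formulas of propositional inclusion logic $\mathcal{PINC}$ are given by $$\varphi ::= \top \mid \bot \mid x \mid \neg x \mid \varphi\vee\varphi \mid \varphi\wedge\varphi \mid \mathbf x\subseteq\mathbf y,$$ where $x\in \mathrm{VAR}$ and $\mathbf x,\mathbf y$ are finite tuples of variables of the same length. A team is a set $T$ of assignments $t\colon \mathrm{VAR}\to\{0,1\}$. Always $T\models\top$; $T\models\bot$ iff $T=\emptyset$; $T\models x$ (resp. $T\models \neg x$) iff $t(x)=1$ (resp. $t(x)=0$) for all $t\in T$; $T\models\varphi\wedge\psi$ iff $T\models\varphi$ and $T\models\psi$; $T\models\varphi\vee\psi$ iff $T=T_1\cup T_2$ for some $T_1\models\varphi$ and $T_2\models\psi$, where the strict semantics moreover requires $T_1\cap T_2=\emptyset$ and the lax semantics does not; $T\models \mathbf x\subseteq\mathbf y$ iff for every $t\in T$ there is $t'\in T$ with $t(\mathbf x)=t'(\mathbf y)$. The problem $\mathrm{SAT}$ asks whether a given formula $\varphi$ is satisfied by some nonempty team. Let $G_\varphi$ be the Gaifman graph of the syntax structure of $\varphi$: its vertices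 are the subformulas of $\varphi$ and the variables occurring in $\varphi$ (a variable $x$ being identified with the formula $x$; the formula $\neg x$ has the immediate subformula $x$), and two distinct vertices are adjacent iff one is an immediate subformula of the other, or one is an inclusion atom of $\varphi$ and the other a variable occurring in it, or both are variables occurring in the same inclusion atom of $\varphi$. The treewidth of a graph is the minimum, over all its tree decompositions, of the size of a largest bag minus one. A parameterised problem, given by a set $Q\subseteq\Sigma^*$ and a parameterisation $\kappa\colon\Sigma^*\to\mathbb N$, is in $\mathrm{para}\mathbf{NP}$ if there are a computable function $f\colon\mathbb N\to\mathbb N$, a polynomial $p$ and a nondeterministic Turing machine that decides, for every $x\in\Sigma^*$, whether $x\in Q$, in at most $f(\kappa(x))\cdot p(|x|)$ steps on each computation path. **Statement.** Under the lax as well as under the strict semantics, $\mathrm{SAT}$ for $\mathcal{PINC}$ (formulas being written as strings with variables in binary), parameterised by the treewidth of $G_\varphi$ for the input formula $\varphi$ (strings that are not formulas being no-instances with parameter $0$), is in $\mathrm{para}\mathbf{NP}$. -/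

import Mathlib

/-! ## Nondeterministic machines and the class para-NP -/

/-- A nondeterministic Turing machine with input alphabet `α`. It has finitely many stacks (two
stacks make up one work tape) over finite alphabets, and its programs are those of Mathlib's
multi-stack machines `Turing.TM2`, the model of `Turing.FinTM2`. As usual, nondeterminism is given
by two transition functions `prog false` and `prog true`, one of which is chosen at every step. -/
structure NTM (α : Type) where
  /-- index type of the stacks -/
  K : Type
  [decEqK : DecidableEq K]
  [finK : Finite K]
  /-- stack alphabets -/
  Γ : K → Type
  [finΓ : ∀ k, Finite (Γ k)]
  /-- program labels -/
  Λ : Type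
  [finΛ : Finite Λ]
  /-- internal states -/
  σ : Type
  [finσ : Finite σ]
  /-- the stack on which the input is written, first letter on top -/
  inputStack : K
  /-- the input alphabet is part of the alphabet of the input stack -/
  letter : α ↪ Γ inputStack
  /-- the label at which the computation starts -/
  start : Λ
  /-- the internal state in which the computation starts -/
  init : σ
  /-- the two transition functions -/
  prog : Bool → Λ → Turing.TM2.Stmt Γ Λ σ
  /-- the internal states that are accepting, when the machine has halted -/
  accepting : Set σ

namespace NTM

variable {α : Type} (M : NTM α)

/-- Configurations: current label (`none` if halted), internal state and contents of the stacks. -/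
abbrev Cfg : Type := Turing.TM2.Cfg M.Γ M.Λ M.σ

/-- The initial configuration on the input `w`: all stacks but the input stack are empty. -/
def initCfg (w : List α) : M.Cfg :=
  letI := M.decEqK
  ⟨some M.start, M.init, Function.update (fun _ => []) M.inputStack (w.map M.letter)⟩

/-- `M.Step c c'`: one of the two transition functions takes `c` to `c'` in one step. There is no
step from a halted configuration. -/
def Step (c c' : M.Cfg) : Prop :=
  letI := M.decEqK
  ∃ b : Bool, Turing.TM2.step (M.prog b) c = some c'

/-- `M.Run w n c`: on the input `w`, some sequence of choices leads to `c` in exactly `n` steps. -/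
inductive Run (w : List α) : ℕ → M.Cfg → Prop
  | zero : Run w 0 (M.initCfg w)
  | succ {n : ℕ} {c c' : M.Cfg} : Run w n c → M.Step c c' → Run w (n + 1) c'

/-- Some computation path on the input `w` halts in an accepting state. -/
def Accepts (w : List α) : Prop :=
  ∃ (n : ℕ) (c : M.Cfg), M.Run w n c ∧ c.l = none ∧ c.var ∈ M.accepting

/-- Every computation path on the input `w` halts after at most `t` steps. -/
def HaltsWithin (w : List α) (t : ℕ) : Prop :=
  ∀ (n : ℕ) (c : M.Cfg), M.Run w n c → n ≤ t

end NTM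

/-- A parameterised problem over the alphabet `α`: a set of strings together with a parameterisation
of the strings. The corresponding set of pairs consists of the `(x, param x)` with `x` in `lang`. -/
structure ParamProblem (α : Type) where
  lang : Set (List α)
  param : List α → ℕ

/-- The class para-NP: some nondeterministic machine decides `x ∈ lang` in at most `f k * p |x|`
steps on every computation path, where `k` is the parameter of `x`, the function `f` is computable
and `p` is a polynomial. -/
def ParamProblem.InParaNP {α : Type} (P : ParamProblem α) : Prop :=
  ∃ (M : NTM α) (f : ℕ → ℕ) (p : Polynomial ℕ), Computable f ∧
    ∀ x : List α,
      M.HaltsWithin x (f (P.param x) * p.eval x.length) ∧ (M.Accepts x ↔ x ∈ P.lang)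

/-! ## Propositional inclusion logic -/

/-- Formulas of propositional inclusion logic, with the natural numbers as variables. The atom
`inc x y` is the inclusion atom of the two variable tuples `x`, `y` of the same length `n`. -/
inductive PInc : Type
  | top : PInc
  | bot : PInc
  | var (x : ℕ) : PInc
  | neg (x : ℕ) : PInc
  | or (φ ψ : PInc) : PInc
  | and (φ ψ : PInc) : PInc
  | inc {n : ℕ} (x y : Fin n → ℕ) : PInc

/-- The two semantics of the split-junction. -/
inductive SplitSemantics : Type
  | lax
  | strict

/-- A team is a set of assignments of truth values to the variables. -/
abbrev Team : Type := Set (ℕ → Bool)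

namespace PInc

/-- Team semantics; the strict semantics requires a split into two disjoint parts. -/
def Sat (sem : SplitSemantics) : Team → PInc → Prop
  | _, top => True
  | T, bot => T = ∅
  | T, var x => ∀ t ∈ T, t x = true
  | T, neg x => ∀ t ∈ T, t x = false
  | T, or φ ψ => ∃ T₁ T₂ : Team, T₁ ∪ T₂ = T ∧ (sem = SplitSemantics.strict → Disjoint T₁ T₂) ∧
      Sat sem T₁ φ ∧ Sat sem T₂ ψ
  | T, and φ ψ => Sat sem T φ ∧ Sat sem T ψ
  | T, inc x y => ∀ t ∈ T, ∃ t' ∈ T, (fun i => t (x i)) = fun i => t' (y i)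

/-- A formula is satisfiable if some nonempty team satisfies it. -/
def Satisfiable (sem : SplitSemantics) (φ : PInc) : Prop :=
  ∃ T : Team, T.Nonempty ∧ Sat sem T φ

/-! ## The syntax structure and its Gaifman graph -/

/-- The variables that occur in a formula. -/
def vars : PInc → Set ℕ
  | top => ∅
  | bot => ∅
  | var x => {x}
  | neg x => {x}
  | or φ ψ => vars φ ∪ vars ψ
  | and φ ψ => vars φ ∪ vars ψ
  | inc x y => Set.range x ∪ Set.range y

/-- The subformulas of a formula; the negated variable `neg x` has the subformula `var x`. -/
def subformulas : PInc → Set PInc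
  | top => {top}
  | bot => {bot}
  | var x => {var x}
  | neg x => {neg x, var x}
  | or φ ψ => {or φ ψ} ∪ (subformulas φ ∪ subformulas ψ)
  | and φ ψ => {and φ ψ} ∪ (subformulas φ ∪ subformulas ψ)
  | inc x y => {inc x y}

/-- The universe of the syntax structure: the subformulas and the variables of `φ`, where the
variable `x` is identified with the formula `var x`. -/
def carrier (φ : PInc) : Set PInc :=
  subformulas φ ∪ var '' vars φ

/-- `Immediate ψ α`: the formula `α` is an immediate subformula of `ψ`. -/
inductive Immediate : PInc → PInc → Prop
  | neg (x : ℕ) : Immediate (neg x) (var x)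
  | or_left (φ ψ : PInc) : Immediate (or φ ψ) φ
  | or_right (φ ψ : PInc) : Immediate (or φ ψ) ψ
  | and_left (φ ψ : PInc) : Immediate (and φ ψ) φ
  | and_right (φ ψ : PInc) : Immediate (and φ ψ) ψ

/-- The relation of the syntax structure of `φ` that connects each inclusion atom of `φ` with its
variables, and any two variables that occur in the same inclusion atom of `φ`. -/
inductive Dep (φ : PInc) : PInc → PInc → Prop
  | atom {n : ℕ} (x y : Fin n → ℕ) (v : ℕ) : inc x y ∈ subformulas φ → v ∈ vars (inc x y) →
      Dep φ (inc x y) (var v)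
  | pair {n : ℕ} (x y : Fin n → ℕ) (v w : ℕ) : inc x y ∈ subformulas φ → v ∈ vars (inc x y) →
      w ∈ vars (inc x y) → Dep φ (var v) (var w)

/-- The Gaifman graph of the syntax structure of `φ`: two distinct elements of the universe are
adjacent if they are related, in either order, by one of the binary relations. -/
def gaifman (φ : PInc) : SimpleGraph (carrier φ) :=
  SimpleGraph.fromRel fun u v => Immediate u.1 v.1 ∨ Dep φ u.1 v.1

theorem finite_vars (φ : PInc) : (vars φ).Finite := by
  induction φ with
  | top => exact Set.finite_empty
  | bot => exact Set.finite_empty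
  | var x => exact Set.finite_singleton x
  | neg x => exact Set.finite_singleton x
  | or φ ψ h₁ h₂ => exact h₁.union h₂
  | and φ ψ h₁ h₂ => exact h₁.union h₂
  | inc x y => exact (Set.finite_range x).union (Set.finite_range y)

theorem finite_subformulas (φ : PInc) : (subformulas φ).Finite := by
  induction φ with
  | top => exact Set.finite_singleton _
  | bot => exact Set.finite_singleton _
  | var x => exact Set.finite_singleton _
  | neg x => exact (Set.finite_singleton _).insert _
  | or φ ψ h₁ h₂ => exact (Set.finite_singleton _).union (h₁.union h₂)
  | and φ ψ h₁ h₂ => exact (Set.finite_singleton _).union (h₁.union h₂)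
  | inc x y => exact Set.finite_singleton _

instance finite_carrier (φ : PInc) : Finite (carrier φ) :=
  ((finite_subformulas φ).union ((finite_vars φ).image var)).to_subtype

end PInc

/-! ## Treewidth -/

/-- A tree decomposition of a graph: a finite tree whose nodes carry bags of vertices. -/
structure TreeDecomposition {V : Type} (G : SimpleGraph V) where
  /-- number of nodes of the tree -/
  size : ℕ
  tree : SimpleGraph (Fin size)
  isTree : tree.IsTree
  bag : Fin size → Finset V
  /-- the bags cover all vertices -/
  cover : ∀ v : V, ∃ i, v ∈ bag i
  /-- every edge lies in some bag -/
  edge : ∀ u v : V, G.Adj u v → ∃ i, u ∈ bag i ∧ v ∈ bag i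
  /-- the nodes whose bags contain a given vertex form a connected subgraph -/
  connected : ∀ v : V, (tree.induce {i | v ∈ bag i}).Connected

/-- The width of a tree decomposition: the size of a largest bag minus one. -/
def TreeDecomposition.width {V : Type} {G : SimpleGraph V} (D : TreeDecomposition G) : ℕ :=
  (Finset.univ.sup fun i => (D.bag i).card) - 1

/-- The treewidth of a finite graph: the minimum of the widths of its tree decompositions. -/
noncomputable def treewidth {V : Type} [Finite V] (G : SimpleGraph V) : ℕ :=
  sInf (Set.range fun D : TreeDecomposition G => D.width)

/-! ## Formulas as strings -/

/-- The alphabet in which formulas are written. -/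
inductive Letter : Type
  | top
  | bot
  | pos
  | neg
  | or
  | and
  | inc
  | bit (b : Bool)
  | sep
  | fin

namespace PInc

/-- A variable is written in binary, closed by a separator. -/
def encodeVar (x : ℕ) : List Letter :=
  (Computability.encodeNat x).map Letter.bit ++ [Letter.sep]

/-- A formula is written in prefix notation; the inclusion atom of `(x₁,…,xₙ)` and `(y₁,…,yₙ)` is
written as the list of variables `x₁ y₁ … xₙ yₙ`. -/
def encode : PInc → List Letter
  | top => [Letter.top]
  | bot => [Letter.bot]
  | var x => Letter.pos :: encodeVar x
  | neg x => Letter.neg :: encodeVar x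
  | or φ ψ => Letter.or :: (encode φ ++ encode ψ)
  | and φ ψ => Letter.and :: (encode φ ++ encode ψ)
  | inc x y => Letter.inc ::
      ((List.ofFn fun i => encodeVar (x i) ++ encodeVar (y i)).flatten ++ [Letter.fin])

theorem encodeVar_append_inj {x y : ℕ} {u v : List Letter}
    (h : encodeVar x ++ u = encodeVar y ++ v) : x = y ∧ u = v := by
  have key : ∀ a b : List Bool, a.map Letter.bit ++ [Letter.sep] ++ u = b.map Letter.bit ++ [Letter.sep] ++ v →
      a = b ∧ u = v := by
    intro a
    induction a with
    | nil => intro b hb; cases b <;> simp_all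
    | cons c a ih =>
      intro b hb
      cases b with
      | nil => simp at hb
      | cons d b =>
        simp only [List.map_cons, List.cons_append, List.cons.injEq, Letter.bit.injEq] at hb
        obtain ⟨h₁, h₂⟩ := ih b hb.2
        exact ⟨by rw [hb.1, h₁], h₂⟩
  obtain ⟨h₁, h₂⟩ := key _ _ h
  refine ⟨?_, h₂⟩
  rw [← Computability.decode_encodeNat x, h₁, Computability.decode_encodeNat]

theorem encodeVar_ne_fin (x : ℕ) (u v : List Letter) : encodeVar x ++ u ≠ Letter.fin :: v := by
  unfold encodeVar
  cases Computability.encodeNat x <;> simp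

theorem encodeInc_append_inj {n : ℕ} : ∀ {m : ℕ} {x y : Fin n → ℕ} {x' y' : Fin m → ℕ}
    {u v : List Letter},
    (List.ofFn fun i => encodeVar (x i) ++ encodeVar (y i)).flatten ++ [Letter.fin] ++ u =
      (List.ofFn fun i => encodeVar (x' i) ++ encodeVar (y' i)).flatten ++ [Letter.fin] ++ v →
    inc x y = inc x' y' ∧ u = v := by
  induction n with
  | zero =>
    intro m x y x' y' u v h
    cases m with
    | zero =>
      have hx : x = x' := Subsingleton.elim _ _
      have hy : y = y' := Subsingleton.elim _ _
      subst hx hy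
      simpa using h
    | succ m =>
      exfalso
      simp only [List.ofFn_zero, List.flatten_nil, List.nil_append, List.ofFn_succ,
        List.flatten_cons, List.append_assoc, List.cons_append] at h
      exact encodeVar_ne_fin _ _ _ h.symm
  | succ n ih =>
    intro m x y x' y' u v h
    cases m with
    | zero =>
      exfalso
      simp only [List.ofFn_zero, List.flatten_nil, List.nil_append, List.ofFn_succ,
        List.flatten_cons, List.append_assoc, List.cons_append] at h
      exact encodeVar_ne_fin _ _ _ h
    | succ m =>
      simp only [List.ofFn_succ, List.flatten_cons, List.append_assoc] at h
      obtain ⟨h₀, h⟩ := encodeVar_append_inj h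
      obtain ⟨h₁, h⟩ := encodeVar_append_inj h
      obtain ⟨h₂, h₃⟩ := ih (x := fun i => x i.succ) (y := fun i => y i.succ)
        (x' := fun i => x' i.succ) (y' := fun i => y' i.succ) (by simpa using h)
      refine ⟨?_, h₃⟩
      injection h₂ with hn hx hy
      subst hn
      have hx' : x = x' := funext (Fin.cases h₀ (congrFun (eq_of_heq hx)))
      have hy' : y = y' := funext (Fin.cases h₁ (congrFun (eq_of_heq hy)))
      rw [hx', hy']

/-- Distinct formulas are written as distinct strings. -/
theorem encode_injective : Function.Injective encode := by
  have key : ∀ (φ ψ : PInc) (u v : List Letter), encode φ ++ u = encode ψ ++ v → φ = ψ ∧ u = v := by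
    intro φ
    induction φ with
    | top => intro ψ u v h; cases ψ <;> simp_all [encode]
    | bot => intro ψ u v h; cases ψ <;> simp_all [encode]
    | var x =>
      intro ψ u v h
      cases ψ with
      | var y =>
        obtain ⟨h₁, h₂⟩ := encodeVar_append_inj (List.cons.inj h).2
        exact ⟨by rw [h₁], h₂⟩
      | _ => simp [encode] at h
    | neg x =>
      intro ψ u v h
      cases ψ with
      | neg y =>
        obtain ⟨h₁, h₂⟩ := encodeVar_append_inj (List.cons.inj h).2
        exact ⟨by rw [h₁], h₂⟩
      | _ => simp [encode] at h
    | or φ₁ φ₂ ih₁ ih₂ =>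
      intro ψ u v h
      cases ψ with
      | or ψ₁ ψ₂ =>
        simp only [encode, List.cons_append, List.append_assoc, List.cons.injEq, true_and] at h
        obtain ⟨h₁, h⟩ := ih₁ _ _ _ h
        obtain ⟨h₂, h⟩ := ih₂ _ _ _ h
        exact ⟨by rw [h₁, h₂], h⟩
      | _ => simp [encode] at h
    | and φ₁ φ₂ ih₁ ih₂ =>
      intro ψ u v h
      cases ψ with
      | and ψ₁ ψ₂ =>
        simp only [encode, List.cons_append, List.append_assoc, List.cons.injEq, true_and] at h
        obtain ⟨h₁, h⟩ := ih₁ _ _ _ h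
        obtain ⟨h₂, h⟩ := ih₂ _ _ _ h
        exact ⟨by rw [h₁, h₂], h⟩
      | _ => simp [encode] at h
    | inc x y =>
      intro ψ u v h
      cases ψ with
      | inc x' y' =>
        simp only [encode, List.cons_append, List.cons.injEq, true_and] at h
        exact encodeInc_append_inj h
      | _ => simp [encode] at h
  intro φ ψ h
  exact (key φ ψ [] [] (by rw [h])).1

open Classical in
/-- Satisfiability for propositional inclusion logic, parameterised by the treewidth of the Gaifman
graph of the syntax structure of the input formula. Strings that are not formulas do not belong to
the problem, and have parameter `0`. -/
noncomputable def satByTreewidth (sem : SplitSemantics) : ParamProblem Letter where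
  lang := {w | ∃ φ : PInc, encode φ = w ∧ Satisfiable sem φ}
  param w := if h : ∃ φ : PInc, encode φ = w then treewidth (gaifman h.choose) else 0

theorem param_encode (sem : SplitSemantics) (φ : PInc) :
    (satByTreewidth sem).param (encode φ) = treewidth (gaifman φ) := by
  have h : ∃ ψ : PInc, encode ψ = encode φ := ⟨φ, rfl⟩
  have hφ : h.choose = φ := encode_injective h.choose_spec
  simp only [satByTreewidth, dif_pos h]
  exact congrArg (fun ψ => treewidth (gaifman ψ)) hφ

theorem mem_lang_encode (sem : SplitSemantics) (φ : PInc) :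
    encode φ ∈ (satByTreewidth sem).lang ↔ Satisfiable sem φ := by
  constructor
  · rintro ⟨ψ, h, hψ⟩
    exact encode_injective h ▸ hψ
  · exact fun h => ⟨φ, rfl, h⟩

end PInc

/-! A team is guessed row by row. A row is a copy of the input in which every letter carries a bit:
on a separator, the truth value of the variable that it closes; on a disjunction, the disjunct to
which the assignment is sent; on an inclusion atom, whether the atom is active, that is, whether the
assignment belongs to the part of the team that has to satisfy it. One stack and finite control
suffice to check that a row is a correct annotation (`parse_eq_done_iff`), and a comparison of its
suffixes checks that every variable gets only one value (`IsRow.consistent`,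
`IsRow.exists_of_consistent`). A nonempty list of rows describes a satisfying team once it is
closed: for every active atom in a row there is a row in which the same occurrence is active and the
second tuple takes the values that the first tuple takes in the given row.

Closed lists are sound (`satisfiable_of_chain`) even for strict splits: rows that agree on the
variables of the formula are told apart by a fresh variable, so each assignment goes to one disjunct
only. Conversely, a team that satisfies the formula under either semantics yields a closed set of
rows (`exists_closedSet`), finite because all rows have the same letters. The machine therefore does
not depend on the semantics.

The running time is controlled by a novelty test: every row but the first must show, at some active
atom, values of the second tuple that no earlier row shows at the same active occurrence. This loses
nothing, for if a list is not closed, a row that supplies a missing value is novel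
(`exists_chain_of_closed`). It bounds the list by about the number of positions times `2 ^ k`, where
`k` bounds the number of variables of an inclusion atom (`Chain.length_le`). An atom together with
its variables is a clique of the Gaifman graph, and a clique lies in a single bag by the Helly
property of subtrees (`exists_common_node`), so the treewidth can serve as `k`
(`ncard_vars_le_treewidth`). The machine never computes the treewidth; the novelty test enforces the
bound on every path. -/

/-! ## Computation paths of nondeterministic machines -/

namespace NTM

variable {α : Type} (M : NTM α)

/-- Some computation path from the configuration halts in an accepting state. -/
def AcceptsFrom (c : M.Cfg) : Prop :=
  ∃ c', Relation.ReflTransGen M.Step c c' ∧ c'.l = none ∧ c'.var ∈ M.accepting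

theorem accepts_iff_acceptsFrom (w : List α) : M.Accepts w ↔ M.AcceptsFrom (M.initCfg w) := by
  constructor
  · rintro ⟨n, c, h, h'⟩
    refine ⟨c, ?_, h'⟩
    clear h'
    induction h with
    | zero => exact .refl
    | succ _ hs ih => exact ih.tail hs
  · rintro ⟨c, h, h'⟩
    obtain ⟨n, hn⟩ : ∃ n, M.Run w n c := by
      clear h'
      induction h with
      | refl => exact ⟨0, .zero⟩
      | tail _ hs ih => exact ih.elim fun n hn => ⟨n + 1, hn.succ hs⟩
    exact ⟨n, c, hn, h'⟩

/-- Every computation path from the configuration either meets the set `D` or ends, within the given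
number of steps. -/
inductive Within (D : Set M.Cfg) : ℕ → M.Cfg → Prop
  | mem {t : ℕ} {c : M.Cfg} : c ∈ D → Within D t c
  | step {t : ℕ} {c : M.Cfg} : (∀ c', M.Step c c' → Within D t c') → Within D (t + 1) c

variable {M}

theorem Within.mono {D : Set M.Cfg} {t t' : ℕ} {c : M.Cfg} (h : M.Within D t c) (ht : t ≤ t') :
    M.Within D t' c := by
  induction h generalizing t' with
  | mem h => exact .mem h
  | step _ ih =>
    cases t' with
    | zero => omega
    | succ t' => exact .step fun c' hc => ih c' hc (by omega)

theorem Within.trans {D D' : Set M.Cfg} {t t' : ℕ} {c : M.Cfg} (h : M.Within D t c)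
    (h' : ∀ d ∈ D, M.Within D' t' d) : M.Within D' (t + t') c := by
  induction h with
  | mem h => exact (h' _ h).mono (Nat.le_add_left _ _)
  | step _ ih => rw [Nat.add_right_comm]; exact .step ih

theorem haltsWithin_of_within {w : List α} {t : ℕ} (h : M.Within ∅ t (M.initCfg w)) :
    M.HaltsWithin w t := by
  have key : ∀ n c, M.Run w n c → ∃ s, n + s = t ∧ M.Within ∅ s c := by
    intro n c hr
    induction hr with
    | zero => exact ⟨t, Nat.zero_add t, h⟩
    | succ _ hs ih =>
      obtain ⟨s, hs', hw⟩ := ih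
      cases hw with
      | mem h => exact h.elim
      | step h => exact ⟨_, by omega, h _ hs⟩
  intro n c hr
  obtain ⟨s, hs, -⟩ := key n c hr
  omega

theorem not_step_of_halted {c c' : M.Cfg} (h : c.l = none) : ¬ M.Step c c' := by
  obtain ⟨l, v, S⟩ := c
  subst h
  rintro ⟨b, hb⟩
  cases hb

/-- A configuration that has not halted accepts iff one of its successors does. -/
theorem acceptsFrom_iff_exists_step {c : M.Cfg} (h : c.l ≠ none) :
    M.AcceptsFrom c ↔ ∃ d, M.Step c d ∧ M.AcceptsFrom d := by
  constructor
  · rintro ⟨c', hr, hc⟩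
    rcases Relation.ReflTransGen.cases_head hr with rfl | ⟨e, he, hr⟩
    · exact absurd hc.1 h
    · exact ⟨e, he, c', hr, hc⟩
  · rintro ⟨d, hd, c', hr, hc⟩
    exact ⟨c', .head hd hr, hc⟩

theorem acceptsFrom_iff_of_halted {c : M.Cfg} (h : c.l = none) :
    M.AcceptsFrom c ↔ c.var ∈ M.accepting := by
  constructor
  · rintro ⟨c', hr, hc⟩
    rcases Relation.ReflTransGen.cases_head hr with rfl | ⟨e, he, -⟩
    · exact hc.2
    · exact absurd he (not_step_of_halted h)
  · exact fun hc => ⟨c, .refl, h, hc⟩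

variable (M) in
/-- The only computation path from the first configuration meets the second one, within the given
number of steps. -/
inductive Det : ℕ → M.Cfg → M.Cfg → Prop
  | refl (t : ℕ) (c : M.Cfg) : Det t c c
  | head {t : ℕ} {c d e : M.Cfg} : (∀ c', M.Step c c' ↔ c' = d) → Det t d e → Det (t + 1) c e

theorem Det.trans {t t' : ℕ} {c d e : M.Cfg} (h : M.Det t c d) (h' : M.Det t' d e) :
    M.Det (t + t') c e := by
  induction h with
  -- `t` is only an upper bound for the number of steps, so the unused budget of `refl` is passed on
  -- to the end of `h'`.
  | refl t c =>
    induction h' with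
    | refl => exact .refl _ _
    | head hs _ ih => rw [← Nat.add_assoc]; exact .head hs ih
  | head hs _ ih => rw [Nat.add_right_comm]; exact .head hs (ih h')

theorem Det.mono {t t' : ℕ} {c d : M.Cfg} (h : M.Det t c d) (ht : t ≤ t') : M.Det t' c d := by
  obtain ⟨s, rfl⟩ := Nat.exists_eq_add_of_le ht
  exact h.trans (.refl s d)

/-- Acceptance can be moved both ways along a forced path. With `Det.within` this reduces the
analysis of the machine to its two real choices, the guessed bits and the decision at `main`. -/
theorem Det.acceptsFrom_iff {t : ℕ} {c d : M.Cfg} (h : M.Det t c d) :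
    M.AcceptsFrom c ↔ M.AcceptsFrom d := by
  induction h with
  | refl => rfl
  | head hs _ ih =>
    rw [← ih, acceptsFrom_iff_exists_step fun h => not_step_of_halted h ((hs _).2 rfl)]
    simp [hs]

theorem Det.within {D : Set M.Cfg} {t t' : ℕ} {c d : M.Cfg} (h : M.Det t c d)
    (hd : M.Within D t' d) : M.Within D (t + t') c := by
  induction h with
  | refl => exact hd.mono (Nat.le_add_left _ _)
  | head hs _ ih =>
    rw [Nat.add_right_comm]
    exact .step fun c' hc => (hs c').1 hc ▸ ih hd

end NTM

namespace PInc

/-! ## The machine -/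

/-- A letter of the input, or the end mark `none`, annotated with a bit. -/
abbrev Sym : Type := Option Letter × Bool

instance : Finite Letter := by
  let f : Fin 9 ⊕ Bool → Letter := Sum.elim
    ![.top, .bot, .pos, .neg, .or, .and, .inc, .sep, .fin] .bit
  refine Finite.of_surjective f fun a => ?_
  cases a with
  | top => exact ⟨.inl 0, rfl⟩
  | bot => exact ⟨.inl 1, rfl⟩
  | pos => exact ⟨.inl 2, rfl⟩
  | neg => exact ⟨.inl 3, rfl⟩
  | or => exact ⟨.inl 4, rfl⟩
  | and => exact ⟨.inl 5, rfl⟩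
  | inc => exact ⟨.inl 6, rfl⟩
  | sep => exact ⟨.inl 7, rfl⟩
  | fin => exact ⟨.inl 8, rfl⟩
  | bit b => exact ⟨.inr b, rfl⟩

/-! ### The parser of annotated formulas -/

/-- The states of the parser: it expects a formula, or reads the variable of a literal, or is at the
beginning or inside of a variable of an inclusion atom, or has accepted, or has rejected. -/
inductive Parser : Type
  | form
  | lit (active value mayEnd : Bool)
  | tuple (second : Bool)
  | name (second mayEnd : Bool)
  | done
  | dead

instance : Finite Parser := by
  let f : Fin 3 ⊕ (Bool × Bool × Bool) ⊕ Bool ⊕ (Bool × Bool) → Parser :=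
    Sum.elim ![.form, .done, .dead] (Sum.elim (fun b => .lit b.1 b.2.1 b.2.2)
      (Sum.elim .tuple fun b => .name b.1 b.2))
  refine Finite.of_surjective f fun a => ?_
  cases a with
  | form => exact ⟨.inl 0, rfl⟩
  | done => exact ⟨.inl 1, rfl⟩
  | dead => exact ⟨.inl 2, rfl⟩
  | lit a b c => exact ⟨.inr (.inl (a, b, c)), rfl⟩
  | tuple b => exact ⟨.inr (.inr (.inl b)), rfl⟩
  | name a b => exact ⟨.inr (.inr (.inr (a, b))), rfl⟩

/-- Beginning of a formula that is active or not, other than a connective. The annotation of an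
inclusion atom tells whether it is active. -/
def Parser.atom (active : Bool) : Sym → Parser
  | (some .top, false) => .form
  | (some .bot, false) => if active then .dead else .form
  | (some .pos, false) => .lit active true true
  | (some .neg, false) => .lit active false true
  | (some .inc, b) => if b = active then .tuple false else .dead
  | _ => .dead

/-- Inner letters of literals and inclusion atoms. The annotation of a separator is the truth value
of the variable that it closes. Binary representations end in `true`, or are empty. -/
def Parser.inner : Parser → Sym → Parser
  | .lit p v _, (some (.bit c), false) => .lit p v c
  | .lit p v e, (some .sep, b) => if e && (!p || b == v) then .form else .dead
  | .tuple s, (some (.bit c), false) => .name s c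
  | .tuple s, (some .sep, _) => .tuple !s
  | .tuple false, (some .fin, false) => .form
  | .name s _, (some (.bit c), false) => .name s c
  | .name s e, (some .sep, _) => if e then .tuple !s else .dead
  | _, _ => .dead

/-- The end mark is expected if no formula is left to be read. -/
def Parser.closing : Sym → Parser
  | (none, false) => .done
  | _ => .dead

/-- One step of the parser; the list tells for the formulas that are still to be read whether they
are active. The annotation of a disjunction tells which of its disjuncts may be active. -/
def Parser.next : Parser → List Bool → Sym → Parser × List Bool
  | .form, [], s => (.closing s, [])
  | .form, p :: l, (some .or, b) => (.form, (p && !b) :: (p && b) :: l)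
  | .form, p :: l, (some .and, false) => (.form, p :: p :: l)
  | .form, p :: l, s => (.atom p s, l)
  | m, l, s => (m.inner s, l)

/-- The state of the parser after reading a list. -/
def parse : Parser → List Bool → List Sym → Parser
  | m, _, [] => m
  | m, l, s :: r => parse (m.next l s).1 (m.next l s).2 r

/-! ### Comparison of suffixes by finite automata -/

/-- The three comparisons of suffixes: the annotations of a row assign truth values to variables
consistently; a row is novel in comparison with the previous rows; the rows are closed. -/
inductive Check : Type
  | consistent
  | novel
  | closed

instance : Finite Check :=
  Finite.of_surjective ![Check.consistent, .novel, .closed] fun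
    | .consistent => ⟨0, rfl⟩
    | .novel => ⟨1, rfl⟩
    | .closed => ⟨2, rfl⟩

/-- The states of the automaton that reads two suffixes synchronously. -/
inductive Sync : Type
  | start
  | name
  | fst
  | snd (b : Bool)
  | rest
  | good
  | bad

instance : Finite Sync := by
  refine Finite.of_surjective
    (Sum.elim ![Sync.start, .name, .fst, .rest, .good, .bad] Sync.snd : Fin 6 ⊕ Bool → Sync) ?_
  intro a
  cases a with
  | start => exact ⟨.inl 0, rfl⟩
  | name => exact ⟨.inl 1, rfl⟩
  | fst => exact ⟨.inl 2, rfl⟩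
  | rest => exact ⟨.inl 3, rfl⟩
  | good => exact ⟨.inl 4, rfl⟩
  | bad => exact ⟨.inl 5, rfl⟩
  | snd b => exact ⟨.inr b, rfl⟩

/-- The letters after which a variable may begin. -/
def opens : Option Letter → Bool
  | some .pos | some .neg | some .inc | some .sep => true
  | _ => false

open Classical in
/-- Transitions of the automaton that accepts two occurrences of a variable with different truth
values, each preceded by one more letter. -/
noncomputable def Sync.conflict : Sync → Sym → Sym → Sync
  | .start, s, s' => if opens s.1 ∧ opens s'.1 then .name else .bad
  | .name, s, s' =>
    if s.1 ≠ s'.1 then .bad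
    else match s.1 with
      | some (.bit _) => .name
      | some .sep => if s.2 = s'.2 then .bad else .good
      | _ => .bad
  | q, _, _ => q

open Classical in
/-- Transitions of the automaton that compares occurrences of an inclusion atom in two rows: it
accepts if the atom is inactive in the first row, or if it is active in the second row as well and
the first row agrees there with the second row. What is compared with the truth values of the
second tuple in the second row are the truth values of the second tuple in the first row, or those
of the first tuple, according to the parameter. -/
noncomputable def Sync.agree (cl : Bool) : Sync → Sym → Sym → Sync
  | .start, s, s' =>
    if s = (some .inc, true) then if s' = (some .inc, true) then .fst else .bad else .good
  | .fst, s, s' =>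
    if s.1 ≠ s'.1 then .bad
    else match s.1 with
      | some .sep => .snd s.2
      | some .fin => .rest
      | _ => .fst
  | .snd b, s, s' =>
    if s.1 ≠ s'.1 then .bad
    else match s.1 with
      | some .sep => if (if cl then b else s.2) = s'.2 then .fst else .bad
      | _ => .snd b
  | .rest, s, s' => if s.1 ≠ s'.1 then .bad else if s.1 = none then .good else .rest
  | q, _, _ => q

noncomputable def Check.next : Check → Sync → Sym → Sym → Sync
  | .consistent => Sync.conflict
  | .novel => Sync.agree false
  | .closed => Sync.agree true

/-- The state after a synchronous reading of two lists. -/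
noncomputable def Check.run (c : Check) : Sync → List Sym → List Sym → Sync
  | q, s :: u, s' :: v => c.run (c.next q s s') u v
  | q, _, _ => q

def Sync.accept : Sync → Bool
  | .good => true
  | _ => false

/-- Whether the first list is accepted together with some nonempty suffix of the second one. -/
noncomputable def Check.finds (c : Check) (u : List Sym) : List Sym → Bool
  | [] => false
  | s :: v => (c.run .start u (s :: v)).accept || c.finds u v

/-- For consistency a match is a conflict and must be absent; the other two checks ask every suffix
to have a match. -/
def Check.sign : Check → Bool → Bool
  | .consistent, b => !b
  | _, b => b

/-- Whether all nonempty suffixes of the second list pass the check against the first list. -/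
noncomputable def Check.holds (c : Check) (v : List Sym) : List Sym → Bool
  | [] => true
  | s :: u => c.sign (c.finds (s :: u) v) && c.holds v u

/-! ### The program -/

/-- `row`, `row'` are two copies of the current row and `rows`, `rows'` two copies of the rows kept
so far, because a list can be compared with itself only if it is on two stacks. `word` holds the
reversed input from which the next row is guessed, `pending` is the stack of the parser, and the
remaining stacks hold letters that were read and are to be restored. -/
inductive Stk : Type
  | row
  | row'
  | rows
  | rows'
  | outerDone
  | innerDone
  | outerRead
  | innerRead
  | pending
  | word
  deriving DecidableEq

instance : Finite Stk :=
  Finite.of_surjective ![Stk.row, .row', .rows, .rows', .outerDone, .innerDone, .outerRead,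
    .innerRead, .pending, .word] fun
    | .row => ⟨0, rfl⟩
    | .row' => ⟨1, rfl⟩
    | .rows => ⟨2, rfl⟩
    | .rows' => ⟨3, rfl⟩
    | .outerDone => ⟨4, rfl⟩
    | .innerDone => ⟨5, rfl⟩
    | .outerRead => ⟨6, rfl⟩
    | .innerRead => ⟨7, rfl⟩
    | .pending => ⟨8, rfl⟩
    | .word => ⟨9, rfl⟩

/-- The stack whose suffixes are all to pass the check. -/
def Check.outer : Check → Stk
  | .closed => .rows
  | _ => .row

/-- The stack with whose suffixes they are compared. -/
def Check.inner : Check → Stk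
  | .consistent => .row'
  | .novel => .rows
  | .closed => .rows'

inductive Lab : Type
  | load
  | guess
  | parse
  | unparse
  | stash
  | append
  | main
  | outer (c : Check)
  | inner (c : Check)
  | read (c : Check)
  | unread (c : Check)
  | uninner (c : Check)
  | unouter (c : Check)
  | verdict (c : Check)

instance : Finite Lab := by
  refine Finite.of_surjective (Sum.elim
    ![Lab.load, .guess, .parse, .unparse, .stash, .append, .main]
    (fun x => ![Lab.outer x.2, .inner x.2, .read x.2, .unread x.2, .uninner x.2, .unouter x.2,
      .verdict x.2] x.1) : Fin 7 ⊕ (Fin 7 × Check) → Lab) ?_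
  intro a
  cases a with
  | load => exact ⟨.inl 0, rfl⟩
  | guess => exact ⟨.inl 1, rfl⟩
  | parse => exact ⟨.inl 2, rfl⟩
  | unparse => exact ⟨.inl 3, rfl⟩
  | stash => exact ⟨.inl 4, rfl⟩
  | append => exact ⟨.inl 5, rfl⟩
  | main => exact ⟨.inl 6, rfl⟩
  | outer c => exact ⟨.inr (0, c), rfl⟩
  | inner c => exact ⟨.inr (1, c), rfl⟩
  | read c => exact ⟨.inr (2, c), rfl⟩
  | unread c => exact ⟨.inr (3, c), rfl⟩
  | uninner c => exact ⟨.inr (4, c), rfl⟩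
  | unouter c => exact ⟨.inr (5, c), rfl⟩
  | verdict c => exact ⟨.inr (6, c), rfl⟩

/-- The internal states: two symbols read, the states of the parser and of the synchronous automaton,
and the results of the inner and of the outer loop of a comparison. -/
structure Reg : Type where
  a : Option Sym := none
  b : Option Sym := none
  parser : Parser := .form
  sync : Sync := .start
  found : Bool := false
  all : Bool := true

instance : Finite Reg :=
  Finite.of_injective (fun r : Reg => (r.a, r.b, r.parser, r.sync, r.found, r.all)) <| by
    rintro ⟨⟩ ⟨⟩ h
    simpa using h

def Reg.sym (r : Reg) : Sym := r.a.getD (none, false)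

def Reg.sym' (r : Reg) : Sym := r.b.getD (none, false)

open Turing.TM2.Stmt

/-- The connectives open two formulas. -/
noncomputable def parseStmt : Turing.TM2.Stmt (fun _ : Stk => Sym) Lab Reg :=
  open Classical in
  pop .row (fun r s => { r with a := s }) <|
  branch (fun r => r.a.isSome)
    (push .outerDone Reg.sym <|
      -- Guessing the row has emptied `word`; parsing rebuilds it.
      push .word (fun r => (r.sym.1, false)) <|
      branch (fun r => match r.parser with | .form => true | _ => false)
        (pop .pending (fun r s => { r with b := s }) <|
          branch (fun r => r.b.isSome && decide (r.sym.1 = some .or))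
            -- The flag of the second disjunct goes below that of the first, which is read earlier.
            (push .pending (fun r => (none, r.sym'.2 && r.sym.2)) <|
              push .pending (fun r => (none, r.sym'.2 && !r.sym.2)) <|
              load (fun _ => {}) <|
              goto fun _ => .parse) <|
          branch (fun r => r.b.isSome && decide (r.sym = (some .and, false)))
            (push .pending Reg.sym' <|
              push .pending Reg.sym' <|
              load (fun _ => {}) <|
              goto fun _ => .parse) <|
          load (fun r => { parser := if r.b.isSome then .atom r.sym'.2 r.sym else .closing r.sym }) <|
          goto fun _ => .parse)
        (load (fun r => { parser := r.parser.inner r.sym }) <|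
          goto fun _ => .parse))
    (branch (fun r => match r.parser with | .done => true | _ => false)
      (load (fun _ => {}) <|
        goto fun _ => .unparse)
      (load (fun _ => { all := false }) halt))

/-- The transition function for the choice `choice`. -/
noncomputable def prog (choice : Bool) : Lab → Turing.TM2.Stmt (fun _ : Stk => Sym) Lab Reg
  | .load =>
    pop .row (fun r s => { r with a := s }) <|
    branch (fun r => r.a.isSome)
      (push .word Reg.sym <|
        load (fun _ => {}) <|
        goto fun _ => .load)
      (push .word (fun _ => (none, false)) <|
        goto fun _ => .guess)
  | .guess =>
    pop .word (fun r s => { r with a := s }) <|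
    branch (fun r => r.a.isSome)
      (push .row (fun r => (r.sym.1, choice)) <|
        push .row' (fun r => (r.sym.1, choice)) <|
        load (fun _ => {}) <|
        goto fun _ => .guess)
      (push .pending (fun _ => (none, true)) <|
        goto fun _ => .parse)
  | .parse => parseStmt
  | .unparse =>
    pop .outerDone (fun r s => { r with a := s }) <|
    branch (fun r => r.a.isSome)
      (push .row Reg.sym <|
        load (fun _ => {}) <|
        goto fun _ => .unparse)
      (goto fun _ => .outer .consistent)
  | .outer c =>
    peek c.outer (fun r s => { r with a := s }) <|
    branch (fun r => r.a.isSome)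
      (load (fun r => { all := r.all }) <|
        goto fun _ => .inner c)
      (goto fun _ => .unouter c)
  | .inner c =>
    peek c.inner (fun r s => { r with a := s }) <|
    branch (fun r => r.a.isSome)
      (load (fun r => { r with a := none }) <|
        goto fun _ => .read c)
      (goto fun _ => .uninner c)
  | .read c =>
    peek c.outer (fun r s => { r with a := s }) <|
    peek c.inner (fun r s => { r with b := s }) <|
    branch (fun r => r.a.isSome && r.b.isSome)
      (pop c.outer (fun r _ => r) <|
        pop c.inner (fun r _ => r) <|
        push .outerRead Reg.sym <|
        push .innerRead Reg.sym' <|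
        load (fun r => { sync := c.next r.sync r.sym r.sym', found := r.found, all := r.all }) <|
        goto fun _ => .read c)
      (load (fun r => { found := r.sync.accept || r.found, all := r.all }) <|
        goto fun _ => .unread c)
  | .unread c =>
    pop .outerRead (fun r s => { r with a := s }) <|
    pop .innerRead (fun r s => { r with b := s }) <|
    branch (fun r => r.a.isSome)
      (push c.outer Reg.sym <|
        push c.inner Reg.sym' <|
        load (fun r => { r with a := none, b := none }) <|
        goto fun _ => .unread c)
      -- Both lists are restored; dropping one letter of the inner list passes to its next suffix.
      (pop c.inner (fun r s => { r with a := s }) <|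
        push .innerDone Reg.sym <|
        load (fun r => { r with a := none }) <|
        goto fun _ => .inner c)
  | .uninner c =>
    pop .innerDone (fun r s => { r with a := s }) <|
    branch (fun r => r.a.isSome)
      (push c.inner Reg.sym <|
        load (fun r => { r with a := none }) <|
        goto fun _ => .uninner c)
      (pop c.outer (fun r s => { r with a := s }) <|
        push .outerDone Reg.sym <|
        load (fun r => { all := r.all && c.sign r.found }) <|
        goto fun _ => .outer c)
  | .unouter c =>
    pop .outerDone (fun r s => { r with a := s }) <|
    branch (fun r => r.a.isSome)
      (push c.outer Reg.sym <|
        load (fun r => { r with a := none }) <|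
        goto fun _ => .unouter c)
      (goto fun _ => .verdict c)
  | .verdict .consistent =>
    branch Reg.all
      (goto fun _ => .outer .novel)
      halt
  | .verdict .novel =>
    peek .rows (fun r s => { r with a := s }) <|
    -- A row is rejected if earlier rows exist and it repeats known values at all of its active
    -- atoms.
    branch (fun r => r.a.isSome && r.all)
      (load (fun _ => { all := false }) halt)
      (load (fun _ => {}) <|
        goto fun _ => .stash)
  | .verdict .closed => halt
  | .stash =>
    pop .row (fun r s => { r with a := s }) <|
    pop .row' (fun r _ => r) <|
    branch (fun r => r.a.isSome)
      (push .outerDone Reg.sym <|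
        load (fun _ => {}) <|
        goto fun _ => .stash)
      (goto fun _ => .append)
  | .append =>
    pop .outerDone (fun r s => { r with a := s }) <|
    branch (fun r => r.a.isSome)
      (push .rows Reg.sym <|
        push .rows' Reg.sym <|
        load (fun _ => {}) <|
        goto fun _ => .append)
      (goto fun _ => .main)
  | .main => goto fun _ => if choice then .outer .closed else .guess

/-- The machine guesses rows, as long as they are novel, and accepts if the rows are closed. -/
noncomputable abbrev machine : NTM Letter where
  K := Stk
  Γ _ := Sym
  Λ := Lab
  σ := Reg
  inputStack := .row
  letter := ⟨fun a => (some a, false), fun a b h => by simpa using h⟩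
  start := .load
  init := {}
  prog := prog
  accepting := {r | r.all = true}


/-! ### Deterministic computations: the loops of a comparison -/

theorem machine_step_iff {l : Lab} {v : Reg} {S : Stk → List Sym} {c : machine.Cfg} :
    machine.Step ⟨some l, v, S⟩ c ↔ ∃ b, c = Turing.TM2.stepAux (prog b l) v S := by
  simp only [NTM.Step]
  exact exists_congr fun b => Option.some_inj.trans eq_comm

/-- The configuration with the given label, internal state and stacks. -/
abbrev cfg (l : Lab) (v : Reg) (S : Stk → List Sym) : Turing.TM2.Cfg (fun _ : Stk => Sym) Lab Reg :=
  ⟨some l, v, S⟩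

/-- Except at `guess` and `main` the program ignores the choice, so both transition functions lead
to the same configuration. -/
theorem machine_step_eq {l : Lab} {v : Reg} {S : Stk → List Sym}
    {d : Turing.TM2.Cfg (fun _ : Stk => Sym) Lab Reg}
    (h : ∀ b, Turing.TM2.stepAux (prog b l) v S = d) (c : machine.Cfg) :
    machine.Step (cfg l v S) c ↔ c = d :=
  machine_step_iff.trans
    ⟨fun ⟨b, hb⟩ => hb.trans (h b), fun hc => ⟨true, hc.trans (h true).symm⟩⟩

theorem det_head {l : Lab} {v : Reg} {S : Stk → List Sym} {t : ℕ} {e : machine.Cfg}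
    (d : Turing.TM2.Cfg (fun _ : Stk => Sym) Lab Reg)
    (h : ∀ b, Turing.TM2.stepAux (prog b l) v S = d) (h' : machine.Det t d e) :
    machine.Det (t + 1) (cfg l v S) e :=
  .head (machine_step_eq h) h'

theorem det_single {l : Lab} {v : Reg} {S : Stk → List Sym}
    (d : Turing.TM2.Cfg (fun _ : Stk => Sym) Lab Reg)
    (h : ∀ b, Turing.TM2.stepAux (prog b l) v S = d) : machine.Det 1 (cfg l v S) d :=
  det_head d h (.refl 0 _)

/-- Stack contents outside of the comparisons. -/
def stk (row row' rows done pending word : List Sym) : Stk → List Sym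
  | .row => row
  | .row' => row'
  | .rows => rows
  | .rows' => rows
  | .outerDone => done
  | .pending => pending
  | .word => word
  | _ => []

/-- Stack contents during a comparison. -/
def work (c : Check) (S : Stk → List Sym) (u v ud vd ur vr : List Sym) : Stk → List Sym
  | .outerDone => ud
  | .innerDone => vd
  | .outerRead => ur
  | .innerRead => vr
  | k => if k = c.outer then u else if k = c.inner then v else S k

section work

variable (c : Check) (S : Stk → List Sym) (u v ud vd ur vr l : List Sym)

@[simp] theorem work_outer : work c S u v ud vd ur vr c.outer = u := by cases c <;> rfl
@[simp] theorem work_inner : work c S u v ud vd ur vr c.inner = v := by cases c <;> rfl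
@[simp] theorem work_outerDone : work c S u v ud vd ur vr .outerDone = ud := rfl
@[simp] theorem work_innerDone : work c S u v ud vd ur vr .innerDone = vd := rfl
@[simp] theorem work_outerRead : work c S u v ud vd ur vr .outerRead = ur := rfl
@[simp] theorem work_innerRead : work c S u v ud vd ur vr .innerRead = vr := rfl

@[simp] theorem update_work_outer :
    Function.update (work c S u v ud vd ur vr) c.outer l = work c S l v ud vd ur vr := by
  funext k; cases c <;> cases k <;> rfl

@[simp] theorem update_work_inner :
    Function.update (work c S u v ud vd ur vr) c.inner l = work c S u l ud vd ur vr := by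
  funext k; cases c <;> cases k <;> rfl

@[simp] theorem update_work_outerDone :
    Function.update (work c S u v ud vd ur vr) .outerDone l = work c S u v l vd ur vr := by
  funext k; cases c <;> cases k <;> rfl

@[simp] theorem update_work_innerDone :
    Function.update (work c S u v ud vd ur vr) .innerDone l = work c S u v ud l ur vr := by
  funext k; cases c <;> cases k <;> rfl

@[simp] theorem update_work_outerRead :
    Function.update (work c S u v ud vd ur vr) .outerRead l = work c S u v ud vd l vr := by
  funext k; cases c <;> cases k <;> rfl

@[simp] theorem update_work_innerRead :
    Function.update (work c S u v ud vd ur vr) .innerRead l = work c S u v ud vd ur l := by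
  funext k; cases c <;> cases k <;> rfl

theorem work_self (h : ∀ k ∈ [Stk.outerDone, .innerDone, .outerRead, .innerRead], S k = []) :
    work c S (S c.outer) (S c.inner) [] [] [] [] = S := by
  simp only [List.mem_cons, List.not_mem_nil, or_false, forall_eq_or_imp, forall_eq] at h
  funext k
  cases c <;> cases k <;> simp [work, Check.outer, Check.inner, h]

end work

open NTM

variable (c : Check) (S : Stk → List Sym)

/-- The lists are consumed in parallel until the shorter one ends, which is where `Check.run` stops
as well; the letters read are kept for the restoration. -/
theorem det_read (u v ud vd ur vr : List Sym) (q : Sync) (f all : Bool) :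
    machine.Det (u.length + 1)
      (cfg (.read c) { sync := q, found := f, all := all } (work c S u v ud vd ur vr))
      (cfg (.unread c) { found := (c.run q u v).accept || f, all := all }
        (work c S (u.drop (min u.length v.length)) (v.drop (min u.length v.length)) ud vd
          ((u.take (min u.length v.length)).reverse ++ ur)
          ((v.take (min u.length v.length)).reverse ++ vr))) := by
  induction u generalizing v q ur vr with
  | nil => exact det_single _ fun b => by simp [prog, Check.run]
  | cons s u ih =>
    cases v with
    | nil => exact (det_single _ fun b => by simp [prog, Check.run]).mono (by simp)
    | cons s' v =>
      have := ih v (s :: ur) (s' :: vr) (c.next q s s')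
      refine det_head _ (fun b => ?_) (by simpa [Check.run, Nat.add_min_add_right] using this)
      simp [prog, Reg.sym, Reg.sym']

/-- `a` is the first letter of the restored inner list; it moves to `innerDone`, so that the next
round starts at the next suffix. -/
theorem det_unread (u v ud vd ur vr : List Sym) (f all : Bool) (h : ur.length = vr.length)
    (a : Sym) (w : List Sym) (hv : vr.reverse ++ v = a :: w) :
    machine.Det (ur.length + 1)
      (cfg (.unread c) { found := f, all := all } (work c S u v ud vd ur vr))
      (cfg (.inner c) { found := f, all := all }
        (work c S (ur.reverse ++ u) w ud (a :: vd) [] [])) := by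
  induction ur generalizing vr u v with
  | nil =>
    cases vr with
    | cons _ _ => simp at h
    | nil =>
      obtain rfl : v = a :: w := hv
      exact det_single _ fun b => by simp [prog, Reg.sym]
  | cons s ur ih =>
    cases vr with
    | nil => simp at h
    | cons s' vr =>
      have := ih (s :: u) (s' :: v) vr (by simpa using h) (by simpa using hv)
      refine det_head _ (fun b => ?_) (by simpa using this)
      simp [prog, Reg.sym, Reg.sym']

/-- Each suffix costs one step at `inner` and at most `u.length + 1` steps each for reading and
restoring, hence the factor `2 * u.length + 3`. -/
theorem det_inner (u v ud vd : List Sym) (f all : Bool) :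
    machine.Det (v.length * (2 * u.length + 3) + 1)
      (cfg (.inner c) { found := f, all := all } (work c S u v ud vd [] []))
      (cfg (.uninner c) { found := f || c.finds u v, all := all }
        (work c S u [] ud (v.reverse ++ vd) [] [])) := by
  induction v generalizing vd f with
  | nil => exact (det_single _ fun b => by simp [prog, Check.finds]).mono (by simp)
  | cons s v ih =>
    have h₁ := det_read c S u (s :: v) ud vd [] [] .start f all
    have h₂ := det_unread c S (u.drop (min u.length (s :: v).length))
      ((s :: v).drop (min u.length (s :: v).length)) ud vd
      ((u.take (min u.length (s :: v).length)).reverse ++ [])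
      (((s :: v).take (min u.length (s :: v).length)).reverse ++ [])
      ((c.run .start u (s :: v)).accept || f) all (by simp) s v (by simp [List.take_append_drop])
    have hu : ((u.take (min u.length (s :: v).length)).reverse ++ []).reverse ++
        u.drop (min u.length (s :: v).length) = u := by simp [List.take_append_drop]
    rw [hu] at h₂
    have h₃ := ih (s :: vd) ((c.run .start u (s :: v)).accept || f)
    have h₄ : ((c.run .start u (s :: v)).accept || f || c.finds u v) =
        (f || c.finds u (s :: v)) := by
      rw [Check.finds, ← Bool.or_assoc, Bool.or_comm f]
    have h₅ : v.reverse ++ s :: vd = (s :: v).reverse ++ vd := by simp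
    rw [h₄, h₅] at h₃
    refine (det_head _ (fun b => ?_) (h₁.trans (h₂.trans h₃))).mono ?_
    · simp [prog]
    · simp only [List.append_nil, List.length_reverse, List.length_take, List.length_cons]
      have := min_le_left u.length (min u.length (v.length + 1))
      have := min_le_left u.length (v.length + 1)
      rw [Nat.add_mul]
      omega

theorem det_uninner (u v ud vd : List Sym) (s : Sym) (f all : Bool) :
    machine.Det (vd.length + 1)
      (cfg (.uninner c) { found := f, all := all } (work c S (s :: u) v ud vd [] []))
      (cfg (.outer c) { all := all && c.sign f }
        (work c S u (vd.reverse ++ v) (s :: ud) [] [] [])) := by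
  induction vd generalizing v with
  | nil => exact det_single _ fun b => by simp [prog, Reg.sym]
  | cons s' vd ih =>
    refine det_head _ (fun b => ?_) (by simpa using ih (s' :: v))
    simp [prog, Reg.sym]

theorem det_unouter (u v ud : List Sym) (all : Bool) :
    machine.Det (ud.length + 1)
      (cfg (.unouter c) { all := all } (work c S u v ud [] [] []))
      (cfg (.verdict c) { all := all } (work c S (ud.reverse ++ u) v [] [] [] [])) := by
  induction ud generalizing u with
  | nil => exact det_single _ fun b => by simp [prog]
  | cons s ud ih =>
    refine det_head _ (fun b => ?_) (by simpa using ih (s :: u))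
    simp [prog, Reg.sym]

/-- `m` stays fixed while `u` shrinks, so that all rounds share one bound. A round consists of one
step, an inner loop, and at most `v.length + 1` steps that restore the inner list. -/
theorem det_outer (u v ud : List Sym) (all : Bool) (m : ℕ) (hm : u.length ≤ m) :
    machine.Det (u.length * (v.length * (2 * m + 4) + 3) + 1)
      (cfg (.outer c) { all := all } (work c S u v ud [] [] []))
      (cfg (.unouter c) { all := all && c.holds v u }
        (work c S [] v (u.reverse ++ ud) [] [] [])) := by
  induction u generalizing ud all with
  | nil => exact (det_single _ fun b => by simp [prog, Check.holds]).mono (by simp)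
  | cons s u ih =>
    have h₁ := det_inner c S (s :: u) v ud [] false all
    have h₂ := det_uninner c S u [] ud (v.reverse ++ []) s (false || c.finds (s :: u) v) all
    have h₃ := ih (s :: ud) (all && c.sign (false || c.finds (s :: u) v))
      ((Nat.le_succ _).trans hm)
    have hv : (v.reverse ++ []).reverse ++ [] = v := by simp
    have h₄ : (all && c.sign (false || c.finds (s :: u) v) && c.holds v u) =
        (all && c.holds v (s :: u)) := by
      rw [Check.holds, Bool.false_or, Bool.and_assoc]
    have h₅ : u.reverse ++ s :: ud = (s :: u).reverse ++ ud := by simp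
    rw [hv] at h₂
    rw [h₄, h₅] at h₃
    refine (det_head _ (fun b => ?_) (h₁.trans (h₂.trans h₃))).mono ?_
    · simp [prog]
    · have := Nat.mul_le_mul_left v.length (show 2 * (s :: u).length + 3 ≤ 2 * m + 3 by omega)
      simp only [List.append_nil, List.length_reverse, List.length_cons, Nat.add_mul (u.length)]
        at this ⊢
      have h : v.length * (2 * m + 4) = v.length * (2 * m + 3) + v.length := by ring
      omega

/-- A comparison leaves the stacks unchanged. -/
theorem det_check (h : ∀ k ∈ [Stk.outerDone, .innerDone, .outerRead, .innerRead], S k = []) :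
    machine.Det (4 * ((S c.outer).length + (S c.inner).length + 1) ^ 3)
      (cfg (.outer c) {} S)
      (cfg (.verdict c) { all := c.holds (S c.inner) (S c.outer) } S) := by
  have h₁ := det_outer c S (S c.outer) (S c.inner) [] true _ le_rfl
  have h₂ := det_unouter c S [] (S c.inner) ((S c.outer).reverse ++ [])
    (true && c.holds (S c.inner) (S c.outer))
  have hu : ((S c.outer).reverse ++ []).reverse ++ [] = S c.outer := by simp
  rw [hu] at h₂
  have := h₁.trans h₂
  rw [work_self c S h] at this
  refine this.mono ?_
  simp only [List.append_nil, List.length_reverse]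
  generalize (S c.outer).length = a
  generalize (S c.inner).length = b
  nlinarith [Nat.zero_le (a ^ 3), Nat.zero_le (b ^ 3), Nat.zero_le (a ^ 2 * b),
    Nat.zero_le (a * b ^ 2), Nat.zero_le (a * b), Nat.zero_le (a ^ 2), Nat.zero_le (b ^ 2)]


/-! ### Guessing, parsing and keeping a row -/

open NTM

section stk

variable (row row' rows done pending word l : List Sym)

@[simp] theorem stk_row : stk row row' rows done pending word .row = row := rfl
@[simp] theorem stk_row' : stk row row' rows done pending word .row' = row' := rfl
@[simp] theorem stk_rows : stk row row' rows done pending word .rows = rows := rfl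
@[simp] theorem stk_rows' : stk row row' rows done pending word .rows' = rows := rfl
@[simp] theorem stk_outerDone : stk row row' rows done pending word .outerDone = done := rfl
@[simp] theorem stk_pending : stk row row' rows done pending word .pending = pending := rfl
@[simp] theorem stk_word : stk row row' rows done pending word .word = word := rfl

@[simp] theorem update_stk_row : Function.update (stk row row' rows done pending word) .row l =
    stk l row' rows done pending word := by
  funext k; cases k <;> rfl

@[simp] theorem update_stk_row' : Function.update (stk row row' rows done pending word) .row' l =
    stk row l rows done pending word := by
  funext k; cases k <;> rfl

/-- `stk` keeps the two copies of the rows equal, so only the update of both is again of this form.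
-/
theorem update_stk_rows : Function.update (Function.update (stk row row' rows done pending word)
    .rows l) .rows' l = stk row row' l done pending word := by
  funext k; cases k <;> rfl

@[simp] theorem update_stk_outerDone :
    Function.update (stk row row' rows done pending word) .outerDone l =
      stk row row' rows l pending word := by
  funext k; cases k <;> rfl

@[simp] theorem update_stk_pending :
    Function.update (stk row row' rows done pending word) .pending l =
      stk row row' rows done l word := by
  funext k; cases k <;> rfl

@[simp] theorem update_stk_word : Function.update (stk row row' rows done pending word) .word l =
    stk row row' rows done pending l := by
  funext k; cases k <;> rfl

end stk

theorem det_load (w : List Letter) (word : List Sym) :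
    machine.Det (w.length + 1)
      (cfg .load {} (stk (w.map fun a => (some a, false)) [] [] [] [] word))
      (cfg .guess {} (stk [] [] [] [] []
        ((none, false) :: ((w.map fun a => (some a, false)).reverse ++ word)))) := by
  induction w generalizing word with
  | nil => exact det_single _ fun b => by simp [prog]
  | cons a w ih =>
    refine det_head _ (fun b => ?_) (by simpa using ih ((some a, false) :: word))
    simp [prog, Reg.sym]

/-- The input word with an end mark, from right to left. -/
def reversedWord (w : List Letter) : List Sym :=
  (none, false) :: (w.map fun a => (some a, false)).reverse

theorem det_init (w : List Letter) :
    machine.Det (w.length + 1) (machine.initCfg w)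
      (cfg .guess {} (stk [] [] [] [] [] (reversedWord w))) := by
  have h : machine.initCfg w = cfg .load {} (stk (w.map fun a => (some a, false)) [] [] [] [] []) := by
    have hs : Function.update (fun _ => []) Stk.row (w.map fun a => (some a, false)) =
        stk (w.map fun a => (some a, false)) [] [] [] [] [] := by
      funext k; cases k <;> rfl
    exact congrArg (cfg .load {}) hs
  rw [h]
  simpa [reversedWord] using det_load w []

theorem step_guess_iff (row rows word : List Sym) (s : Sym) (c : machine.Cfg) :
    machine.Step (cfg .guess {} (stk row row rows [] [] (s :: word))) c ↔
      ∃ b, c = cfg .guess {} (stk ((s.1, b) :: row) ((s.1, b) :: row) rows [] [] word) := by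
  refine machine_step_iff.trans (exists_congr fun b => ?_)
  have : Turing.TM2.stepAux (prog b .guess) {} (stk row row rows [] [] (s :: word)) =
      cfg .guess {} (stk ((s.1, b) :: row) ((s.1, b) :: row) rows [] [] word) := by
    simp [prog, Reg.sym]
  rw [this]

/-- The configuration in which the row that was guessed is going to be parsed. -/
abbrev parseCfg (row rows : List Sym) : Turing.TM2.Cfg (fun _ : Stk => Sym) Lab Reg :=
  cfg .parse {} (stk row row rows [] [(none, true)] [])

theorem det_guess_nil (row rows : List Sym) :
    machine.Det 1 (cfg .guess {} (stk row row rows [] [] [])) (parseCfg row rows) :=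
  det_single _ fun b => by simp [prog]

theorem guess_within (row rows word : List Sym) :
    machine.Within {c | ∃ r, r.map Prod.fst = (word.map Prod.fst).reverse ∧
        c = parseCfg (r ++ row) rows} (word.length + 1)
      (cfg .guess {} (stk row row rows [] [] word)) := by
  induction word generalizing row with
  | nil =>
    refine ((det_guess_nil row rows).within (t' := 0) (.mem ?_)).mono le_rfl
    exact ⟨[], rfl, rfl⟩
  | cons s word ih =>
    refine .step fun c hc => ?_
    obtain ⟨b, rfl⟩ := (step_guess_iff row rows word s c).1 hc
    refine (ih ((s.1, b) :: row)).trans (t' := 0) ?_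
    rintro _ ⟨r, hr, rfl⟩
    exact .mem ⟨r ++ [(s.1, b)], by simp [hr], by simp⟩

/-- Every letter receives an arbitrary bit, so the guessed rows are all the annotated copies of the
word, built from right to left. -/
theorem guess_acceptsFrom_iff (row rows word : List Sym) :
    machine.AcceptsFrom (cfg .guess {} (stk row row rows [] [] word)) ↔
      ∃ r, r.map Prod.fst = (word.map Prod.fst).reverse ∧
        machine.AcceptsFrom (parseCfg (r ++ row) rows) := by
  induction word generalizing row with
  | nil => simpa using (det_guess_nil row rows).acceptsFrom_iff
  | cons s word ih =>
    rw [acceptsFrom_iff_exists_step (Option.some_ne_none _)]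
    constructor
    · rintro ⟨c, hc, hacc⟩
      obtain ⟨b, rfl⟩ := (step_guess_iff row rows word s c).1 hc
      obtain ⟨r, hr, h⟩ := (ih _).1 hacc
      exact ⟨r ++ [(s.1, b)], by simp [hr], by simpa using h⟩
    · rintro ⟨r, hr, h⟩
      rcases List.eq_nil_or_concat r with rfl | ⟨r, ⟨a, b⟩, rfl⟩
      · simp at hr
      · simp only [List.concat_eq_append, List.map_append, List.map_cons, List.map_nil,
          List.reverse_cons] at hr h
        obtain ⟨hr', ha⟩ := List.append_inj' hr rfl
        obtain rfl : a = s.1 := by simpa using ha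
        exact ⟨_, (step_guess_iff row rows word s _).2 ⟨b, rfl⟩, (ih _).2 ⟨r, hr', by simpa using h⟩⟩

/-- The stack of the parser. -/
def flags (l : List Bool) : List Sym := l.map fun p => (none, p)

theorem step_parse (m : Parser) (l : List Bool) (s : Sym) (r row' rows done word : List Sym)
    (b : Bool) :
    Turing.TM2.stepAux (prog b .parse) { parser := m }
        (stk (s :: r) row' rows done (flags l) word) =
      cfg .parse { parser := (m.next l s).1 }
        (stk r row' rows (s :: done) (flags (m.next l s).2) ((s.1, false) :: word)) := by
  cases m with
  | form =>
    cases l with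
    | nil => simp [prog, parseStmt, Reg.sym, Parser.next, flags]
    | cons p l =>
      obtain ⟨_ | a, e⟩ := s
      · simp [prog, parseStmt, Reg.sym, Reg.sym', Parser.next, flags]
      · cases a <;> cases e <;>
          simp [prog, parseStmt, Reg.sym, Reg.sym', Parser.next, flags]
  | _ => simp [prog, parseStmt, Reg.sym, Parser.next]

/-- The state `done` is entered only when no formula is pending. This ensures that an accepting
parse leaves the stack `pending` empty for the next row. -/
theorem Parser.next_eq_done {m : Parser} {l : List Bool} {s : Sym} (h : (m.next l s).1 = .done) :
    (m.next l s).2 = [] := by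
  cases m with
  | form =>
    cases l with
    | nil => rfl
    | cons p l =>
      obtain ⟨_ | a, e⟩ := s
      · simp [Parser.next, Parser.atom] at h
      · cases a <;> cases e <;> revert h <;> simp only [Parser.next, Parser.atom] <;>
          (try split_ifs) <;> simp
  | lit p v e =>
    obtain ⟨_ | a, b⟩ := s
    · simp [Parser.next, Parser.inner] at h
    · cases a <;> cases b <;> revert h <;> simp only [Parser.next, Parser.inner] <;>
        (try split_ifs) <;> simp
  | tuple p =>
    obtain ⟨_ | a, b⟩ := s
    · simp [Parser.next, Parser.inner] at h
    · cases a <;> cases b <;> cases p <;> revert h <;> simp [Parser.next, Parser.inner]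
  | name p e =>
    obtain ⟨_ | a, b⟩ := s
    · simp [Parser.next, Parser.inner] at h
    · cases a <;> cases b <;> revert h <;> simp only [Parser.next, Parser.inner] <;>
        (try split_ifs) <;> simp
  | done => simp [Parser.next, Parser.inner] at h
  | dead => simp [Parser.next, Parser.inner] at h

theorem det_parse (m : Parser) (l : List Bool) (r row' rows done word : List Sym)
    (hm : m = .done → l = []) (h : parse m l r = .done) :
    machine.Det (r.length + 1)
      (cfg .parse { parser := m } (stk r row' rows done (flags l) word))
      (cfg .unparse {} (stk [] row' rows (r.reverse ++ done) []
        ((r.map fun s => (s.1, false)).reverse ++ word))) := by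
  induction r generalizing m l done word with
  | nil =>
    obtain rfl : m = .done := h
    obtain rfl := hm rfl
    exact det_single _ fun b => by simp [prog, parseStmt, flags]
  | cons s r ih =>
    refine det_head _ (step_parse m l s r row' rows done word) ?_
    simpa using ih _ _ (s :: done) ((s.1, false) :: word) Parser.next_eq_done h

theorem det_parse_halt (m : Parser) (l : List Bool) (r row' rows done word : List Sym)
    (h : parse m l r ≠ .done) : ∃ S : Stk → List Sym,
    machine.Det (r.length + 1)
      (cfg .parse { parser := m } (stk r row' rows done (flags l) word))
      (⟨none, { all := false }, S⟩ : Turing.TM2.Cfg (fun _ : Stk => Sym) Lab Reg) := by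
  induction r generalizing m l done word with
  | nil =>
    refine ⟨stk [] row' rows done (flags l) word,
      det_single ⟨none, { all := false }, stk [] row' rows done (flags l) word⟩ fun b => ?_⟩
    cases m <;> simp_all [prog, parseStmt, parse]
  | cons s r ih =>
    obtain ⟨S, hS⟩ := ih _ _ (s :: done) ((s.1, false) :: word) h
    exact ⟨S, det_head _ (step_parse m l s r row' rows done word) hS⟩

theorem det_unparse (row row' rows done word : List Sym) :
    machine.Det (done.length + 1)
      (cfg .unparse {} (stk row row' rows done [] word))
      (cfg (.outer .consistent) {} (stk (done.reverse ++ row) row' rows [] [] word)) := by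
  induction done generalizing row with
  | nil => exact det_single _ fun b => by simp [prog]
  | cons s done ih =>
    refine det_head _ (fun b => ?_) (by simpa using ih (s :: row))
    simp [prog, Reg.sym]

theorem det_stash (row row' rows done word : List Sym) (h : row.length = row'.length) :
    machine.Det (row.length + 1)
      (cfg .stash {} (stk row row' rows done [] word))
      (cfg .append {} (stk [] [] rows (row.reverse ++ done) [] word)) := by
  induction row generalizing row' done with
  | nil =>
    obtain rfl : row' = [] := List.length_eq_zero_iff.1 h.symm
    exact det_single _ fun b => by simp [prog]
  | cons s row ih =>
    cases row' with
    | nil => simp at h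
    | cons s' row' =>
      refine det_head _ (fun b => ?_) (by simpa using ih row' (s :: done) (by simpa using h))
      simp [prog, Reg.sym]

theorem det_append (rows done word : List Sym) :
    machine.Det (done.length + 1)
      (cfg .append {} (stk [] [] rows done [] word))
      (cfg .main {} (stk [] [] (done.reverse ++ rows) [] [] word)) := by
  induction done generalizing rows with
  | nil => exact det_single _ fun b => by simp [prog]
  | cons s done ih =>
    refine det_head _ (fun b => ?_) (by simpa using ih (s :: rows))
    simp [prog, Reg.sym, update_stk_rows]

/-- A guessed row is kept if it can be parsed, is consistent, and is the first one or novel. -/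
def Keeps (rows row : List Sym) : Prop :=
  parse .form [true] row = .done ∧ Check.consistent.holds row row = true ∧
    (rows = [] ∨ Check.novel.holds rows row = false)

theorem stk_cleared (row row' rows pending word : List Sym) (k : Stk)
    (hk : k ∈ [Stk.outerDone, .innerDone, .outerRead, .innerRead]) :
    stk row row' rows [] pending word k = [] := by
  revert k
  simp [stk]

/-- The configuration in which the machine decides whether to guess one more row. -/
abbrev mainCfg (w : List Letter) (rows : List Sym) : Turing.TM2.Cfg (fun _ : Stk => Sym) Lab Reg :=
  cfg .main {} (stk [] [] rows [] [] (reversedWord w))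

/-- The configuration in which the machine begins to guess a row. -/
abbrev guessCfg (w : List Letter) (rows : List Sym) : Turing.TM2.Cfg (fun _ : Stk => Sym) Lab Reg :=
  cfg .guess {} (stk [] [] rows [] [] (reversedWord w))

/-- The letters of a row: the input word with an end mark. -/
def marked (w : List Letter) : List (Option Letter) := w.map some ++ [none]

theorem det_keep (w : List Letter) (rows row : List Sym) (hw : row.map Prod.fst = marked w)
    (h : Keeps rows row) :
    machine.Det (30 * (row.length + rows.length + 1) ^ 3 + 30 * (row.length + row.length + 1) ^ 3)
      (parseCfg row rows) (mainCfg w (row ++ rows)) := by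
  obtain ⟨h₁, h₂, h₃⟩ := h
  have hword : (row.map fun s => (s.1, false)).reverse ++ [] = reversedWord w := by
    have : row.map (fun s => (s.1, false)) = (row.map Prod.fst).map fun a => (a, false) := by
      simp
    rw [this, hw]
    simp [marked, reversedWord]
  have d₁ := det_parse .form [true] row row rows [] [] (by simp) h₁
  rw [hword] at d₁
  have d₂ := det_unparse [] row rows (row.reverse ++ []) (reversedWord w)
  have hrow : (row.reverse ++ []).reverse ++ [] = row := by simp
  rw [hrow] at d₂
  have d₃ := det_check .consistent (stk row row rows [] [] (reversedWord w)) (stk_cleared _ _ _ _ _)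
  have d₄ : machine.Det 1 _ _ := det_single (l := .verdict .consistent)
    (v := { all := Check.consistent.holds row row }) (S := stk row row rows [] [] (reversedWord w))
    (cfg (.outer .novel) {} (stk row row rows [] [] (reversedWord w))) fun b => by simp [prog, h₂]
  have d₅ := det_check .novel (stk row row rows [] [] (reversedWord w)) (stk_cleared _ _ _ _ _)
  have d₆ : machine.Det 1 _ _ := det_single (l := .verdict .novel)
    (v := { all := Check.novel.holds rows row }) (S := stk row row rows [] [] (reversedWord w))
    (cfg .stash {} (stk row row rows [] [] (reversedWord w))) fun b => by
      rcases h₃ with rfl | h₃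
      · simp [prog]
      · simp [prog, h₃]
  have d₇ := det_stash row row rows [] (reversedWord w) rfl
  have d₈ := det_append rows (row.reverse ++ []) (reversedWord w)
  have hrow' : (row.reverse ++ []).reverse ++ rows = row ++ rows := by simp
  rw [hrow'] at d₈
  refine (d₁.trans <| d₂.trans <| d₃.trans <| d₄.trans <| d₅.trans <| d₆.trans <|
    d₇.trans d₈).mono ?_
  simp only [List.append_nil, List.length_reverse, Check.outer, Check.inner, stk_row, stk_row',
    stk_rows]
  generalize row.length = a
  generalize rows.length = b
  have h₁ : a + b + 1 ≤ (a + b + 1) ^ 3 := Nat.le_self_pow (by norm_num) _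
  omega

/-- A failure of the parse, of consistency or of novelty ends the path in a rejecting state; no
stack has to be cleaned up, so the final contents are left open. -/
theorem det_not_keep (rows row : List Sym) (h : ¬ Keeps rows row) : ∃ S : Stk → List Sym,
    machine.Det (30 * (row.length + rows.length + 1) ^ 3 + 30 * (row.length + row.length + 1) ^ 3)
      (parseCfg row rows)
      (⟨none, { all := false }, S⟩ : Turing.TM2.Cfg (fun _ : Stk => Sym) Lab Reg) := by
  have hle : row.length + rows.length + 1 ≤ (row.length + rows.length + 1) ^ 3 :=
    Nat.le_self_pow (by norm_num) _
  by_cases h₁ : parse .form [true] row = .done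
  swap
  · obtain ⟨S, hS⟩ := det_parse_halt .form [true] row row rows [] [] h₁
    exact ⟨S, hS.mono (by omega)⟩
  have d₁ := det_parse .form [true] row row rows [] [] (by simp) h₁
  generalize (row.map fun s : Sym => (s.1, false)).reverse ++ [] = word at d₁
  have d₂ := det_unparse [] row rows (row.reverse ++ []) word
  have hrow : (row.reverse ++ []).reverse ++ [] = row := by simp
  rw [hrow] at d₂
  have d₃ := det_check .consistent (stk row row rows [] [] word) (stk_cleared _ _ _ _ _)
  refine ⟨stk row row rows [] [] word, ?_⟩
  by_cases h₂ : Check.consistent.holds row row = true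
  · have d₄ : machine.Det 1 _ _ := det_single (l := .verdict .consistent)
      (v := { all := Check.consistent.holds row row }) (S := stk row row rows [] [] word)
      (cfg (.outer .novel) {} (stk row row rows [] [] word)) fun b => by simp [prog, h₂]
    have d₅ := det_check .novel (stk row row rows [] [] word) (stk_cleared _ _ _ _ _)
    have h₃ : rows ≠ [] ∧ Check.novel.holds rows row = true := by
      simpa [Keeps, h₁, h₂] using h
    have d₆ : machine.Det 1 _ _ := det_single (l := .verdict .novel)
      (v := { all := Check.novel.holds rows row }) (S := stk row row rows [] [] word)
      ⟨none, { all := false }, stk row row rows [] [] word⟩ fun b => by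
        have : rows.head?.isSome = true := by simpa [List.isSome_head?] using h₃.1
        simp [prog, h₃.2, this]
    refine (d₁.trans <| d₂.trans <| d₃.trans <| d₄.trans <| d₅.trans d₆).mono ?_
    simp only [List.append_nil, List.length_reverse, Check.outer, Check.inner, stk_row, stk_row',
      stk_rows]
    omega
  · have d₄ : machine.Det 1 _ _ := det_single (l := .verdict .consistent)
      (v := { all := Check.consistent.holds row row }) (S := stk row row rows [] [] word)
      ⟨none, { all := false }, stk row row rows [] [] word⟩ fun b => by simp [prog, h₂]
    refine (d₁.trans <| d₂.trans <| d₃.trans d₄).mono ?_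
    simp only [List.append_nil, List.length_reverse, Check.outer, Check.inner, stk_row, stk_row']
    omega

theorem det_closed (rows word : List Sym) :
    machine.Det (5 * (rows.length + rows.length + 1) ^ 3)
      (cfg (.outer .closed) {} (stk [] [] rows [] [] word))
      (⟨none, { all := Check.closed.holds rows rows }, stk [] [] rows [] [] word⟩ :
        Turing.TM2.Cfg (fun _ : Stk => Sym) Lab Reg) := by
  have d₁ := det_check .closed (stk [] [] rows [] [] word) (stk_cleared _ _ _ _ _)
  have d₂ : machine.Det 1 _ _ := det_single (l := .verdict .closed)
      (v := { all := Check.closed.holds rows rows }) (S := stk [] [] rows [] [] word)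
      ⟨none, { all := Check.closed.holds rows rows }, stk [] [] rows [] [] word⟩
      fun b => by simp [prog]
  refine (d₁.trans d₂).mono ?_
  simp only [Check.outer, Check.inner, stk_rows, stk_rows']
  have := Nat.one_le_pow 3 (rows.length + rows.length + 1) (by omega)
  omega

theorem step_main_iff (w : List Letter) (rows : List Sym) (c : machine.Cfg) :
    machine.Step (mainCfg w rows) c ↔
      c = cfg (.outer .closed) {} (stk [] [] rows [] [] (reversedWord w)) ∨ c = guessCfg w rows := by
  refine machine_step_iff.trans ?_
  rw [Bool.exists_bool, or_comm]
  rfl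

theorem acceptsFrom_halted_iff (v : Reg) (S : Stk → List Sym) :
    machine.AcceptsFrom (⟨none, v, S⟩ : Turing.TM2.Cfg (fun _ : Stk => Sym) Lab Reg) ↔
      v.all = true :=
  acceptsFrom_iff_of_halted rfl

theorem main_acceptsFrom_iff (w : List Letter) (rows : List Sym) :
    machine.AcceptsFrom (mainCfg w rows) ↔
      Check.closed.holds rows rows = true ∨ machine.AcceptsFrom (guessCfg w rows) := by
  rw [acceptsFrom_iff_exists_step (Option.some_ne_none _)]
  simp only [step_main_iff, or_and_right, exists_or, exists_eq_left]
  refine or_congr_left ?_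
  exact (det_closed rows _).acceptsFrom_iff.trans (acceptsFrom_halted_iff _ _)

theorem guessCfg_acceptsFrom_iff (w : List Letter) (rows : List Sym) :
    machine.AcceptsFrom (guessCfg w rows) ↔
      ∃ row, row.map Prod.fst = marked w ∧ Keeps rows row ∧
        machine.AcceptsFrom (mainCfg w (row ++ rows)) := by
  have hw : ((reversedWord w).map Prod.fst).reverse = marked w := by
    simp [reversedWord, marked, Function.comp_def]
  rw [guess_acceptsFrom_iff, hw]
  refine exists_congr fun row => and_congr_right fun hrow => ?_
  rw [List.append_nil]
  by_cases h : Keeps rows row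
  · rw [(det_keep w rows row hrow h).acceptsFrom_iff]
    simp [h]
  · obtain ⟨S, hS⟩ := det_not_keep rows row h
    rw [hS.acceptsFrom_iff, acceptsFrom_halted_iff]
    simp [h]


/-! ### Lists of kept rows: running time and acceptance -/

open NTM

/-- The lists of rows that the machine may produce on the input `w`, the last row first. -/
inductive Chain (w : List Letter) : List (List Sym) → Prop
  | nil : Chain w []
  | cons {rows : List (List Sym)} {row : List Sym} : Chain w rows → row.map Prod.fst = marked w →
      Keeps rows.flatten row → Chain w (row :: rows)

theorem Chain.map_fst {w : List Letter} {rows : List (List Sym)} (h : Chain w rows) :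
    ∀ r ∈ rows, r.map Prod.fst = marked w := by
  induction h with
  | nil => simp
  | cons _ hr _ ih => simpa using ⟨hr, ih⟩

theorem length_of_map_fst {w : List Letter} {row : List Sym} (h : row.map Prod.fst = marked w) :
    row.length = w.length + 1 := by
  simpa [marked] using congrArg List.length h

theorem Chain.length_flatten {w : List Letter} {rows : List (List Sym)} (h : Chain w rows) :
    rows.flatten.length = rows.length * (w.length + 1) := by
  induction h with
  | nil => simp
  | cons _ hr _ ih => simp [ih, length_of_map_fst hr, Nat.add_mul, Nat.add_comm]

/-- The budget is 1 and not 0, because `Within.step` charges a unit even to a configuration without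
successors. -/
theorem within_halted (v : Reg) (S : Stk → List Sym) :
    machine.Within ∅ 1 (⟨none, v, S⟩ : Turing.TM2.Cfg (fun _ : Stk => Sym) Lab Reg) :=
  .step fun _ h => absurd h (not_step_of_halted rfl)

/-- `k` counts the rounds that are still possible. For `k = 0` the list would already be longer than
`B`. -/
theorem guess_within_empty {w : List Letter} {B : ℕ}
    (hB : ∀ rows, Chain w rows → rows.length ≤ B) (k : ℕ) {rows : List (List Sym)}
    (h : Chain w rows) (hk : B < rows.length + k) :
    machine.Within ∅ (k * (70 * (2 * (B + 1) * (w.length + 1) + 1) ^ 3))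
      (guessCfg w rows.flatten) := by
  induction k generalizing rows with
  | zero => exact absurd (hB rows h) (by omega)
  | succ k ih =>
    -- `L` bounds the total length of the two lists in any comparison. A round costs at most `60 * L
    -- ^ 3` for testing and keeping a row, `5 * L ^ 3` for the final check, and a linear amount for
    -- the guess.
    set L := 2 * (B + 1) * (w.length + 1) + 1 with hL
    have hL1 : 2 * (w.length + 1) + 2 * (B * (w.length + 1)) + 1 = L := by rw [hL]; ring
    have hL3 : L ≤ L ^ 3 := Nat.le_self_pow (by norm_num) _
    have hword : (reversedWord w).length = w.length + 1 := by simp [reversedWord]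
    have hw : ((reversedWord w).map Prod.fst).reverse = marked w := by
      simp [reversedWord, marked, Function.comp_def]
    have hg := guess_within [] rows.flatten (reversedWord w)
    rw [hword, hw] at hg
    refine (hg.trans (t' := 60 * L ^ 3 + (5 * L ^ 3 + 1 + 1 + k * (70 * L ^ 3))) ?_).mono ?_
    · rintro _ ⟨row, hrow, rfl⟩
      rw [List.append_nil]
      have hlen := length_of_map_fst hrow
      have hflat : rows.flatten.length ≤ B * (w.length + 1) := by
        rw [h.length_flatten]; exact Nat.mul_le_mul_right _ (hB rows h)
      have h₁ : (row.length + rows.flatten.length + 1) ^ 3 ≤ L ^ 3 :=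
        Nat.pow_le_pow_left (by omega) 3
      have h₂ : (row.length + row.length + 1) ^ 3 ≤ L ^ 3 := Nat.pow_le_pow_left (by omega) 3
      by_cases hkeep : Keeps rows.flatten row
      · have hc : Chain w (row :: rows) := h.cons hrow hkeep
        have hd := det_keep w _ _ hrow hkeep
        refine (hd.mono (t' := 60 * L ^ 3) (by omega)).within ?_
        refine (Within.step (t := 5 * L ^ 3 + 1 + k * (70 * L ^ 3)) fun c hstep => ?_).mono
          (by omega)
        have hflat' : (row ++ rows.flatten).length ≤ B * (w.length + 1) := by
          have := hc.length_flatten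
          rw [List.flatten_cons] at this
          rw [this]; exact Nat.mul_le_mul_right _ (hB _ hc)
        rcases (step_main_iff w _ c).1 hstep with rfl | rfl
        · refine ((det_closed _ _).within (within_halted _ _)).mono ?_
          have : ((row ++ rows.flatten).length + (row ++ rows.flatten).length + 1) ^ 3 ≤ L ^ 3 :=
            Nat.pow_le_pow_left (by omega) 3
          omega
        · exact (ih hc (by simp only [List.length_cons]; omega)).mono (by omega)
      · obtain ⟨S, hS⟩ := det_not_keep _ _ hkeep
        exact (hS.within (within_halted _ S)).mono (by omega)
    · rw [Nat.add_mul k]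
      omega

/-- The machine halts in polynomial time in terms of the number of rows. -/
theorem machine_haltsWithin {w : List Letter} {B : ℕ}
    (hB : ∀ rows, Chain w rows → rows.length ≤ B) :
    machine.HaltsWithin w (80 * (2 * (B + 1) * (w.length + 1) + 1) ^ 4) := by
  refine haltsWithin_of_within (((det_init w).within
    (guess_within_empty hB (B + 1) .nil (by simp))).mono ?_)
  have hB1 : B + 1 ≤ 2 * (B + 1) * (w.length + 1) + 1 := by nlinarith
  have hw1 : w.length + 1 ≤ 2 * (B + 1) * (w.length + 1) + 1 := by nlinarith
  generalize 2 * (B + 1) * (w.length + 1) + 1 = L at *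
  have h₁ : (B + 1) * (70 * L ^ 3) ≤ 70 * L ^ 4 := by
    calc (B + 1) * (70 * L ^ 3) ≤ L * (70 * L ^ 3) := Nat.mul_le_mul_right _ hB1
      _ = 70 * L ^ 4 := by ring
  have h₂ : L ≤ L ^ 4 := Nat.le_self_pow (by norm_num) _
  omega

/-- The machine accepts if it may produce a nonempty list of rows that is closed. -/
theorem machine_accepts_iff {w : List Letter} {B : ℕ}
    (hB : ∀ rows, Chain w rows → rows.length ≤ B) :
    machine.Accepts w ↔ ∃ rows, rows ≠ [] ∧ Chain w rows ∧
      Check.closed.holds rows.flatten rows.flatten = true := by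
  rw [accepts_iff_acceptsFrom, (det_init w).acceptsFrom_iff]
  constructor
  · have key : ∀ (k : ℕ) (rows : List (List Sym)), Chain w rows → B < rows.length + k →
        machine.AcceptsFrom (guessCfg w rows.flatten) → ∃ rows, rows ≠ [] ∧ Chain w rows ∧
          Check.closed.holds rows.flatten rows.flatten = true := by
      intro k
      induction k with
      | zero => exact fun rows h hk => absurd (hB rows h) (by omega)
      | succ k ih =>
        intro rows h hk hacc
        obtain ⟨row, hrow, hkeep, hacc⟩ := (guessCfg_acceptsFrom_iff w _).1 hacc
        have hc : Chain w (row :: rows) := h.cons hrow hkeep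
        rcases (main_acceptsFrom_iff w _).1 hacc with hacc | hacc
        · exact ⟨row :: rows, by simp, hc, hacc⟩
        · exact ih _ hc (by simp only [List.length_cons]; omega) hacc
    exact key (B + 1) [] .nil (by simp)
  · rintro ⟨rows, hne, hc, hcl⟩
    -- The list is undone row by row: at `main`, after each proper nonempty part of it, the
    -- accepting path chooses to guess again.
    have key : ∀ rows, Chain w rows → rows ≠ [] →
        machine.AcceptsFrom (mainCfg w rows.flatten) → machine.AcceptsFrom (guessCfg w []) := by
      intro rows hc
      induction hc with
      | nil => exact fun h => absurd rfl h
      | @cons rows row hc hrow hkeep ih =>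
        intro _ hacc
        have hg := (guessCfg_acceptsFrom_iff w rows.flatten).2 ⟨row, hrow, hkeep, hacc⟩
        rcases eq_or_ne rows [] with rfl | hne
        · exact hg
        · exact ih hne ((main_acceptsFrom_iff w _).2 (.inr hg))
    exact key rows hc hne ((main_acceptsFrom_iff w _).2 (.inl hcl))


/-! ## Annotated formulas -/

/-- The last entry of a list of bits, with a default value. -/
def endBit : Bool → List Bool → Bool
  | e, [] => e
  | _, c :: l => endBit c l

/-- Numerals are written with the least significant bit first, so the last bit is the leading one
and equals `true`. -/
theorem endBit_encodePosNum (e : Bool) (n : PosNum) :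
    endBit e (Computability.encodePosNum n) = true := by
  induction n generalizing e with
  | one => rfl
  | bit0 n ih => exact ih _
  | bit1 n ih => exact ih _

theorem endBit_encodeNat (n : ℕ) : endBit true (Computability.encodeNat n) = true := by
  unfold Computability.encodeNat
  cases (n : Num) with
  | zero => rfl
  | pos n => exact endBit_encodePosNum _ n

theorem exists_encodePosNum_eq (c : Bool) (l : List Bool) (h : endBit c l = true) :
    ∃ n, Computability.encodePosNum n = c :: l := by
  induction l generalizing c with
  | nil =>
    obtain rfl : c = true := h
    exact ⟨.one, rfl⟩
  | cons d l ih =>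
    obtain ⟨n, hn⟩ := ih d h
    cases c with
    | false => exact ⟨.bit0 n, by rw [Computability.encodePosNum, hn]⟩
    | true => exact ⟨.bit1 n, by rw [Computability.encodePosNum, hn]⟩

/-- The default `true` admits the empty list, which is the numeral of 0. The finite control of the
parser thus recognises exactly the numerals. -/
theorem exists_encodeNat_eq (l : List Bool) (h : endBit true l = true) :
    ∃ n, Computability.encodeNat n = l := by
  cases l with
  | nil => exact ⟨0, rfl⟩
  | cons c l =>
    obtain ⟨n, hn⟩ := exists_encodePosNum_eq c l h
    refine ⟨((Num.pos n : Num) : ℕ), ?_⟩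
    rw [Computability.encodeNat, Num.of_to_nat]
    exact hn

/-- An annotated bit of a variable name. -/
def bitSym (c : Bool) : Sym := (some (.bit c), false)

/-- A variable, annotated with a truth value. -/
def annVar (q : ℕ × Bool) : List Sym :=
  (Computability.encodeNat q.1).map bitSym ++ [(some .sep, q.2)]

/-- A list of pairs of variables, annotated with truth values. -/
def annPairs (T : List ((ℕ × Bool) × ℕ × Bool)) : List Sym :=
  T.flatMap fun q => annVar q.1 ++ annVar q.2

/-- `Ann V φ p r`: the list `r` is an annotation of the formula `φ`, which is active if `p` is true,
in which only those truth values are assigned to a variable that are allowed by `V`. -/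
inductive Ann (V : ℕ → Bool → Prop) : PInc → Bool → List Sym → Prop
  | top (p : Bool) : Ann V top p [(some .top, false)]
  | bot : Ann V bot false [(some .bot, false)]
  | var {x : ℕ} {p b : Bool} : V x b → (p = true → b = true) →
      Ann V (var x) p ((some .pos, false) :: annVar (x, b))
  | neg {x : ℕ} {p b : Bool} : V x b → (p = true → b = false) →
      Ann V (neg x) p ((some .neg, false) :: annVar (x, b))
  | or {φ ψ : PInc} {p : Bool} (b : Bool) {r s : List Sym} : Ann V φ (p && !b) r →
      Ann V ψ (p && b) s → Ann V (or φ ψ) p ((some .or, b) :: (r ++ s))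
  | and {φ ψ : PInc} {p : Bool} {r s : List Sym} : Ann V φ p r → Ann V ψ p s →
      Ann V (and φ ψ) p ((some .and, false) :: (r ++ s))
  | inc {n : ℕ} {x y : Fin n → ℕ} (p : Bool) {T : List ((ℕ × Bool) × ℕ × Bool)} :
      T.map (·.1.1) = List.ofFn x → T.map (·.2.1) = List.ofFn y →
      (∀ q ∈ T, V q.1.1 q.1.2 ∧ V q.2.1 q.2.2) →
      Ann V (inc x y) p ((some .inc, p) :: (annPairs T ++ [(some .fin, false)]))

theorem map_fst_annVar (q : ℕ × Bool) : (annVar q).map Prod.fst = (encodeVar q.1).map some := by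
  simp [annVar, encodeVar, bitSym, Function.comp_def]

theorem map_fst_annPairs {n : ℕ} {x y : Fin n → ℕ} {T : List ((ℕ × Bool) × ℕ × Bool)}
    (hx : T.map (·.1.1) = List.ofFn x) (hy : T.map (·.2.1) = List.ofFn y) :
    (annPairs T).map Prod.fst =
      ((List.ofFn fun i => encodeVar (x i) ++ encodeVar (y i)).flatten).map some := by
  have h : T.map (fun q => encodeVar q.1.1 ++ encodeVar q.2.1) =
      List.ofFn fun i => encodeVar (x i) ++ encodeVar (y i) := by
    have hn : T.length = n := by simpa using congrArg List.length hx
    apply List.ext_getElem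
    · simpa using hn
    · intro i h₁ h₂
      have hi : i < T.length := by simpa using h₁
      have e₁ : T[i].1.1 = x ⟨i, hn ▸ hi⟩ := by
        have := List.getElem_of_eq hx (i := i) (by simpa using hi)
        rwa [List.getElem_map, List.getElem_ofFn] at this
      have e₂ : T[i].2.1 = y ⟨i, hn ▸ hi⟩ := by
        have := List.getElem_of_eq hy (i := i) (by simpa using hi)
        rwa [List.getElem_map, List.getElem_ofFn] at this
      simp [e₁, e₂]
  rw [← h, annPairs]
  simp [List.flatMap, List.map_flatten, Function.comp_def, map_fst_annVar]

theorem Ann.map_fst {V : ℕ → Bool → Prop} {φ : PInc} {p : Bool} {r : List Sym} (h : Ann V φ p r) :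
    r.map Prod.fst = (encode φ).map some := by
  induction h with
  | top => rfl
  | bot => rfl
  | var => simp [encode, map_fst_annVar]
  | neg => simp [encode, map_fst_annVar]
  | or _ _ _ ih₁ ih₂ => simp [encode, ih₁, ih₂]
  | and _ _ ih₁ ih₂ => simp [encode, ih₁, ih₂]
  | inc p hx hy hV => simp [encode, map_fst_annPairs hx hy]

/-! ### The parser -/

theorem parse_dead (l : List Bool) (r : List Sym) : parse .dead l r = .dead := by
  induction r with
  | nil => rfl
  | cons s r ih => exact ih

theorem parse_form_nil {r : List Sym} (h : parse .form [] r = .done) : r = [(none, false)] := by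
  have hd : ∀ r, parse .done [] r = .done → r = [] := by
    intro r h
    cases r with
    | nil => rfl
    | cons s r =>
      have : parse .dead [] r = .done := h
      simp [parse_dead] at this
  cases r with
  | nil => cases h
  | cons s r =>
    have h' : parse (.closing s) [] r = .done := h
    unfold Parser.closing at h'
    split at h'
    · rw [hd r h']
    · simp [parse_dead] at h'

theorem parse_lit_bits (p v e : Bool) (l bits : List Bool) (r : List Sym) :
    parse (.lit p v e) l (bits.map bitSym ++ r) = parse (.lit p v (endBit e bits)) l r := by
  induction bits generalizing e with
  | nil => rfl
  | cons c bits ih => exact ih c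

theorem parse_name_bits (s e : Bool) (l bits : List Bool) (r : List Sym) :
    parse (.name s e) l (bits.map bitSym ++ r) = parse (.name s (endBit e bits)) l r := by
  induction bits generalizing e with
  | nil => rfl
  | cons c bits ih => exact ih c

theorem parse_annVar_lit {x : ℕ} {b p v : Bool} (h : p = true → b = v) (l : List Bool)
    (r : List Sym) : parse (.lit p v true) l (annVar (x, b) ++ r) = parse .form l r := by
  rw [annVar, List.append_assoc, parse_lit_bits, endBit_encodeNat]
  have : (!p || b == v) = true := by
    cases p with
    | false => rfl
    | true => simp [h rfl]
  simp [parse, Parser.next, Parser.inner, this]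

theorem parse_annVar_tuple (q : ℕ × Bool) (s : Bool) (l : List Bool) (r : List Sym) :
    parse (.tuple s) l (annVar q ++ r) = parse (.tuple !s) l r := by
  have h := endBit_encodeNat q.1
  rw [annVar, List.append_assoc]
  cases hx : Computability.encodeNat q.1 with
  | nil => rfl
  | cons c bits =>
    rw [hx] at h
    have h' : endBit c bits = true := h
    change parse (.name s c) l (bits.map bitSym ++ _) = _
    rw [parse_name_bits, h']
    simp [parse, Parser.next, Parser.inner]

theorem parse_annPairs (T : List ((ℕ × Bool) × ℕ × Bool)) (l : List Bool) (r : List Sym) :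
    parse (.tuple false) l (annPairs T ++ (some .fin, false) :: r) = parse .form l r := by
  induction T with
  | nil => rfl
  | cons q T ih =>
    simp only [annPairs, List.flatMap_cons, List.append_assoc] at ih ⊢
    rw [parse_annVar_tuple, parse_annVar_tuple]
    exact ih

/-- The parser accepts annotated formulas. -/
theorem Ann.parse {V : ℕ → Bool → Prop} {φ : PInc} {p : Bool} {r : List Sym} (h : Ann V φ p r)
    (l : List Bool) (s : List Sym) :
    PInc.parse .form (p :: l) (r ++ s) = PInc.parse .form l s := by
  induction h generalizing l s with
  | top => rfl
  | bot => rfl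
  | var _ hb => exact parse_annVar_lit hb l s
  | neg _ hb => exact parse_annVar_lit hb l s
  | @or φ ψ p b r₁ r₂ _ _ ih₁ ih₂ =>
    rw [List.cons_append, List.append_assoc]
    exact (ih₁ ((p && b) :: l) (r₂ ++ s)).trans (ih₂ l s)
  | @and φ ψ p r₁ r₂ _ _ ih₁ ih₂ =>
    rw [List.cons_append, List.append_assoc]
    exact (ih₁ (p :: l) (r₂ ++ s)).trans (ih₂ l s)
  | @inc n x y p T =>
    rw [← parse_annPairs T l s]
    simp [PInc.parse, Parser.next, Parser.atom]

theorem exists_of_parse_lit {p v e : Bool} {l : List Bool} {r : List Sym}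
    (h : parse (.lit p v e) l r = .done) : ∃ (bits : List Bool) (b : Bool) (s : List Sym),
      r = bits.map bitSym ++ (some .sep, b) :: s ∧ endBit e bits = true ∧ (p = true → b = v) ∧
        parse .form l s = .done := by
  induction r generalizing e with
  | nil => cases h
  | cons s r ih =>
    obtain ⟨_ | a, b⟩ := s
    · rw [parse] at h; simp [Parser.next, Parser.inner, parse_dead] at h
    cases a with
    | bit c =>
      cases b with
      | true => rw [parse] at h; simp [Parser.next, Parser.inner, parse_dead] at h
      | false =>
        obtain ⟨bits, b, s, rfl, h₁, h₂⟩ := ih (e := c) h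
        exact ⟨c :: bits, b, s, rfl, h₁, h₂⟩
    | sep =>
      rw [parse] at h
      by_cases he : (e && (!p || b == v)) = true
      · have he' : e = true ∧ (p = true → b = v) := by
          revert he; cases e <;> cases p <;> simp
        simp only [Parser.next, Parser.inner, he, if_true] at h
        exact ⟨[], b, r, rfl, he'.1, he'.2, h⟩
      · simp [Parser.next, Parser.inner, he, parse_dead] at h
    | _ => rw [parse] at h; simp [Parser.next, Parser.inner, parse_dead] at h

theorem exists_of_parse_name {t e : Bool} {l : List Bool} {r : List Sym}
    (h : parse (.name t e) l r = .done) : ∃ (bits : List Bool) (b : Bool) (s : List Sym),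
      r = bits.map bitSym ++ (some .sep, b) :: s ∧ endBit e bits = true ∧
        parse (.tuple !t) l s = .done := by
  induction r generalizing e with
  | nil => cases h
  | cons s r ih =>
    obtain ⟨_ | a, b⟩ := s
    · rw [parse] at h; simp [Parser.next, Parser.inner, parse_dead] at h
    cases a with
    | bit c =>
      cases b with
      | true => rw [parse] at h; simp [Parser.next, Parser.inner, parse_dead] at h
      | false =>
        obtain ⟨bits, b, s, rfl, h₁, h₂⟩ := ih (e := c) h
        exact ⟨c :: bits, b, s, rfl, h₁, h₂⟩
    | sep =>
      rw [parse] at h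
      cases e with
      | true => exact ⟨[], b, r, rfl, rfl, h⟩
      | false => simp [Parser.next, Parser.inner, parse_dead] at h
    | _ => rw [parse] at h; simp [Parser.next, Parser.inner, parse_dead] at h

theorem exists_of_parse_tuple {t : Bool} {l : List Bool} {r : List Sym}
    (h : parse (.tuple t) l r = .done) :
    (t = false ∧ ∃ s, r = (some .fin, false) :: s ∧ parse .form l s = .done) ∨
      ∃ q s, r = annVar q ++ s ∧ parse (.tuple !t) l s = .done := by
  cases r with
  | nil => cases h
  | cons s r =>
    obtain ⟨_ | a, b⟩ := s
    · rw [parse] at h; simp [Parser.next, Parser.inner, parse_dead] at h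
    cases a with
    | bit c =>
      cases b with
      | true => rw [parse] at h; simp [Parser.next, Parser.inner, parse_dead] at h
      | false =>
        obtain ⟨bits, b, s, rfl, h₁, h₂⟩ := exists_of_parse_name (t := t) (e := c) h
        obtain ⟨x, hx⟩ := exists_encodeNat_eq (c :: bits) h₁
        exact .inr ⟨(x, b), s, by simp [annVar, hx, bitSym], h₂⟩
    | sep => exact .inr ⟨(0, b), r, rfl, h⟩
    | fin =>
      cases b <;> cases t
      · exact .inl ⟨rfl, r, rfl, h⟩
      all_goals rw [parse] at h; simp [Parser.next, Parser.inner, parse_dead] at h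
    | _ => rw [parse] at h; simp [Parser.next, Parser.inner, parse_dead] at h

theorem length_annVar_pos (q : ℕ × Bool) : 0 < (annVar q).length := by simp [annVar]

theorem exists_of_parse_tuple_false {l : List Bool} {r : List Sym}
    (h : parse (.tuple false) l r = .done) :
    ∃ T s, r = annPairs T ++ (some .fin, false) :: s ∧ parse .form l s = .done := by
  induction hn : r.length using Nat.strong_induction_on generalizing r with
  | _ n ih =>
    rcases exists_of_parse_tuple h with ⟨-, s, rfl, hs⟩ | ⟨q, s, rfl, hs⟩
    · exact ⟨[], s, rfl, hs⟩
    · rcases exists_of_parse_tuple hs with ⟨h, -⟩ | ⟨q', s', rfl, hs'⟩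
      · cases h
      · have := length_annVar_pos q
        obtain ⟨T, s, rfl, h₀⟩ := ih _ (by simp at hn; omega) hs' rfl
        exact ⟨(q, q') :: T, s, by simp [annPairs], h₀⟩

/-- The parser accepts only annotated formulas. -/
theorem exists_of_parse_form {p : Bool} {l : List Bool} {r : List Sym}
    (h : parse .form (p :: l) r = .done) : ∃ φ r₁ r₂, r = r₁ ++ r₂ ∧ r₁ ≠ [] ∧
      Ann (fun _ _ => True) φ p r₁ ∧ parse .form l r₂ = .done := by
  induction hn : r.length using Nat.strong_induction_on generalizing r p l with
  | _ n ih =>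
  cases r with
  | nil => cases h
  | cons s r =>
    obtain ⟨_ | a, b⟩ := s
    · rw [parse] at h; simp [Parser.next, Parser.atom, parse_dead] at h
    have lit : ∀ v, parse (.lit p v true) l r = .done → ∃ x c s, r = annVar (x, c) ++ s ∧
        (p = true → c = v) ∧ parse .form l s = .done := by
      intro v h
      obtain ⟨bits, c, s, rfl, h₁, h₂, h₃⟩ := exists_of_parse_lit h
      obtain ⟨x, hx⟩ := exists_encodeNat_eq bits h₁
      exact ⟨x, c, s, by simp [annVar, hx], h₂, h₃⟩
    have two : ∀ p₁ p₂, parse .form (p₁ :: p₂ :: l) r = .done → ∃ φ ψ r₁ r₂ s, r = r₁ ++ r₂ ++ s ∧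
        Ann (fun _ _ => True) φ p₁ r₁ ∧ Ann (fun _ _ => True) ψ p₂ r₂ ∧
          parse .form l s = .done := by
      intro p₁ p₂ h
      obtain ⟨φ, r₁, r₂, rfl, hne, hφ, h⟩ := ih _ (by simp at hn; omega) h rfl
      obtain ⟨ψ, r₂, s, rfl, -, hψ, h⟩ := ih _ (by
        have := List.length_pos_iff.2 hne
        simp at hn; omega) h rfl
      exact ⟨φ, ψ, r₁, r₂, s, by simp, hφ, hψ, h⟩
    cases a with
    | bot =>
      cases b <;> cases p
      · exact ⟨_, _, r, rfl, by simp, .bot, h⟩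
      all_goals rw [parse] at h; simp [Parser.next, Parser.atom, parse_dead] at h
    | or =>
      obtain ⟨φ, ψ, r₁, r₂, s, rfl, hφ, hψ, h'⟩ := two _ _ h
      exact ⟨_, _, s, by simp, by simp, hφ.or b hψ, h'⟩
    | inc =>
      by_cases hb : b = p
      · subst hb
        rw [parse] at h
        simp only [Parser.next, Parser.atom, if_true] at h
        obtain ⟨T, s, rfl, h'⟩ := exists_of_parse_tuple_false h
        refine ⟨.inc (fun i : Fin T.length => T[i].1.1) fun i => T[i].2.1, _, s, ?_, ?_,
          .inc b (T := T) ?_ ?_ (by simp), h'⟩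
        · simp
        · simp
        · exact List.ext_getElem (by simp) (by simp)
        · exact List.ext_getElem (by simp) (by simp)
      · rw [parse] at h
        simp [Parser.next, Parser.atom, hb, parse_dead] at h
    | _ =>
      cases b with
      | true => rw [parse] at h; simp [Parser.next, Parser.atom, parse_dead] at h
      | false =>
        first
        | (rw [parse] at h; simp [Parser.next, Parser.atom, parse_dead] at h; done)
        | exact ⟨_, _, r, rfl, by simp, .top p, h⟩
        | (obtain ⟨x, c, s, rfl, hc, h'⟩ := lit true h
           exact ⟨_, _, s, rfl, by simp, .var trivial hc, h'⟩)
        | (obtain ⟨x, c, s, rfl, hc, h'⟩ := lit false h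
           exact ⟨_, _, s, rfl, by simp, .neg trivial hc, h'⟩)
        | (obtain ⟨φ, ψ, r₁, r₂, s, rfl, hφ, hψ, h'⟩ := two p p h
           exact ⟨_, _, s, by simp, by simp, hφ.and hψ, h'⟩)

/-- The parser accepts the annotations of formulas that are closed by the end mark. -/
theorem parse_eq_done_iff {r : List Sym} : parse .form [true] r = .done ↔
    ∃ φ s, Ann (fun _ _ => True) φ true s ∧ r = s ++ [(none, false)] := by
  constructor
  · intro h
    obtain ⟨φ, r₁, r₂, rfl, -, hφ, h⟩ := exists_of_parse_form h
    exact ⟨φ, r₁, hφ, by rw [parse_form_nil h]⟩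
  · rintro ⟨φ, s, h, rfl⟩
    rw [h.parse]
    rfl


/-! ### The comparisons -/

theorem Check.finds_iff {c : Check} {u v : List Sym} :
    c.finds u v = true ↔ ∃ v', v' ≠ [] ∧ v' <:+ v ∧ c.run .start u v' = .good := by
  have hacc : ∀ q : Sync, q.accept = true ↔ q = .good := by rintro ⟨⟩ <;> simp [Sync.accept]
  induction v with
  | nil => simp +contextual [Check.finds]
  | cons s v ih =>
    simp only [Check.finds, Bool.or_eq_true, ih, hacc]
    constructor
    · rintro (h | ⟨v', h₁, h₂, h₃⟩)
      · exact ⟨_, by simp, List.suffix_rfl, h⟩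
      · exact ⟨v', h₁, h₂.trans (List.suffix_cons s v), h₃⟩
    · rintro ⟨v', h₁, h₂, h₃⟩
      rcases List.suffix_cons_iff.1 h₂ with rfl | h₂
      · exact .inl h₃
      · exact .inr ⟨v', h₁, h₂, h₃⟩

theorem Check.holds_iff {c : Check} {u v : List Sym} :
    c.holds v u = true ↔ ∀ u', u' ≠ [] → u' <:+ u → c.sign (c.finds u' v) = true := by
  induction u with
  | nil => simp +contextual [Check.holds]
  | cons s u ih =>
    rw [Check.holds, Bool.and_eq_true, ih]
    constructor
    · rintro ⟨h₁, h₂⟩ u' hne hu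
      rcases List.suffix_cons_iff.1 hu with rfl | hu
      · exact h₁
      · exact h₂ u' hne hu
    · exact fun h => ⟨h _ (by simp) List.suffix_rfl,
        fun u' hne hu => h u' hne (hu.trans (List.suffix_cons s u))⟩

theorem Check.run_good (c : Check) (u v : List Sym) : c.run .good u v = .good := by
  induction u generalizing v with
  | nil => rfl
  | cons s u ih =>
    cases v with
    | nil => rfl
    | cons s' v => cases c <;> exact ih v

theorem Check.run_bad (c : Check) (u v : List Sym) : c.run .bad u v = .bad := by
  induction u generalizing v with
  | nil => rfl
  | cons s u ih =>
    cases v with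
    | nil => rfl
    | cons s' v => cases c <;> exact ih v

theorem suffix_append_iff {α : Type*} {u a b : List α} :
    u <:+ a ++ b ↔ u <:+ b ∨ ∃ u', u' <:+ a ∧ u = u' ++ b := by
  constructor
  · rintro ⟨t, ht⟩
    rcases List.append_eq_append_iff.1 ht with ⟨c, rfl, rfl⟩ | ⟨c, rfl, rfl⟩
    · exact .inr ⟨c, List.suffix_append _ _, rfl⟩
    · exact .inl (List.suffix_append _ _)
  · rintro (h | ⟨u', ⟨t, rfl⟩, rfl⟩)
    · exact h.trans (List.suffix_append _ _)
    · exact ⟨t, by simp⟩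

theorem suffix_flatten {α : Type*} {C : List (List α)} {u : List α} (hne : u ≠ [])
    (h : u <:+ C.flatten) : ∃ r ∈ C, ∃ u' R, u' ≠ [] ∧ u' <:+ r ∧ u = u' ++ R := by
  induction C with
  | nil => exact absurd (List.suffix_nil.1 h) hne
  | cons r C ih =>
    rw [List.flatten_cons, suffix_append_iff] at h
    rcases h with h | ⟨u', hu', rfl⟩
    · obtain ⟨r, hr, h⟩ := ih h
      exact ⟨r, by simp [hr], h⟩
    · rcases eq_or_ne u' [] with rfl | hne'
      · obtain ⟨r, hr, h⟩ := ih (by simp)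
        exact ⟨r, by simp [hr], h⟩
      · exact ⟨r, by simp, u', _, hne', hu', rfl⟩

theorem exists_suffix_flatten {α : Type*} {C : List (List α)} {r u : List α} (hr : r ∈ C)
    (h : u <:+ r) : ∃ R, u ++ R <:+ C.flatten := by
  induction C with
  | nil => simp at hr
  | cons s C ih =>
    rcases List.mem_cons.1 hr with rfl | hr
    · exact ⟨C.flatten, suffix_append_iff.2 (.inr ⟨u, h, rfl⟩)⟩
    · obtain ⟨R, hR⟩ := ih hr
      exact ⟨R, hR.trans (List.suffix_append _ _)⟩

/-! #### Consistency -/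

theorem run_name (bits : List Bool) (a b : Bool) (u v : List Sym) (h : a ≠ b) :
    Check.consistent.run .name (bits.map bitSym ++ (some .sep, a) :: u)
      (bits.map bitSym ++ (some .sep, b) :: v) = .good := by
  induction bits with
  | nil =>
    rw [List.map_nil, List.nil_append, List.nil_append, Check.run]
    simpa [Check.next, Sync.conflict, h] using Check.run_good .consistent u v
  | cons c bits ih => simpa [Check.run, Check.next, Sync.conflict, bitSym] using ih

/-- The letter in front makes both readings start at the beginning of a name; otherwise a name could
be matched with the tail of a longer one. -/
theorem run_conflict {s s' : Sym} (hs : opens s.1 = true) (hs' : opens s'.1 = true) (x : ℕ)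
    {a b : Bool} (h : a ≠ b) (u v : List Sym) :
    Check.consistent.run .start (s :: (annVar (x, a) ++ u)) (s' :: (annVar (x, b) ++ v)) =
      .good := by
  rw [Check.run]
  simpa [Check.next, Sync.conflict, hs, hs', annVar] using run_name _ a b u v h

theorem exists_of_run_name {u v : List Sym} (h : Check.consistent.run .name u v = .good) :
    ∃ (bits : List Bool) (l l' : List Sym) (a b : Bool) (u' v' : List Sym),
      u = l ++ (some .sep, a) :: u' ∧ v = l' ++ (some .sep, b) :: v' ∧
      l.map Prod.fst = bits.map (fun c => some (.bit c)) ∧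
      l'.map Prod.fst = bits.map (fun c => some (.bit c)) ∧ a ≠ b := by
  induction u generalizing v with
  | nil => cases h
  | cons s u ih =>
    cases v with
    | nil => cases h
    | cons s' v =>
      obtain ⟨x, a⟩ := s
      obtain ⟨y, b⟩ := s'
      rw [Check.run] at h
      by_cases hxy : x = y
      · subst hxy
        have bad : ∀ q, q = Sync.bad → Check.consistent.run q u v ≠ .good := by
          rintro _ rfl; simp [Check.run_bad]
        rcases x with _ | x
        · exact absurd h (bad _ (by simp [Check.next, Sync.conflict]))
        cases x with
        | bit c =>
          simp only [Check.next, Sync.conflict, ne_eq, not_true_eq_false, if_false] at h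
          obtain ⟨bits, l, l', a', b', u', v', rfl, rfl, h₁, h₂, h₃⟩ := ih h
          exact ⟨c :: bits, (some (.bit c), a) :: l, (some (.bit c), b) :: l', a', b', u', v', rfl,
            rfl, by simp [h₁], by simp [h₂], h₃⟩
        | sep =>
          by_cases hab : a = b
          · exact absurd h (bad _ (by simp [Check.next, Sync.conflict, hab]))
          · exact ⟨[], [], [], a, b, u, v, rfl, rfl, rfl, rfl, hab⟩
        | _ => exact absurd h (bad _ (by simp [Check.next, Sync.conflict]))
      · simp [Check.next, Sync.conflict, hxy, Check.run_bad] at h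

theorem exists_of_run_conflict {u v : List Sym} (h : Check.consistent.run .start u v = .good) :
    ∃ (s s' : Sym) (u' v' : List Sym), u = s :: u' ∧ v = s' :: v' ∧ opens s.1 = true ∧
      opens s'.1 = true ∧ Check.consistent.run .name u' v' = .good := by
  cases u with
  | nil => cases h
  | cons s u =>
    cases v with
    | nil => cases h
    | cons s' v =>
      rw [Check.run] at h
      by_cases hs : opens s.1 = true ∧ opens s'.1 = true
      · simp only [Check.next, Sync.conflict, hs, and_self, if_true] at h
        exact ⟨s, s', u, v, rfl, rfl, hs.1, hs.2, h⟩
      · simp [Check.next, Sync.conflict, hs, Check.run_bad] at h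

/-- The variable `x` occurs with the truth value `b`. -/
def Occurs (x : ℕ) (b : Bool) (r : List Sym) : Prop :=
  ∃ (pre : List Sym) (s : Sym) (post : List Sym), opens s.1 = true ∧
    r = pre ++ s :: (annVar (x, b) ++ post)

theorem Occurs.of_append {x : ℕ} {b : Bool} {r : List Sym} (h : Occurs x b r) (l l' : List Sym) :
    Occurs x b (l ++ r ++ l') := by
  obtain ⟨pre, s, post, hs, rfl⟩ := h
  exact ⟨l ++ pre, s, post ++ l', hs, by simp⟩

theorem occurs_annPairs {T : List ((ℕ × Bool) × ℕ × Bool)} {q : (ℕ × Bool) × ℕ × Bool}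
    (hq : q ∈ T) {s : Sym} (hs : opens s.1 = true) (z : List Sym) :
    Occurs q.1.1 q.1.2 (s :: (annPairs T ++ z)) ∧ Occurs q.2.1 q.2.2 (s :: (annPairs T ++ z)) := by
  induction T generalizing s with
  | nil => simp at hq
  | cons q' T ih =>
    rcases List.mem_cons.1 hq with rfl | hq
    · exact ⟨⟨[], s, annVar q.2 ++ (annPairs T ++ z), hs, by simp [annPairs]⟩,
        ⟨s :: (Computability.encodeNat q.1.1).map bitSym, (some .sep, q.1.2), annPairs T ++ z, rfl,
          by simp [annPairs, annVar]⟩⟩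
    · have h : s :: (annPairs (q' :: T) ++ z) =
          s :: (annVar q'.1 ++ (Computability.encodeNat q'.2.1).map bitSym) ++
            (some .sep, q'.2.2) :: (annPairs T ++ z) ++ [] := by simp [annPairs, annVar]
      rw [h]
      obtain ⟨h₁, h₂⟩ := ih hq (s := (some .sep, q'.2.2)) rfl
      exact ⟨h₁.of_append _ _, h₂.of_append _ _⟩

/-- The condition on truth values concerns occurrences in the list only. This is how an assignment
read off from a row becomes one that the row annotates. -/
theorem Ann.of_occurs {V V' : ℕ → Bool → Prop} {φ : PInc} {p : Bool} {r : List Sym}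
    (h : Ann V φ p r) (hV : ∀ x b, Occurs x b r → V' x b) : Ann V' φ p r := by
  induction h with
  | top p => exact .top p
  | bot => exact .bot
  | var _ hb => exact .var (hV _ _ ⟨[], (some .pos, false), [], rfl, by simp⟩) hb
  | neg _ hb => exact .neg (hV _ _ ⟨[], (some .neg, false), [], rfl, by simp⟩) hb
  | @or φ ψ p b r₁ r₂ _ _ ih₁ ih₂ =>
    refine .or b (ih₁ fun x c h => hV x c ?_) (ih₂ fun x c h => hV x c ?_)
    · exact h.of_append [_] _
    · simpa using h.of_append ((some .or, b) :: r₁) []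
  | @and φ ψ p r₁ r₂ _ _ ih₁ ih₂ =>
    refine .and (ih₁ fun x c h => hV x c ?_) (ih₂ fun x c h => hV x c ?_)
    · exact h.of_append [_] _
    · simpa using h.of_append ((some .and, false) :: r₁) []
  | inc p hx hy _ =>
    refine .inc p hx hy fun q hq => ?_
    have := occurs_annPairs hq (s := (some .inc, p)) rfl [(some .fin, false)]
    exact ⟨hV _ _ this.1, hV _ _ this.2⟩

/-- What follows after a letter that opens a variable is a variable with an allowed truth value. -/
def Reads (V : ℕ → Bool → Prop) (u : List Sym) : Prop :=
  ∀ (s : Sym) (l : List Sym) (bits : List Bool) (a : Bool) (u' : List Sym),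
    u = s :: (l ++ (some .sep, a) :: u') → l.map Prod.fst = bits.map (fun c => some (.bit c)) →
      opens s.1 = true → ∃ x, Computability.encodeNat x = bits ∧ V x a

/-- The list begins with a letter that does not belong to a variable. -/
def Neutral (u : List Sym) : Prop :=
  ∃ s u', u = s :: u' ∧ s.1 ≠ some .sep ∧ ∀ c, s.1 ≠ some (.bit c)

/-- A separator opens the next variable of a tuple, but it may also close the last variable of an
atom or a literal. In the latter case the text goes on with a neutral letter, so no name is read by
mistake. -/
theorem Neutral.reads_cons {V : ℕ → Bool → Prop} {u : List Sym} (h : Neutral u) (s : Sym) :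
    Reads V (s :: u) := by
  obtain ⟨s₀, u₀, rfl, h₁, h₂⟩ := h
  intro s' l bits a u' hu hl _
  exfalso
  cases l with
  | nil =>
    simp only [List.nil_append, List.cons.injEq] at hu
    exact h₁ (by rw [hu.2.1])
  | cons s₁ l =>
    cases bits with
    | nil => simp at hl
    | cons c bits =>
      simp only [List.cons_append, List.cons.injEq, List.map_cons] at hu hl
      exact h₂ c (by rw [hu.2.1, hl.1])

theorem reads_cons_of_not_opens {V : ℕ → Bool → Prop} {s : Sym} (h : opens s.1 = false)
    (u : List Sym) : Reads V (s :: u) := by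
  intro s' l bits a u' hu _ hs
  simp only [List.cons.injEq] at hu
  rw [← hu.1, h] at hs
  cases hs

theorem reads_annVar {V : ℕ → Bool → Prop} {q : ℕ × Bool} (h : V q.1 q.2) (s : Sym)
    (u : List Sym) : Reads V (s :: (annVar q ++ u)) := by
  intro s' l bits a u' hu hl _
  have key : ∀ (b : List Bool) (l : List Sym) (bits : List Bool),
      b.map bitSym ++ (some .sep, q.2) :: u = l ++ (some .sep, a) :: u' →
        l.map Prod.fst = bits.map (fun c => some (.bit c)) → b = bits ∧ q.2 = a := by
    intro b
    induction b with
    | nil =>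
      intro l bits h hl
      cases l with
      | nil =>
        obtain rfl : bits = [] := by simpa using hl
        simp only [List.map_nil, List.nil_append, List.cons.injEq, Prod.mk.injEq] at h
        exact ⟨rfl, h.1.2⟩
      | cons s₁ l =>
        cases bits with
        | nil => simp at hl
        | cons c bits =>
          simp only [List.map_nil, List.nil_append, List.cons_append, List.cons.injEq,
            List.map_cons] at h hl
          rw [← h.1] at hl
          simp at hl
    | cons c b ih =>
      intro l bits h hl
      cases l with
      | nil => simp [bitSym] at h
      | cons s₁ l =>
        cases bits with
        | nil => simp at hl
        | cons d bits =>
          simp only [List.cons_append, List.cons.injEq, List.map_cons] at h hl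
          obtain ⟨h₁, h₂⟩ := ih l bits h.2 hl.2
          rw [← h.1] at hl
          simp only [bitSym, Option.some.injEq, Letter.bit.injEq] at hl
          exact ⟨by rw [h₁, hl.1], h₂⟩
  simp only [annVar, List.append_assoc, List.cons.injEq, List.cons_append, List.nil_append] at hu
  obtain ⟨h₁, h₂⟩ := key _ _ _ hu.2 hl
  exact ⟨q.1, h₁, h₂ ▸ h⟩

/-- All suffixes have the property `Reads`. -/
def AllReads (V : ℕ → Bool → Prop) (u : List Sym) : Prop := ∀ u', u' <:+ u → Reads V u'

theorem AllReads.cons {V : ℕ → Bool → Prop} {s : Sym} {u : List Sym} (h : AllReads V u)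
    (hs : Reads V (s :: u)) : AllReads V (s :: u) := by
  intro u' hu
  rcases List.suffix_cons_iff.1 hu with rfl | hu
  · exact hs
  · exact h u' hu

theorem AllReads.annVar_append {V : ℕ → Bool → Prop} {u : List Sym} (h : AllReads V u)
    (hs : ∀ s, Reads V (s :: u)) (q : ℕ × Bool) : AllReads V (annVar q ++ u) := by
  rw [annVar, List.append_assoc]
  induction Computability.encodeNat q.1 with
  | nil => exact h.cons (hs _)
  | cons c bits ih => exact ih.cons (reads_cons_of_not_opens rfl _)

theorem AllReads.annPairs_append {V : ℕ → Bool → Prop} {u : List Sym} (h : AllReads V u)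
    (hs : ∀ s, Reads V (s :: u)) {T : List ((ℕ × Bool) × ℕ × Bool)}
    (hT : ∀ q ∈ T, V q.1.1 q.1.2 ∧ V q.2.1 q.2.2) :
    AllReads V (annPairs T ++ u) ∧ ∀ s, Reads V (s :: (annPairs T ++ u)) := by
  induction T with
  | nil => exact ⟨h, hs⟩
  | cons q T ih =>
    have e : annPairs (q :: T) ++ u = annVar q.1 ++ (annVar q.2 ++ (annPairs T ++ u)) := by
      simp [annPairs]
    obtain ⟨h₁, h₂⟩ := ih fun q hq => hT q (by simp [hq])
    have hq := hT q (by simp)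
    rw [e]
    exact ⟨(h₁.annVar_append h₂ q.2).annVar_append (fun s => reads_annVar hq.2 s _) q.1,
      fun s => reads_annVar hq.1 s _⟩

/-- What a suffix reads at the end of the formula depends on the text `u` behind it. The induction
runs from right to left, and neutrality is passed on because every formula begins with a neutral
letter. -/
theorem Ann.allReads {V : ℕ → Bool → Prop} {φ : PInc} {p : Bool} {r : List Sym}
    (h : Ann V φ p r) {u : List Sym} (hu : AllReads V u) (hn : Neutral u) :
    AllReads V (r ++ u) ∧ Neutral (r ++ u) := by
  induction h generalizing u with
  | top p => exact ⟨hu.cons (reads_cons_of_not_opens rfl _), _, _, rfl, by simp, by simp⟩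
  | bot => exact ⟨hu.cons (reads_cons_of_not_opens rfl _), _, _, rfl, by simp, by simp⟩
  | var hV _ =>
    exact ⟨(hu.annVar_append hn.reads_cons _).cons (reads_annVar (by exact hV) _ _),
      _, _, rfl, by simp, by simp⟩
  | neg hV _ =>
    exact ⟨(hu.annVar_append hn.reads_cons _).cons (reads_annVar (by exact hV) _ _),
      _, _, rfl, by simp, by simp⟩
  | or b _ _ ih₁ ih₂ =>
    obtain ⟨h₂, n₂⟩ := ih₂ hu hn
    obtain ⟨h₁, n₁⟩ := ih₁ h₂ n₂
    rw [List.cons_append, List.append_assoc]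
    exact ⟨h₁.cons (n₁.reads_cons _), _, _, rfl, by simp, by simp⟩
  | and _ _ ih₁ ih₂ =>
    obtain ⟨h₂, n₂⟩ := ih₂ hu hn
    obtain ⟨h₁, n₁⟩ := ih₁ h₂ n₂
    rw [List.cons_append, List.append_assoc]
    exact ⟨h₁.cons (n₁.reads_cons _), _, _, rfl, by simp, by simp⟩
  | inc p hx hy hT =>
    have hf : AllReads V ((some .fin, false) :: u) := hu.cons (reads_cons_of_not_opens rfl _)
    have hf' : Neutral ((some .fin, false) :: u) := ⟨_, _, rfl, by simp, by simp⟩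
    obtain ⟨h₁, h₂⟩ := hf.annPairs_append hf'.reads_cons hT
    rw [List.cons_append, List.append_assoc]
    exact ⟨h₁.cons (h₂ _), _, _, rfl, by simp, by simp⟩

/-- An annotation of an active formula, with the end mark. -/
def IsRow (V : ℕ → Bool → Prop) (φ : PInc) (row : List Sym) : Prop :=
  ∃ r, Ann V φ true r ∧ row = r ++ [(none, false)]

theorem IsRow.map_fst {V : ℕ → Bool → Prop} {φ : PInc} {row : List Sym} (h : IsRow V φ row) :
    row.map Prod.fst = marked (encode φ) := by
  obtain ⟨r, h, rfl⟩ := h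
  simp [h.map_fst, marked]

/-- The rows that assign truth values consistently pass the check. -/
theorem IsRow.consistent {t : ℕ → Bool} {φ : PInc} {row : List Sym}
    (h : IsRow (fun x b => t x = b) φ row) : Check.consistent.holds row row = true := by
  obtain ⟨r, h, rfl⟩ := h
  have hr := (h.allReads (u := [(none, false)]) ?_ ⟨_, _, rfl, by simp, by simp⟩).1
  swap
  · have : AllReads (fun x b => t x = b) [] := by
      intro u' hu s l bits a u'' hu'
      rw [List.suffix_nil.1 hu] at hu'
      cases hu'
    exact this.cons (reads_cons_of_not_opens rfl _)
  rw [Check.holds_iff]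
  intro u _ hu
  rw [Check.sign, Bool.not_eq_true', ← Bool.not_eq_true, Check.finds_iff]
  rintro ⟨v, -, hv, hrun⟩
  obtain ⟨s, s', u, v, rfl, rfl, hs, hs', hrun⟩ := exists_of_run_conflict hrun
  obtain ⟨bits, l, l', a, b, u, v, rfl, rfl, hl, hl', hab⟩ := exists_of_run_name hrun
  obtain ⟨x, hx, rfl⟩ := hr _ hu s l bits a u rfl hl hs
  obtain ⟨y, hy, rfl⟩ := hr _ hv s' l' bits b v rfl hl' hs'
  have : x = y := by
    rw [← Computability.decode_encodeNat x, hx, ← hy, Computability.decode_encodeNat]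
  exact hab (by rw [this])

/-- A row that passes the check assigns truth values consistently. -/
theorem IsRow.exists_of_consistent {V : ℕ → Bool → Prop} {φ : PInc} {row : List Sym}
    (h : IsRow V φ row) (hc : Check.consistent.holds row row = true) :
    ∃ t : ℕ → Bool, IsRow (fun x b => t x = b) φ row := by
  classical
  obtain ⟨r, h, rfl⟩ := h
  -- A variable is true if it occurs with value `true` somewhere; by consistency it then never
  -- occurs with `false`.
  refine ⟨fun x => decide (Occurs x true r), r, h.of_occurs fun x b hb => ?_, rfl⟩
  cases b with
  | true => simpa using hb
  | false =>
    simp only [decide_eq_false_iff_not]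
    intro ht
    obtain ⟨pre, s, post, hs, e⟩ := hb
    obtain ⟨pre', s', post', hs', e'⟩ := ht
    have h₁ : s :: (annVar (x, false) ++ (post ++ [(none, false)])) <:+ r ++ [(none, false)] :=
      ⟨pre, by rw [e]; simp⟩
    have h₂ : s' :: (annVar (x, true) ++ (post' ++ [(none, false)])) <:+ r ++ [(none, false)] :=
      ⟨pre', by rw [e']; simp⟩
    have := Check.holds_iff.1 hc _ (by simp) h₁
    rw [Check.sign, Bool.not_eq_true', ← Bool.not_eq_true, Check.finds_iff] at this
    exact this ⟨_, by simp, h₂, run_conflict hs hs' x (by simp) _ _⟩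


/-! #### Inclusion atoms -/

theorem annVar_append_inj {p q : ℕ × Bool} {u v : List Sym} (h : annVar p ++ u = annVar q ++ v) :
    p = q ∧ u = v := by
  have key : ∀ (a b : List Bool), a.map bitSym ++ (some .sep, p.2) :: u =
      b.map bitSym ++ (some .sep, q.2) :: v → a = b ∧ p.2 = q.2 ∧ u = v := by
    intro a
    induction a with
    | nil =>
      intro b h
      cases b with
      | nil => simpa using h
      | cons d b => simp [bitSym] at h
    | cons c a ih =>
      intro b h
      cases b with
      | nil => simp [bitSym] at h
      | cons d b =>
        simp only [List.map_cons, List.cons_append, List.cons.injEq] at h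
        obtain ⟨h₁, h₂⟩ := ih b h.2
        have : c = d := by simpa [bitSym] using h.1
        exact ⟨by rw [h₁, this], h₂⟩
  obtain ⟨h₁, h₂, h₃⟩ := key _ _ (by simpa [annVar] using h)
  refine ⟨Prod.ext ?_ h₂, h₃⟩
  rw [← Computability.decode_encodeNat p.1, h₁, Computability.decode_encodeNat]

theorem annVar_append_ne (q : ℕ × Bool) (u : List Sym) (b : Bool) (v : List Sym) :
    annVar q ++ u ≠ (some .fin, b) :: v := by
  unfold annVar
  cases Computability.encodeNat q.1 <;> simp [bitSym]

theorem annPairs_append_inj {T T' : List ((ℕ × Bool) × ℕ × Bool)} {b b' : Bool} {u v : List Sym}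
    (h : annPairs T ++ (some .fin, b) :: u = annPairs T' ++ (some .fin, b') :: v) :
    T = T' ∧ u = v := by
  induction T generalizing T' with
  | nil =>
    cases T' with
    | nil => simpa [annPairs] using (List.cons.inj h).2
    | cons q' T' =>
      simp only [annPairs, List.flatMap_cons, List.flatMap_nil, List.nil_append,
        List.append_assoc] at h
      exact absurd h.symm (annVar_append_ne _ _ _ _)
  | cons q T ih =>
    cases T' with
    | nil =>
      simp only [annPairs, List.flatMap_cons, List.flatMap_nil, List.nil_append,
        List.append_assoc] at h
      exact absurd h (annVar_append_ne _ _ _ _)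
    | cons q' T' =>
      simp only [annPairs, List.flatMap_cons, List.append_assoc] at h
      obtain ⟨h₁, h⟩ := annVar_append_inj h
      obtain ⟨h₂, h⟩ := annVar_append_inj h
      obtain ⟨h₃, h₄⟩ := ih h
      exact ⟨by rw [h₃, Prod.ext h₁ h₂], h₄⟩

theorem erase_annVar (q : ℕ × Bool) :
    ((annVar q).map Prod.fst).map (fun a => ((a, false) : Sym)) = annVar (q.1, false) := by
  simp only [annVar, List.map_append, List.map_map, List.map_cons, List.map_nil]
  rfl

theorem mem_annVar_fst {q : ℕ × Bool} {s : Sym} (h : s ∈ annVar q) :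
    s.1 ≠ some .inc ∧ s.1 ≠ none := by
  simp only [annVar, List.mem_append, List.mem_map, List.mem_singleton] at h
  rcases h with ⟨c, -, rfl⟩ | rfl <;> simp [bitSym]

/-- The variables of annotated pairs. -/
def pairVars (T : List ((ℕ × Bool) × ℕ × Bool)) : List (ℕ × ℕ) := T.map fun q => (q.1.1, q.2.1)

/-- The pairs are determined by the letters, up to annotations. -/
theorem pairVars_eq_of_map_fst_eq {T T' : List ((ℕ × Bool) × ℕ × Bool)} {b b' : Bool}
    {u v : List Sym} (h : (annPairs T ++ (some .fin, b) :: u).map Prod.fst =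
      (annPairs T' ++ (some .fin, b') :: v).map Prod.fst) :
    pairVars T = pairVars T' ∧ u.map Prod.fst = v.map Prod.fst := by
  have e : ∀ (T : List ((ℕ × Bool) × ℕ × Bool)) (b : Bool) (u : List Sym),
      ((annPairs T ++ (some .fin, b) :: u).map Prod.fst).map (fun a => ((a, false) : Sym)) =
        annPairs ((pairVars T).map fun q => ((q.1, false), (q.2, false))) ++
          (some .fin, false) :: u.map fun s => (s.1, false) := by
    intro T b u
    induction T with
    | nil => simp [annPairs, pairVars]
    | cons q T ih =>
      simp only [annPairs, List.flatMap_cons, List.append_assoc, List.map_append, List.map_cons,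
        pairVars, erase_annVar] at ih ⊢
      rw [ih]
  obtain ⟨h₁, h₂⟩ := annPairs_append_inj
    ((e T b u).symm.trans ((congrArg _ h).trans (e T' b' v)))
  constructor
  · refine List.map_injective_iff.2 ?_ h₁
    intro q q' h
    simpa [Prod.ext_iff] using h
  · simpa [Function.comp_def] using congrArg (List.map Prod.fst) h₂

theorem mem_annPairs_fst {T : List ((ℕ × Bool) × ℕ × Bool)} {s : Sym} (h : s ∈ annPairs T) :
    s.1 ≠ some .inc ∧ s.1 ≠ none := by
  obtain ⟨q, -, h⟩ := List.mem_flatMap.1 h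
  rcases List.mem_append.1 h with h | h
  · exact mem_annVar_fst h
  · exact mem_annVar_fst h

/-- Such a suffix cannot begin inside a list that is free of the letter `inc`. This localises atoms
in the inductions over formulas. -/
theorem suffix_of_head {u l z : List Sym} {e : Bool} (h : u <:+ l ++ z)
    (hu : u.head? = some (some .inc, e)) (hl : ∀ s ∈ l, s.1 ≠ some .inc) : u <:+ z := by
  rcases suffix_append_iff.1 h with h | ⟨u', hu', rfl⟩
  · exact h
  · cases u' with
    | nil => simp
    | cons s u' =>
      obtain rfl : s = (some .inc, e) := by simpa using hu
      exact absurd rfl (hl (some .inc, e) (hu'.subset (by simp)))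

/-- The list `u` begins with an annotation of an inclusion atom of `φ`. -/
def AtomAt (V : ℕ → Bool → Prop) (φ : PInc) (e : Bool) (T : List ((ℕ × Bool) × ℕ × Bool))
    (z u : List Sym) : Prop :=
  u = (some .inc, e) :: (annPairs T ++ (some .fin, false) :: z) ∧
    (∀ q ∈ T, V q.1.1 q.1.2 ∧ V q.2.1 q.2.2) ∧
    ∃ (n : ℕ) (x y : Fin n → ℕ), inc x y ∈ subformulas φ ∧
      T.map (·.1.1) = List.ofFn x ∧ T.map (·.2.1) = List.ofFn y

theorem AtomAt.mono {V : ℕ → Bool → Prop} {φ ψ : PInc} {e : Bool}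
    {T : List ((ℕ × Bool) × ℕ × Bool)} {z u : List Sym} (h : AtomAt V φ e T z u)
    (hs : subformulas φ ⊆ subformulas ψ) : AtomAt V ψ e T z u := by
  obtain ⟨h₁, h₂, n, x, y, h₃, h₄⟩ := h
  exact ⟨h₁, h₂, n, x, y, hs h₃, h₄⟩

/-- The letter `inc` occurs only at the beginning of atoms, and annotations pass activity only
downwards, so an active atom forces the surrounding formula to be active. -/
theorem Ann.atomAt {V : ℕ → Bool → Prop} {φ : PInc} {p : Bool} {r : List Sym} (h : Ann V φ p r)
    {u z : List Sym} (hu : u <:+ r ++ z) {e : Bool} (he : u.head? = some (some .inc, e)) :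
    u <:+ z ∨ (∃ T z', AtomAt V φ e T z' u) ∧ (e = true → p = true) := by
  induction h generalizing z with
  | top => exact .inl (suffix_of_head hu he (by simp))
  | bot => exact .inl (suffix_of_head hu he (by simp))
  | var | neg =>
    refine .inl (suffix_of_head hu he fun s hs => ?_)
    rcases List.mem_cons.1 hs with rfl | hs
    · simp
    · exact (mem_annVar_fst hs).1
  | @or φ ψ p b r₁ r₂ _ _ ih₁ ih₂ =>
    have hu' : u <:+ r₁ ++ (r₂ ++ z) := suffix_of_head (l := [(some .or, b)]) (by simpa using hu) he
      (by simp)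
    rcases ih₁ hu' with h | ⟨⟨T, z', h⟩, hp⟩
    · rcases ih₂ h with h | ⟨⟨T, z', h⟩, hp⟩
      · exact .inl h
      · exact .inr ⟨⟨T, z', h.mono fun _ h => .inr (.inr h)⟩, fun h => by
          simpa using (Bool.and_eq_true_iff.1 (hp h)).1⟩
    · exact .inr ⟨⟨T, z', h.mono fun _ h => .inr (.inl h)⟩, fun h => by
        simpa using (Bool.and_eq_true_iff.1 (hp h)).1⟩
  | @and φ ψ p r₁ r₂ _ _ ih₁ ih₂ =>
    have hu' : u <:+ r₁ ++ (r₂ ++ z) := suffix_of_head (l := [(some .and, false)])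
      (by simpa using hu) he (by simp)
    rcases ih₁ hu' with h | ⟨⟨T, z', h⟩, hp⟩
    · rcases ih₂ h with h | ⟨⟨T, z', h⟩, hp⟩
      · exact .inl h
      · exact .inr ⟨⟨T, z', h.mono fun _ h => .inr (.inr h)⟩, hp⟩
    · exact .inr ⟨⟨T, z', h.mono fun _ h => .inr (.inl h)⟩, hp⟩
  | @inc n x y p T hx hy hT =>
    rw [List.cons_append, List.suffix_cons_iff] at hu
    rcases hu with rfl | hu
    · obtain rfl : p = e := by simpa using he
      exact .inr ⟨⟨T, z, by simp, hT, n, x, y, rfl, hx, hy⟩, id⟩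
    · refine .inl (suffix_of_head hu he fun s hs => ?_)
      rcases List.mem_append.1 hs with hs | hs
      · exact (mem_annPairs_fst hs).1
      · rw [List.mem_singleton.1 hs]; simp

theorem Ann.fst_ne_none {V : ℕ → Bool → Prop} {φ : PInc} {p : Bool} {r : List Sym}
    (h : Ann V φ p r) : none ∉ r.map Prod.fst := by
  rw [h.map_fst]; simp

theorem IsRow.atomAt {V : ℕ → Bool → Prop} {φ : PInc} {row u : List Sym} (h : IsRow V φ row)
    (hu : u <:+ row) {e : Bool} (he : u.head? = some (some .inc, e)) :
    ∃ T z, AtomAt V φ e T z u := by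
  obtain ⟨r, h, rfl⟩ := h
  rcases h.atomAt hu he with h | ⟨h, -⟩
  · have := suffix_of_head (l := [(none, false)]) (z := []) (by simpa using h) he (by simp)
    rw [List.suffix_nil.1 this] at he
    cases he
  · exact h

theorem IsRow.exists_of_suffix {V : ℕ → Bool → Prop} {φ : PInc} {row u : List Sym}
    (h : IsRow V φ row) (hu : u <:+ row) (hne : u ≠ []) :
    ∃ u', u = u' ++ [(none, false)] ∧ none ∉ u'.map Prod.fst := by
  obtain ⟨r, h, rfl⟩ := h
  rcases suffix_append_iff.1 hu with hu | ⟨u', hu', rfl⟩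
  · rcases List.suffix_cons_iff.1 hu with rfl | hu
    · exact ⟨[], rfl, by simp⟩
    · exact absurd (List.suffix_nil.1 hu) hne
  · exact ⟨u', rfl, fun hm => h.fst_ne_none ((hu'.map Prod.fst).subset hm)⟩

/-- The comparison of the truth values of the first tuple in the first row, or those of the second
tuple, with those of the second tuple in the second row. -/
def agreeCheck (cl : Bool) : Check := if cl then .closed else .novel

theorem agreeCheck_next (cl : Bool) : (agreeCheck cl).next = Sync.agree cl := by
  cases cl <;> rfl

/-- The truth values of one of the tuples. -/
def pairVals (first : Bool) (T : List ((ℕ × Bool) × ℕ × Bool)) : List Bool :=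
  T.map fun q => if first then q.1.2 else q.2.2

theorem run_fst_annVar (cl : Bool) (x : ℕ) (a b : Bool) (u v : List Sym) :
    (agreeCheck cl).run .fst (annVar (x, a) ++ u) (annVar (x, b) ++ v) =
      (agreeCheck cl).run (.snd a) u v := by
  simp only [annVar, List.append_assoc]
  induction Computability.encodeNat x with
  | nil => simp [Check.run, agreeCheck_next, Sync.agree]
  | cons c bits ih => simpa [Check.run, agreeCheck_next, Sync.agree, bitSym] using ih

theorem run_snd_annVar (cl : Bool) (c : Bool) (x : ℕ) (a b : Bool) (u v : List Sym) :
    (agreeCheck cl).run (.snd c) (annVar (x, a) ++ u) (annVar (x, b) ++ v) =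
      if (if cl then c else a) = b then (agreeCheck cl).run .fst u v else .bad := by
  simp only [annVar, List.append_assoc]
  induction Computability.encodeNat x with
  | nil =>
    by_cases h : (if cl then c else a) = b
    · simp [Check.run, agreeCheck_next, Sync.agree, h]
    · simp [Check.run, agreeCheck_next, Sync.agree, h, Check.run_bad]
  | cons c bits ih => simpa [Check.run, agreeCheck_next, Sync.agree, bitSym] using ih

theorem run_annPairs (cl : Bool) {T T' : List ((ℕ × Bool) × ℕ × Bool)}
    (h : pairVars T = pairVars T') (u v : List Sym) :
    (agreeCheck cl).run .fst (annPairs T ++ (some .fin, false) :: u)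
      (annPairs T' ++ (some .fin, false) :: v) =
        if pairVals cl T = pairVals false T' then (agreeCheck cl).run .rest u v else .bad := by
  induction T generalizing T' with
  | nil =>
    obtain rfl : T' = [] := by simpa [pairVars] using h.symm
    simp [annPairs, pairVals, Check.run, agreeCheck_next, Sync.agree]
  | cons q T ih =>
    cases T' with
    | nil => simp [pairVars] at h
    | cons q' T' =>
      obtain ⟨⟨x, a⟩, y, b⟩ := q
      obtain ⟨⟨x', a'⟩, y', b'⟩ := q'
      simp only [pairVars, List.map_cons, List.cons.injEq, Prod.mk.injEq] at h
      obtain ⟨⟨rfl, rfl⟩, h⟩ := h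
      have := ih h
      simp only [annPairs, List.flatMap_cons, List.append_assoc] at this ⊢
      rw [run_fst_annVar, run_snd_annVar, this]
      by_cases hb : (if cl then a else b) = b'
      · simp [pairVals, hb]
      · simp [pairVals, hb]

theorem run_rest (cl : Bool) {u v : List Sym} (h : u.map Prod.fst = v.map Prod.fst) (b b' : Bool)
    (u' v' : List Sym) :
    (agreeCheck cl).run .rest (u ++ (none, b) :: u') (v ++ (none, b') :: v') = .good := by
  induction u generalizing v with
  | nil =>
    obtain rfl : v = [] := by simpa using h.symm
    simp [Check.run, agreeCheck_next, Sync.agree, Check.run_good]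
  | cons s u ih =>
    cases v with
    | nil => simp at h
    | cons s' v =>
      simp only [List.map_cons, List.cons.injEq] at h
      simp only [List.cons_append, Check.run, agreeCheck_next, Sync.agree, h.1, ne_eq,
        not_true_eq_false, if_false]
      by_cases hs : s'.1 = none
      · simp [hs, Check.run_good]
      · simpa [hs] using ih h.2

/-- Accepted lists have the same letters up to the end mark. -/
theorem exists_of_run_agree (cl : Bool) {q : Sync} (hq : q = .fst ∨ (∃ c, q = .snd c) ∨ q = .rest)
    {u u' v : List Sym} {b : Bool} (hu : none ∉ u.map Prod.fst)
    (h : (agreeCheck cl).run q (u ++ (none, b) :: u') v = .good) :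
    ∃ v₀ b' v', v = v₀ ++ (none, b') :: v' ∧ v₀.map Prod.fst = u.map Prod.fst := by
  have step : ∀ (q : Sync), (q = .fst ∨ (∃ c, q = .snd c) ∨ q = .rest) →
      ∀ (s s' : Sym) (w w' : List Sym), (agreeCheck cl).run q (s :: w) (s' :: w') = .good →
      s.1 = s'.1 ∧ (s.1 ≠ none → ∃ q' : Sync, (q' = .fst ∨ (∃ c, q' = .snd c) ∨ q' = .rest) ∧
        (agreeCheck cl).run q' w w' = .good) := by
    intro q hq s s' w w' h
    obtain ⟨a, e⟩ := s
    obtain ⟨a', e'⟩ := s'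
    rw [Check.run, agreeCheck_next] at h
    by_cases ha : a = a'
    · subst ha
      refine ⟨rfl, fun hne => ⟨_, ?_, h⟩⟩
      have hbad : Sync.agree cl q (a, e) (a, e') ≠ .bad := by
        intro hb
        rw [hb, Check.run_bad] at h
        cases h
      obtain ⟨a, rfl⟩ := Option.ne_none_iff_exists'.1 hne
      rcases hq with rfl | ⟨c, rfl⟩ | rfl
      · cases a <;> simp [Sync.agree]
      · cases a with
        | sep =>
          by_cases hx : (if cl then c else e) = e'
          · simp [Sync.agree, hx]
          · simp [Sync.agree, hx] at hbad
        | _ => simp [Sync.agree]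
      · simp [Sync.agree]
    · rcases hq with rfl | ⟨c, rfl⟩ | rfl <;> simp [Sync.agree, ha, Check.run_bad] at h
  induction u generalizing v q with
  | nil =>
    cases v with
    | nil => rcases hq with rfl | ⟨c, rfl⟩ | rfl <;> cases h
    | cons s' v =>
      obtain ⟨hs, -⟩ := step q hq _ _ _ _ h
      exact ⟨[], s'.2, v, by rw [List.nil_append, show s' = (none, s'.2) from Prod.ext hs.symm rfl], rfl⟩
  | cons s u ih =>
    cases v with
    | nil => rcases hq with rfl | ⟨c, rfl⟩ | rfl <;> cases h
    | cons s' v =>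
      simp only [List.map_cons, List.mem_cons, not_or] at hu
      obtain ⟨hs, hstep⟩ := step q hq _ _ _ _ h
      obtain ⟨q', hq', h'⟩ := hstep (Ne.symm hu.1)
      obtain ⟨v₀, b', v', rfl, hl⟩ := ih hq' hu.2 h'
      exact ⟨s' :: v₀, b', v', rfl, by simp [hl, hs]⟩

/-- The lists begin with annotations of the same active inclusion atom, and the truth values agree,
and the remaining letters are the same. -/
def Link (cl : Bool) (u v : List Sym) : Prop :=
  ∃ T T' z z', u = (some .inc, true) :: (annPairs T ++ (some .fin, false) :: z) ∧
    v = (some .inc, true) :: (annPairs T' ++ (some .fin, false) :: z') ∧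
    pairVars T = pairVars T' ∧ pairVals cl T = pairVals false T' ∧
    z.map Prod.fst = z'.map Prod.fst

theorem map_fst_annPairs_eq (T : List ((ℕ × Bool) × ℕ × Bool)) : (annPairs T).map Prod.fst =
    (pairVars T).flatMap fun q => (encodeVar q.1 ++ encodeVar q.2).map some := by
  simp [annPairs, pairVars, List.map_flatMap, List.flatMap_map, map_fst_annVar]

theorem Link.map_fst {cl : Bool} {u v : List Sym} (h : Link cl u v) :
    u.map Prod.fst = v.map Prod.fst := by
  obtain ⟨T, T', z, z', rfl, rfl, h, -, hz⟩ := h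
  simp [map_fst_annPairs_eq, h, hz]

theorem append_none_inj {a b R R' : List Sym} {e e' : Bool} (ha : none ∉ a.map Prod.fst)
    (hb : none ∉ b.map Prod.fst) (h : a ++ (none, e) :: R = b ++ (none, e') :: R') :
    a = b ∧ R = R' := by
  induction a generalizing b with
  | nil =>
    cases b with
    | nil => simpa using (List.cons.inj h).2
    | cons s b => simp only [List.nil_append, List.cons_append, List.cons.injEq] at h; simp [← h.1] at hb
  | cons s a ih =>
    cases b with
    | nil => simp only [List.nil_append, List.cons_append, List.cons.injEq] at h; simp [h.1] at ha
    | cons s' b =>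
      simp only [List.map_cons, List.mem_cons, not_or] at ha hb
      simp only [List.cons_append, List.cons.injEq] at h
      obtain ⟨h₁, h₂⟩ := ih ha.2 hb.2 h.2
      exact ⟨by rw [h.1, h₁], h₂⟩

/-- The automaton insists on equal letters up to the end mark of the row. Hence a match starts at
the same position of the formula, and the text `R` behind the row has no influence. -/
theorem agreeCheck_finds_iff (cl : Bool) {V : ℕ → Bool → Prop} {φ : PInc} {row u R : List Sym}
    (hrow : IsRow V φ row) (hu : u <:+ row) (he : u.head? = some (some .inc, true))
    {rows : List (List Sym)} (hrows : ∀ r ∈ rows, ∃ V, IsRow V φ r) :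
    (agreeCheck cl).finds (u ++ R) rows.flatten = true ↔
      ∃ r ∈ rows, ∃ v, v <:+ r ∧ Link cl u v := by
  obtain ⟨T, z, rfl, -⟩ := hrow.atomAt hu he
  obtain ⟨u₀, hu₀, hnone⟩ := hrow.exists_of_suffix hu (by simp)
  rw [Check.finds_iff]
  constructor
  · rintro ⟨v, hne, hv, hrun⟩
    obtain ⟨r, hr, v₁, R', hne₁, hv₁, rfl⟩ := suffix_flatten hne hv
    obtain ⟨V', hV'⟩ := hrows r hr
    obtain ⟨v₂, rfl, hv₂⟩ := hV'.exists_of_suffix hv₁ hne₁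
    cases u₀ with
    | nil => simp at hu₀
    | cons s u₀ =>
    obtain ⟨rfl, hu₁⟩ : (some .inc, true) = s ∧ annPairs T ++ (some .fin, false) :: z =
        u₀ ++ [(none, false)] := by simpa using hu₀
    cases v₂ with
    | nil => simp [Check.run, agreeCheck_next, Sync.agree, Check.run_bad] at hrun
    | cons s' v₂ =>
    by_cases hs' : s' = (some .inc, true)
    swap
    · simp [Check.run, agreeCheck_next, Sync.agree, Check.run_bad, hs'] at hrun
    subst hs'
    have hrun' : (agreeCheck cl).run .fst (u₀ ++ (none, false) :: R)
        (v₂ ++ (none, false) :: R') = .good := by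
      have : (agreeCheck cl).run .start ((some .inc, true) :: (u₀ ++ (none, false) :: R))
          ((some .inc, true) :: (v₂ ++ (none, false) :: R')) = .good := by
        rw [hu₀] at hrun; simpa using hrun
      rw [Check.run] at this
      simpa [agreeCheck_next, Sync.agree] using this
    simp only [List.map_cons, List.mem_cons, not_or] at hnone hv₂
    obtain ⟨v₃, b', R₃, hv₃, hl⟩ := exists_of_run_agree cl (.inl rfl) hnone.2 hrun'
    obtain ⟨rfl, rfl⟩ := append_none_inj hv₂.2 (by rw [hl]; exact hnone.2) hv₃
    obtain ⟨T', z', hT', -⟩ := hV'.atomAt hv₁ (e := true) rfl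
    have hT'' : v₂ ++ [(none, false)] = annPairs T' ++ (some .fin, false) :: z' := by
      simpa using hT'
    obtain ⟨hvars, hz⟩ := pairVars_eq_of_map_fst_eq (T := T) (T' := T') (b := false) (b' := false)
      (u := z) (v := z') (by rw [hu₁, ← hT'']; simp [hl])
    refine ⟨r, hr, _, hv₁, T, T', z, z', rfl, hT', hvars, ?_, hz⟩
    by_contra hvals
    have e₁ : u₀ ++ (none, false) :: R = annPairs T ++ (some .fin, false) :: (z ++ R) := by
      rw [show u₀ ++ (none, false) :: R = (u₀ ++ [(none, false)]) ++ R by simp, ← hu₁]; simp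
    have e₂ : v₂ ++ (none, false) :: R' = annPairs T' ++ (some .fin, false) :: (z' ++ R') := by
      rw [show v₂ ++ (none, false) :: R' = (v₂ ++ [(none, false)]) ++ R' by simp, hT'']; simp
    rw [e₁, e₂, run_annPairs cl hvars, if_neg hvals] at hrun'
    cases hrun'
  · rintro ⟨r, hr, v, hv, T₁, T', z₁, z', hT₁, rfl, hvars, hvals, hz⟩
    obtain ⟨rfl, rfl⟩ := annPairs_append_inj (List.cons.inj hT₁).2
    obtain ⟨R', hR'⟩ := exists_suffix_flatten hr hv
    refine ⟨_, by simp, hR', ?_⟩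
    obtain ⟨V', hV'⟩ := hrows r hr
    -- The end mark cannot be the closing letter of the atom, so it belongs to the rest `z`.
    have hend : ∀ {T z u₀}, (some .inc, true) :: (annPairs T ++ (some .fin, false) :: z) =
        u₀ ++ [((none, false) : Sym)] → ∃ z₀, z = z₀ ++ [(none, false)] := by
      intro T z u₀ h
      rcases List.eq_nil_or_concat z with rfl | ⟨z₀, s, rfl⟩
      · have h' : ((some .inc, true) :: annPairs T) ++ [((some .fin, false) : Sym)] =
            u₀ ++ [(none, false)] := by simpa using h
        have := (List.append_inj' h' rfl).2
        simp at this
      · have h' : ((some .inc, true) :: (annPairs T ++ (some .fin, false) :: z₀)) ++ [s] =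
            u₀ ++ [((none, false) : Sym)] := by simpa using h
        have := (List.append_inj' h' rfl).2
        exact ⟨z₀, by simpa using this⟩
    obtain ⟨z₀, rfl⟩ := hend hu₀
    obtain ⟨v₀, hv₀, -⟩ := hV'.exists_of_suffix hv (by simp)
    obtain ⟨z₀', rfl⟩ := hend hv₀
    have hrest := run_rest cl (u := z₀) (v := z₀') (by simpa using hz) false false R R'
    simp only [List.cons_append, List.append_assoc, Check.run]
    have hn : (agreeCheck cl).next .start (some .inc, true) (some .inc, true) = .fst := by
      simp [agreeCheck_next, Sync.agree]
    rw [hn]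
    simp only [List.nil_append]
    rw [run_annPairs cl hvars, if_pos hvals]
    exact hrest

/-- The automaton accepts at once, so only active atoms impose conditions in the checks of novelty
and closedness. -/
theorem agreeCheck_finds_of_head (cl : Bool) {s : Sym} (hs : s ≠ (some .inc, true))
    (u : List Sym) {v : List Sym} (hv : v ≠ []) : (agreeCheck cl).finds (s :: u) v = true := by
  rw [Check.finds_iff]
  refine ⟨v, hv, List.suffix_rfl, ?_⟩
  cases v with
  | nil => exact absurd rfl hv
  | cons s' v => simp [Check.run, agreeCheck_next, Sync.agree, hs, Check.run_good]

theorem flatten_ne_nil {φ : PInc} {rows : List (List Sym)} (hne : rows ≠ [])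
    (hrows : ∀ r ∈ rows, ∃ V, IsRow V φ r) : rows.flatten ≠ [] := by
  cases rows with
  | nil => exact absurd rfl hne
  | cons r rows =>
    obtain ⟨V, r', -, rfl⟩ := hrows r (by simp)
    simp

/-- The check of closedness is passed if for every row and every active atom there is a row whose
values of the second tuple are the values of the first tuple. -/
theorem closed_holds_iff {φ : PInc} {rows : List (List Sym)} (hne : rows ≠ [])
    (hrows : ∀ r ∈ rows, ∃ V, IsRow V φ r) :
    Check.closed.holds rows.flatten rows.flatten = true ↔
      ∀ r ∈ rows, ∀ u, u <:+ r → u.head? = some (some .inc, true) →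
        ∃ r' ∈ rows, ∃ v, v <:+ r' ∧ Link true u v := by
  rw [Check.holds_iff]
  constructor
  · intro h r hr u hu he
    obtain ⟨V, hV⟩ := hrows r hr
    obtain ⟨R, hR⟩ := exists_suffix_flatten hr hu
    refine (agreeCheck_finds_iff true hV hu he hrows (R := R)).1 (h _ ?_ hR)
    rintro h
    rw [(List.append_eq_nil_iff.1 h).1] at he
    cases he
  · intro h u hne' hu
    obtain ⟨r, hr, u', R, hne'', hu', rfl⟩ := suffix_flatten hne' hu
    obtain ⟨V, hV⟩ := hrows r hr
    cases u' with
    | nil => exact absurd rfl hne''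
    | cons s u' =>
      by_cases hs : s = (some .inc, true)
      · exact (agreeCheck_finds_iff true hV hu' (by rw [hs]; rfl) hrows).2
          (h r hr _ hu' (by rw [hs]; rfl))
      · exact agreeCheck_finds_of_head true hs _ (flatten_ne_nil hne hrows)

/-- A row is novel if in no other row the second tuple of some active atom has the same values. -/
theorem novel_holds_eq_false_iff {V : ℕ → Bool → Prop} {φ : PInc} {row : List Sym}
    (hrow : IsRow V φ row) {rows : List (List Sym)} (hne : rows ≠ [])
    (hrows : ∀ r ∈ rows, ∃ V, IsRow V φ r) :
    Check.novel.holds rows.flatten row = false ↔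
      ∃ u, u <:+ row ∧ u.head? = some (some .inc, true) ∧
        ¬ ∃ r ∈ rows, ∃ v, v <:+ r ∧ Link false u v := by
  rw [← Bool.not_eq_true, Check.holds_iff]
  push Not
  constructor
  · rintro ⟨u, hne', hu, hf⟩
    have hf' : ¬ (agreeCheck false).finds u rows.flatten = true := hf
    cases u with
    | nil => exact absurd rfl hne'
    | cons s u =>
      by_cases hs : s = (some .inc, true)
      · subst hs
        refine ⟨_, hu, rfl, fun r hr v hv hl => hf' ?_⟩
        have := (agreeCheck_finds_iff false hrow hu rfl hrows (R := [])).2 ⟨r, hr, v, hv, hl⟩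
        rwa [List.append_nil] at this
      · exact absurd (agreeCheck_finds_of_head false hs _ (flatten_ne_nil hne hrows)) hf'
  · rintro ⟨u, hu, he, h⟩
    refine ⟨u, ?_, hu, fun hf => ?_⟩
    · rintro rfl
      cases he
    · have hf' : (agreeCheck false).finds (u ++ []) rows.flatten = true := by
        rw [List.append_nil]; exact hf
      obtain ⟨r, hr, v, hv, hl⟩ := (agreeCheck_finds_iff false hrow hu he hrows).1 hf'
      exact h r hr v hv hl


/-! ## Soundness -/

/-- The truth values of an assignment. -/
abbrev Val (t : ℕ → Bool) (x : ℕ) (b : Bool) : Prop := t x = b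

theorem Ann.mono {V V' : ℕ → Bool → Prop} {φ : PInc} {p : Bool} {r : List Sym} (h : Ann V φ p r)
    (hV : ∀ x ∈ vars φ, ∀ b, V x b → V' x b) : Ann V' φ p r := by
  induction h with
  | top p => exact .top p
  | bot => exact .bot
  | var h hb => exact .var (hV _ rfl _ h) hb
  | neg h hb => exact .neg (hV _ rfl _ h) hb
  | or b _ _ ih₁ ih₂ =>
    exact .or b (ih₁ fun x hx => hV x (.inl hx)) (ih₂ fun x hx => hV x (.inr hx))
  | and _ _ ih₁ ih₂ =>
    exact .and (ih₁ fun x hx => hV x (.inl hx)) (ih₂ fun x hx => hV x (.inr hx))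
  | @inc n x y p T hx hy hT =>
    refine .inc p hx hy fun q hq => ⟨hV _ (.inl ?_) _ (hT q hq).1, hV _ (.inr ?_) _ (hT q hq).2⟩
    · have : q.1.1 ∈ List.ofFn x :=
        hx ▸ List.mem_map_of_mem (f := fun q : (ℕ × Bool) × ℕ × Bool => q.1.1) hq
      exact List.mem_ofFn.1 this
    · have : q.2.1 ∈ List.ofFn y :=
        hy ▸ List.mem_map_of_mem (f := fun q : (ℕ × Bool) × ℕ × Bool => q.2.1) hq
      exact List.mem_ofFn.1 this

theorem Ann.length_eq {V V' : ℕ → Bool → Prop} {φ : PInc} {p p' : Bool} {r r' : List Sym}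
    (h : Ann V φ p r) (h' : Ann V' φ p' r') : r.length = r'.length := by
  simpa using congrArg List.length (h.map_fst.trans h'.map_fst.symm)

theorem Keeps.exists_isRow {w : List Letter} {rows row : List Sym}
    (hw : row.map Prod.fst = marked w) (h : Keeps rows row) :
    ∃ φ, encode φ = w ∧ ∃ t, IsRow (Val t) φ row := by
  obtain ⟨φ, s, hs, rfl⟩ := parse_eq_done_iff.1 h.1
  have hr : IsRow (fun _ _ => True) φ (s ++ [(none, false)]) := ⟨s, hs, rfl⟩
  refine ⟨φ, ?_, hr.exists_of_consistent h.2.1⟩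
  rw [hr.map_fst] at hw
  have := List.append_cancel_right hw
  exact List.map_injective_iff.2 (Option.some_injective _) this

theorem Chain.exists_isRow {φ : PInc} {rows : List (List Sym)} (h : Chain (encode φ) rows) :
    ∀ r ∈ rows, ∃ t, IsRow (Val t) φ r := by
  induction h with
  | nil => simp
  | cons _ hw hk ih =>
    obtain ⟨ψ, hψ, h⟩ := hk.exists_isRow hw
    rw [encode_injective hψ] at h
    simpa using ⟨h, ih⟩

theorem Chain.exists_encode {w : List Letter} {rows : List (List Sym)} (h : Chain w rows)
    (hne : rows ≠ []) : ∃ φ, encode φ = w := by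
  cases h with
  | nil => exact absurd rfl hne
  | cons _ hw hk =>
    obtain ⟨φ, hφ, -⟩ := hk.exists_isRow hw
    exact ⟨φ, hφ⟩

/-- If the rows are closed and belong to distinct assignments, every subformula is satisfied by the
team of those assignments for which it is active. -/
theorem sat_of_closed (sem : SplitSemantics) {ι : Type} {t : ι → ℕ → Bool}
    (ht : Function.Injective t) {row : ι → List Sym}
    (hcl : ∀ i u, u <:+ row i → u.head? = some (some .inc, true) →
      ∃ j v, v <:+ row j ∧ Link true u v) (φ : PInc) :
    -- `seg i` is the annotation in row `i` of one fixed occurrence of the subformula; the equal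
    -- lengths of `post` put these occurrences at the same position.
    ∀ (pre seg post : ι → List Sym) (act : ι → Bool), (∀ i, row i = pre i ++ (seg i ++ post i)) →
      (∀ i j, (post i).length = (post j).length) → (∀ i, Ann (Val (t i)) φ (act i) (seg i)) →
      Sat sem {s | ∃ i, act i = true ∧ t i = s} φ := by
  induction φ with
  | top => intros; trivial
  | bot =>
    intro pre seg post act _ _ hann
    rw [Sat, Set.eq_empty_iff_forall_notMem]
    rintro _ ⟨i, hi, rfl⟩
    have := hann i
    rw [hi] at this
    cases this
  | var x =>
    rintro pre seg post act _ _ hann _ ⟨i, hi, rfl⟩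
    have := hann i
    generalize seg i = l at this
    cases this with
    | var h hb => exact h.trans (hb hi)
  | neg x =>
    rintro pre seg post act _ _ hann _ ⟨i, hi, rfl⟩
    have := hann i
    generalize seg i = l at this
    cases this with
    | neg h hb => exact h.trans (hb hi)
  | or φ ψ ih₁ ih₂ =>
    intro pre seg post act hrow hpost hann
    have : ∀ i, ∃ b r s, seg i = (some .or, b) :: (r ++ s) ∧ Ann (Val (t i)) φ (act i && !b) r ∧
        Ann (Val (t i)) ψ (act i && b) s := by
      intro i
      have := hann i
      generalize seg i = l at this
      cases this with
      | or b h₁ h₂ => exact ⟨b, _, _, rfl, h₁, h₂⟩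
    choose b r s hseg h₁ h₂ using this
    refine ⟨_, _, ?_, fun _ => ?_,
      ih₁ (fun i => pre i ++ [(some .or, b i)]) r (fun i => s i ++ post i) (fun i => act i && !b i)
        (fun i => by simp [hrow, hseg])
        (fun i j => by simp [hpost i j, (h₂ i).length_eq (h₂ j)]) h₁,
      ih₂ (fun i => pre i ++ (some .or, b i) :: r i) s post (fun i => act i && b i)
        (fun i => by simp [hrow, hseg]) hpost h₂⟩
    · ext u
      constructor
      · rintro (⟨i, hi, rfl⟩ | ⟨i, hi, rfl⟩)
        · exact ⟨i, (Bool.and_eq_true_iff.1 hi).1, rfl⟩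
        · exact ⟨i, (Bool.and_eq_true_iff.1 hi).1, rfl⟩
      · rintro ⟨i, hi, rfl⟩
        cases hb : b i
        · exact .inl ⟨i, by simp [hi, hb], rfl⟩
        · exact .inr ⟨i, by simp [hi, hb], rfl⟩
    -- An assignment comes from a single row, and the bit of that row selects a single disjunct; so
    -- the split is strict.
    · rw [Set.disjoint_left]
      rintro _ ⟨i, hi, rfl⟩ ⟨j, hj, hij⟩
      obtain rfl := ht hij
      simp only [Bool.and_eq_true, Bool.not_eq_true'] at hi hj
      rw [hi.2] at hj
      cases hj.2
  | and φ ψ ih₁ ih₂ =>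
    intro pre seg post act hrow hpost hann
    have : ∀ i, ∃ r s, seg i = (some .and, false) :: (r ++ s) ∧ Ann (Val (t i)) φ (act i) r ∧
        Ann (Val (t i)) ψ (act i) s := by
      intro i
      have := hann i
      generalize seg i = l at this
      cases this with
      | and h₁ h₂ => exact ⟨_, _, rfl, h₁, h₂⟩
    choose r s hseg h₁ h₂ using this
    exact ⟨ih₁ (fun i => pre i ++ [(some .and, false)]) r (fun i => s i ++ post i) act
        (fun i => by simp [hrow, hseg])
        (fun i j => by simp [hpost i j, (h₂ i).length_eq (h₂ j)]) h₁,
      ih₂ (fun i => pre i ++ (some .and, false) :: r i) s post act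
        (fun i => by simp [hrow, hseg]) hpost h₂⟩
  | @inc n x y =>
    rintro pre seg post act hrow hpost hann _ ⟨i, hi, rfl⟩
    have : ∀ i, ∃ T, seg i = (some .inc, act i) :: (annPairs T ++ [(some .fin, false)]) ∧
        T.map (·.1.1) = List.ofFn x ∧ T.map (·.2.1) = List.ofFn y ∧
        (∀ q ∈ T, t i q.1.1 = q.1.2 ∧ t i q.2.1 = q.2.2) := by
      intro i
      have := hann i
      generalize seg i = l at this
      cases this with
      | inc p hx hy hT => exact ⟨_, rfl, hx, hy, hT⟩
    choose T hseg hx hy hT using this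
    obtain ⟨j, v, hv, T₁, T₂, z₁, z₂, hu, rfl, hvars, hvals, hz⟩ := hcl i (seg i ++ post i)
      (by rw [hrow]; exact List.suffix_append _ _) (by simp [hseg, hi])
    have hlink : Link true (seg i ++ post i)
        ((some .inc, true) :: (annPairs T₂ ++ (some .fin, false) :: z₂)) :=
      ⟨T₁, T₂, z₁, z₂, hu, rfl, hvars, hvals, hz⟩
    -- Linked lists have equal length, so `v` is the suffix of row `j` at the same occurrence. Its
    -- first letter then shows that `j` belongs to the team of the atom.
    have hv' : (some .inc, true) :: (annPairs T₂ ++ (some .fin, false) :: z₂) =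
        seg j ++ post j := by
      have hs : seg j ++ post j <:+ row j := by rw [hrow]; exact List.suffix_append _ _
      have hl := congrArg List.length hlink.map_fst
      simp only [List.length_map, List.length_append (as := seg i), (hann i).length_eq (hann j),
        hpost i j] at hl
      rw [← List.length_append] at hl
      exact (List.suffix_of_suffix_length_le hv hs hl.ge).eq_of_length hl.symm
    rw [hseg, List.cons_append, List.append_assoc] at hu hv'
    obtain ⟨h₁, -⟩ := annPairs_append_inj (List.cons.inj hu).2
    obtain ⟨h₂, -⟩ := annPairs_append_inj (List.cons.inj hv').2
    obtain ⟨hj, -⟩ := Prod.mk.inj (List.cons.inj hv').1 |>.symm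
    refine ⟨t j, ⟨j, (Prod.mk.inj (List.cons.inj hv').1).2.symm, rfl⟩, List.ofFn_injective ?_⟩
    rw [← h₁, h₂] at hvals
    have e₁ : List.ofFn (fun k => t i (x k)) = pairVals true (T i) := by
      rw [← Function.comp_def, ← List.map_ofFn, ← hx i, List.map_map]
      exact List.map_congr_left fun q hq => (hT i q hq).1
    have e₂ : List.ofFn (fun k => t j (y k)) = pairVals false (T j) := by
      rw [← Function.comp_def, ← List.map_ofFn, ← hy j, List.map_map]
      exact List.map_congr_left fun q hq => (hT j q hq).2
    rw [e₁, e₂, hvals]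

/-- If the machine produces a closed list of rows, the formula is satisfiable. -/
theorem satisfiable_of_chain (sem : SplitSemantics) {φ : PInc} {rows : List (List Sym)}
    (hne : rows ≠ []) (h : Chain (encode φ) rows)
    (hcl : Check.closed.holds rows.flatten rows.flatten = true) : Satisfiable sem φ := by
  have hrows := h.exists_isRow
  rw [closed_holds_iff hne fun r hr => (hrows r hr).imp' _ fun _ => id] at hcl
  choose t₀ hrow using fun i : {r // r ∈ rows} => hrows i.1 i.2
  obtain ⟨M, hM⟩ := (finite_vars φ).bddAbove
  obtain ⟨f, hf⟩ := exists_injective_nat {r // r ∈ rows}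
  -- Rows with the same values on the formula may still choose different disjuncts. Beyond the bound
  -- `M` for its variables, each row gets a private variable that makes the assignments distinct.
  let t : {r // r ∈ rows} → ℕ → Bool := fun i x =>
    if x ≤ M then t₀ i x else decide (x = M + 1 + f i)
  have ht : Function.Injective t := by
    intro i j hij
    have h₁ : t i (M + 1 + f i) = true := by simp [t, show ¬ M + 1 + f i ≤ M by omega]
    rw [hij] at h₁
    have : f i = f j := by simpa [t, show ¬ M + 1 + f i ≤ M by omega] using h₁
    exact hf this
  choose seg hseg hrow using hrow
  have hann : ∀ i, Ann (Val (t i)) φ true (seg i) := fun i =>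
    (hseg i).mono fun x hx b h => (if_pos (hM hx)).trans h
  have := sat_of_closed sem ht (row := fun i => i.1) (fun i u hu he => by
      obtain ⟨r, hr, v, hv, hl⟩ := hcl i.1 i.2 u hu he
      exact ⟨⟨r, hr⟩, v, hv, hl⟩) φ (fun _ => []) seg (fun _ => [(none, false)]) (fun _ => true)
    hrow (fun _ _ => rfl) hann
  obtain ⟨r, hr⟩ := List.exists_mem_of_ne_nil rows hne
  exact ⟨{s | ∃ i, true = true ∧ t i = s}, ⟨t ⟨r, hr⟩, ⟨r, hr⟩, rfl, rfl⟩, this⟩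

/-! ## Completeness -/

theorem Link.append {cl : Bool} {u v : List Sym} (h : Link cl u v) {a b : List Sym}
    (hab : a.map Prod.fst = b.map Prod.fst) : Link cl (u ++ a) (v ++ b) := by
  obtain ⟨T, T', z, z', rfl, rfl, h, h', hz⟩ := h
  exact ⟨T, T', z ++ a, z' ++ b, by simp, by simp, h, h', by simp [hz, hab]⟩

/-- If a row that supplies a missing witness only repeated the values of an earlier row, that
earlier row would itself have been a witness. This is why such rows pass the test of novelty. -/
theorem Link.trans {cl : Bool} {u v w : List Sym} (h : Link cl u v) (h' : Link false v w) :
    Link cl u w := by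
  obtain ⟨T, T', z, z', rfl, rfl, h₁, h₂, hz⟩ := h
  obtain ⟨T₁, T'', z₁, z'', e, rfl, h₃, h₄, hz'⟩ := h'
  obtain ⟨rfl, rfl⟩ := annPairs_append_inj (List.cons.inj e).2
  exact ⟨T, T'', z, z'', rfl, rfl, h₁.trans h₃, h₂.trans h₄, hz.trans hz'⟩

/-- The annotation of an inclusion atom under an assignment. -/
def annInc {n : ℕ} (t : ℕ → Bool) (x y : Fin n → ℕ) : List ((ℕ × Bool) × ℕ × Bool) :=
  List.ofFn fun i => ((x i, t (x i)), (y i, t (y i)))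

theorem ann_annInc {n : ℕ} (t : ℕ → Bool) (x y : Fin n → ℕ) (p : Bool) :
    Ann (Val t) (inc x y) p
      ((some .inc, p) :: (annPairs (annInc t x y) ++ [(some .fin, false)])) := by
  refine .inc p ?_ ?_ ?_
  · simp [annInc, List.map_ofFn, Function.comp_def]
  · simp [annInc, List.map_ofFn, Function.comp_def]
  · simp [annInc, List.mem_ofFn]

/-- An inactive formula only records truth values. Such annotations fill the disjunct that a row
does not choose. -/
theorem exists_ann_inactive (t : ℕ → Bool) (φ : PInc) : ∃ r, Ann (Val t) φ false r := by
  induction φ with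
  | top => exact ⟨_, .top _⟩
  | bot => exact ⟨_, .bot⟩
  | var x => exact ⟨_, .var (b := t x) rfl (by simp)⟩
  | neg x => exact ⟨_, .neg (b := t x) rfl (by simp)⟩
  | or φ ψ ih₁ ih₂ =>
    obtain ⟨r, hr⟩ := ih₁
    obtain ⟨s, hs⟩ := ih₂
    exact ⟨_, .or false hr hs⟩
  | and φ ψ ih₁ ih₂ =>
    obtain ⟨r, hr⟩ := ih₁
    obtain ⟨s, hs⟩ := ih₂
    exact ⟨_, .and hr hs⟩
  | inc x y => exact ⟨_, ann_annInc t x y false⟩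

theorem Ann.not_suffix {V : ℕ → Bool → Prop} {φ : PInc} {r : List Sym} (h : Ann V φ false r)
    {u : List Sym} (hu : u <:+ r) : u.head? ≠ some (some .inc, true) := by
  intro he
  rcases h.atomAt (z := []) (by simpa using hu) he with h | ⟨-, h⟩
  · rw [List.suffix_nil.1 h] at he
    cases he
  · cases h rfl

theorem suffix_append_head {u a b : List Sym} {s : Sym} (h : u <:+ a ++ b)
    (he : u.head? = some s) : u <:+ b ∨ ∃ u', u' <:+ a ∧ u'.head? = some s ∧ u = u' ++ b := by
  rcases suffix_append_iff.1 h with h | ⟨u', hu', rfl⟩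
  · exact .inl h
  · cases u' with
    | nil => exact .inl (by simp)
    | cons s' u' => exact .inr ⟨_, hu', by simpa using he, rfl⟩

/-- A set of annotations of an active formula under assignments of a team, at least one for every
assignment, that is closed in the sense of the final check. -/
structure ClosedSet (φ : PInc) (T : Team) (R : Set ((ℕ → Bool) × List Sym)) : Prop where
  ann : ∀ x ∈ R, x.1 ∈ T ∧ Ann (Val x.1) φ true x.2
  total : ∀ t ∈ T, ∃ r, (t, r) ∈ R
  closed : ∀ x ∈ R, ∀ u, u <:+ x.2 → u.head? = some (some .inc, true) →
    ∃ y ∈ R, ∃ v, v <:+ y.2 ∧ Link true u v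

/-- By induction on the formula. For a disjunction, the annotations of the chosen disjunct are
completed by an inactive one of the other; if the parts overlap, an assignment gets rows of both
kinds, which is why `R` is a relation. For a conjunction, all combinations under the same assignment
are taken, and `total` supplies the other half of the row of a witness. Disjointness of splits plays
no role. -/
theorem exists_closedSet {sem : SplitSemantics} {φ : PInc} {T : Team} (h : Sat sem T φ) :
    ∃ R, ClosedSet φ T R := by
  induction φ generalizing T with
  | top =>
    refine ⟨{x | x.1 ∈ T ∧ x.2 = [(some .top, false)]}, ?_, fun t ht => ⟨[(some .top, false)], ht, rfl⟩, ?_⟩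
    · rintro ⟨t, _⟩ ⟨ht, rfl⟩
      exact ⟨ht, .top _⟩
    · rintro ⟨t, _⟩ ⟨ht, rfl⟩ u hu he
      have := suffix_of_head (z := []) (by simpa using hu) he (by simp)
      simp [List.suffix_nil.1 this] at he
  | bot =>
    obtain rfl : T = ∅ := h
    exact ⟨∅, by simp, by simp, by simp⟩
  | var x =>
    refine ⟨{z | z.1 ∈ T ∧ z.2 = (some .pos, false) :: annVar (x, true)}, ?_,
      fun t ht => ⟨(some .pos, false) :: annVar (x, true), ht, rfl⟩, ?_⟩
    · rintro ⟨t, _⟩ ⟨ht, rfl⟩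
      exact ⟨ht, .var (h t ht) (by simp)⟩
    · rintro ⟨t, _⟩ ⟨ht, rfl⟩ u hu he
      have := suffix_of_head (z := []) (by simpa using hu) he (fun s hs => by
        rcases List.mem_cons.1 hs with rfl | hs
        · simp
        · exact (mem_annVar_fst hs).1)
      simp [List.suffix_nil.1 this] at he
  | neg x =>
    refine ⟨{z | z.1 ∈ T ∧ z.2 = (some .neg, false) :: annVar (x, false)}, ?_,
      fun t ht => ⟨(some .neg, false) :: annVar (x, false), ht, rfl⟩, ?_⟩
    · rintro ⟨t, _⟩ ⟨ht, rfl⟩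
      exact ⟨ht, .neg (h t ht) (by simp)⟩
    · rintro ⟨t, _⟩ ⟨ht, rfl⟩ u hu he
      have := suffix_of_head (z := []) (by simpa using hu) he (fun s hs => by
        rcases List.mem_cons.1 hs with rfl | hs
        · simp
        · exact (mem_annVar_fst hs).1)
      simp [List.suffix_nil.1 this] at he
  | or φ ψ ih₁ ih₂ =>
    obtain ⟨T₁, T₂, rfl, -, h₁, h₂⟩ := h
    obtain ⟨R₁, hR₁⟩ := ih₁ h₁
    obtain ⟨R₂, hR₂⟩ := ih₂ h₂
    choose d₁ hd₁ using fun t => exists_ann_inactive t φ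
    choose d₂ hd₂ using fun t => exists_ann_inactive t ψ
    refine ⟨{z | (∃ r, (z.1, r) ∈ R₁ ∧ z.2 = (some .or, false) :: (r ++ d₂ z.1)) ∨
      ∃ r, (z.1, r) ∈ R₂ ∧ z.2 = (some .or, true) :: (d₁ z.1 ++ r)}, ?_, ?_, ?_⟩
    · rintro ⟨t, l⟩ (⟨r, hr, e⟩ | ⟨r, hr, e⟩) <;> dsimp only at e <;> subst e
      · exact ⟨.inl (hR₁.ann _ hr).1, .or false (hR₁.ann _ hr).2 (hd₂ t)⟩
      · exact ⟨.inr (hR₂.ann _ hr).1, .or true (hd₁ t) (hR₂.ann _ hr).2⟩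
    · rintro t (ht | ht)
      · obtain ⟨r, hr⟩ := hR₁.total t ht
        exact ⟨(some .or, false) :: (r ++ d₂ t), .inl ⟨r, hr, rfl⟩⟩
      · obtain ⟨r, hr⟩ := hR₂.total t ht
        exact ⟨(some .or, true) :: (d₁ t ++ r), .inr ⟨r, hr, rfl⟩⟩
    · rintro ⟨t, l⟩ (⟨r, hr, e⟩ | ⟨r, hr, e⟩) u hu he <;> dsimp only at e <;> subst e
      · have hu' := suffix_of_head (l := [(some .or, false)]) (z := r ++ d₂ t) hu he (by simp)
        rcases suffix_append_head hu' he with hu' | ⟨u', hu₁, he', rfl⟩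
        · exact absurd he ((hd₂ t).not_suffix hu')
        · obtain ⟨⟨t', r'⟩, hr', v, hv, hl⟩ := hR₁.closed _ hr u' hu₁ he'
          refine ⟨(t', (some .or, false) :: (r' ++ d₂ t')), .inl ⟨r', hr', rfl⟩, v ++ d₂ t', ?_,
            hl.append ((hd₂ t).map_fst.trans (hd₂ t').map_fst.symm)⟩
          exact (suffix_append_iff.2 (.inr ⟨v, hv, rfl⟩)).trans (List.suffix_cons _ _)
      · have hu' := suffix_of_head (l := [(some .or, true)]) (z := d₁ t ++ r) hu he (by simp)
        rcases suffix_append_head hu' he with hu' | ⟨u', hu₁, he', rfl⟩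
        · obtain ⟨⟨t', r'⟩, hr', v, hv, hl⟩ := hR₂.closed _ hr u hu' he
          refine ⟨(t', (some .or, true) :: (d₁ t' ++ r')), .inr ⟨r', hr', rfl⟩, v, ?_, hl⟩
          exact (hv.trans (List.suffix_append _ _)).trans (List.suffix_cons _ _)
        · exact absurd he' ((hd₁ t).not_suffix hu₁)
  | and φ ψ ih₁ ih₂ =>
    obtain ⟨R₁, hR₁⟩ := ih₁ h.1
    obtain ⟨R₂, hR₂⟩ := ih₂ h.2
    refine ⟨{z | ∃ r s, (z.1, r) ∈ R₁ ∧ (z.1, s) ∈ R₂ ∧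
      z.2 = (some .and, false) :: (r ++ s)}, ?_, ?_, ?_⟩
    · rintro ⟨t, _⟩ ⟨r, s, hr, hs, rfl⟩
      exact ⟨(hR₁.ann _ hr).1, .and (hR₁.ann _ hr).2 (hR₂.ann _ hs).2⟩
    · intro t ht
      obtain ⟨r, hr⟩ := hR₁.total t ht
      obtain ⟨s, hs⟩ := hR₂.total t ht
      exact ⟨_, r, s, hr, hs, rfl⟩
    · rintro ⟨t, _⟩ ⟨r, s, hr, hs, rfl⟩ u hu he
      have hu' := suffix_of_head (l := [(some .and, false)]) (z := r ++ s) hu he (by simp)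
      rcases suffix_append_head hu' he with hu' | ⟨u', hu₁, he', rfl⟩
      · obtain ⟨⟨t', s'⟩, hs', v, hv, hl⟩ := hR₂.closed _ hs u hu' he
        obtain ⟨r', hr'⟩ := hR₁.total t' (hR₂.ann _ hs').1
        refine ⟨(t', _), ⟨r', s', hr', hs', rfl⟩, v, ?_, hl⟩
        exact (hv.trans (List.suffix_append _ _)).trans (List.suffix_cons _ _)
      · obtain ⟨⟨t', r'⟩, hr', v, hv, hl⟩ := hR₁.closed _ hr u' hu₁ he'
        obtain ⟨s', hs'⟩ := hR₂.total t' (hR₁.ann _ hr').1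
        refine ⟨(t', _), ⟨r', s', hr', hs', rfl⟩, v ++ s', ?_,
          hl.append ((hR₂.ann _ hs).2.map_fst.trans (hR₂.ann _ hs').2.map_fst.symm)⟩
        exact (suffix_append_iff.2 (.inr ⟨v, hv, rfl⟩)).trans (List.suffix_cons _ _)
  | inc x y =>
    refine ⟨{z | z.1 ∈ T ∧ z.2 = (some .inc, true) ::
      (annPairs (annInc z.1 x y) ++ [(some .fin, false)])}, ?_, fun t ht =>
        ⟨(some .inc, true) :: (annPairs (annInc t x y) ++ [(some .fin, false)]), ht, rfl⟩, ?_⟩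
    · rintro ⟨t, l⟩ ⟨ht, e⟩
      dsimp only at ht e
      subst e
      exact ⟨ht, ann_annInc t x y true⟩
    · rintro ⟨t, l⟩ ⟨ht, e⟩ u hu he
      dsimp only at ht e
      subst e
      rcases List.suffix_cons_iff.1 hu with rfl | hu
      · obtain ⟨t', ht', e⟩ := h t ht
        refine ⟨(t', (some .inc, true) :: (annPairs (annInc t' x y) ++ [(some .fin, false)])),
          ⟨ht', rfl⟩, _, List.suffix_rfl, _, _, [], [], rfl, rfl, ?_, ?_, rfl⟩
        · simp [pairVars, annInc, List.map_ofFn, Function.comp_def]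
        · simpa [pairVals, annInc, List.map_ofFn, Function.comp_def] using e
      · have := suffix_of_head (z := []) (by simpa using hu) he (fun s hs => by
          rcases List.mem_append.1 hs with hs | hs
          · exact (mem_annPairs_fst hs).1
          · rw [List.mem_singleton.1 hs]; simp)
        simp [List.suffix_nil.1 this] at he

/-- Even an infinite team leaves only finitely many rows. -/
theorem finite_setOf_map_fst (l : List (Option Letter)) :
    {r : List Sym | r.map Prod.fst = l}.Finite := by
  refine (List.finite_length_eq Sym l.length).subset ?_
  rintro r rfl
  simp

/-- A closed set of rows contains the rows of a closed list that the machine may produce. -/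
theorem exists_chain_of_closed {φ : PInc} {S : Set (List Sym)} (hne : S.Nonempty)
    (hS : ∀ r ∈ S, ∃ t, IsRow (Val t) φ r)
    (hcl : ∀ r ∈ S, ∀ u, u <:+ r → u.head? = some (some .inc, true) →
      ∃ r' ∈ S, ∃ v, v <:+ r' ∧ Link true u v) :
    ∃ rows, rows ≠ [] ∧ Chain (encode φ) rows ∧
      Check.closed.holds rows.flatten rows.flatten = true := by
  have hfin : S.Finite := (finite_setOf_map_fst (marked (encode φ))).subset fun r hr => by
    obtain ⟨t, ht⟩ := hS r hr
    exact ht.map_fst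
  have hkeep : ∀ r ∈ S, ∀ rows : List (List Sym),
      (rows.flatten = [] ∨ Check.novel.holds rows.flatten r = false) → Keeps rows.flatten r := by
    intro r hr rows h
    obtain ⟨t, ht⟩ := hS r hr
    refine ⟨?_, ht.consistent, h⟩
    obtain ⟨s, hs, rfl⟩ := ht
    exact parse_eq_done_iff.2 ⟨φ, s, hs.mono fun _ _ _ _ => trivial, rfl⟩
  -- Induction on the number of rows of `S` that have not been used; when none is left, the list is
  -- as closed as `S`.
  have key : ∀ (n : ℕ) (rows : List (List Sym)), rows ≠ [] → (∀ r ∈ rows, r ∈ S) →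
      Chain (encode φ) rows → (S \ {r | r ∈ rows}).ncard ≤ n →
      ∃ rows, rows ≠ [] ∧ Chain (encode φ) rows ∧
        Check.closed.holds rows.flatten rows.flatten = true := by
    intro n
    induction n with
    | zero =>
      intro rows hne' hrows hc hn
      have hsub : S ⊆ {r | r ∈ rows} := by
        rw [← Set.sdiff_eq_empty]
        exact (Set.ncard_eq_zero (hfin.subset Set.sdiff_subset)).1 (Nat.le_zero.1 hn)
      refine ⟨rows, hne', hc, (closed_holds_iff (φ := φ) hne' fun r hr => ?_).2 fun r hr u hu he => ?_⟩
      · obtain ⟨t, ht⟩ := hS r (hrows r hr)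
        exact ⟨_, ht⟩
      · obtain ⟨r', hr', h⟩ := hcl r (hrows r hr) u hu he
        exact ⟨r', hsub hr', h⟩
    | succ n ih =>
      intro rows hne' hrows hc hn
      have hrows' : ∀ r ∈ rows, ∃ V, IsRow V φ r := fun r hr => by
        obtain ⟨t, ht⟩ := hS r (hrows r hr)
        exact ⟨_, ht⟩
      by_cases hcl' : Check.closed.holds rows.flatten rows.flatten = true
      · exact ⟨rows, hne', hc, hcl'⟩
      rw [closed_holds_iff hne' hrows'] at hcl'
      push Not at hcl'
      obtain ⟨r, hr, u, hu, he, hnone⟩ := hcl'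
      obtain ⟨r', hr', v, hv, hl⟩ := hcl r (hrows r hr) u hu he
      have hr'' : r' ∉ rows := fun h => hnone r' h v hv hl
      obtain ⟨t, ht⟩ := hS r' hr'
      refine ih (r' :: rows) (by simp) (by simpa using ⟨hr', hrows⟩)
        (hc.cons ht.map_fst (hkeep r' hr' rows (.inr ?_))) ?_
      -- `r'` is novel at the very atom `v` that supplies the missing witness for `u`.
      · refine (novel_holds_eq_false_iff ht hne' hrows').2 ⟨v, hv, ?_, ?_⟩
        · obtain ⟨_, _, _, _, _, rfl, _⟩ := hl
          rfl
        · rintro ⟨r₁, hr₁, w, hw, hl'⟩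
          exact hnone r₁ hr₁ w hw (hl.trans hl')
      · have hlt : S \ {r | r ∈ r' :: rows} ⊂ S \ {r | r ∈ rows} := by
          refine ⟨fun x hx => ⟨hx.1, fun h => hx.2 (by simp [show x ∈ rows from h])⟩, fun h => ?_⟩
          exact (h (show r' ∈ S \ {r | r ∈ rows} from ⟨hr', hr''⟩)).2 (by simp)
        have := Set.ncard_lt_ncard hlt (hfin.subset Set.sdiff_subset)
        omega
  obtain ⟨r, hr⟩ := hne
  obtain ⟨t, ht⟩ := hS r hr
  exact key _ [r] (by simp) (by simpa using hr)
    (.cons .nil ht.map_fst (hkeep r hr [] (.inl rfl))) le_rfl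

/-- If the formula is satisfiable, the machine may produce a closed list of rows. -/
theorem exists_chain_of_satisfiable {sem : SplitSemantics} {φ : PInc} (h : Satisfiable sem φ) :
    ∃ rows, rows ≠ [] ∧ Chain (encode φ) rows ∧
      Check.closed.holds rows.flatten rows.flatten = true := by
  obtain ⟨T, ⟨t, ht⟩, hT⟩ := h
  obtain ⟨R, hR⟩ := exists_closedSet hT
  refine exists_chain_of_closed (S := {r | ∃ x ∈ R, r = x.2 ++ [(none, false)]}) ?_ ?_ ?_
  · obtain ⟨r, hr⟩ := hR.total t ht
    exact ⟨_, _, hr, rfl⟩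
  · rintro _ ⟨x, hx, rfl⟩
    exact ⟨x.1, x.2, (hR.ann x hx).2, rfl⟩
  · rintro _ ⟨x, hx, rfl⟩ u hu he
    rcases suffix_append_head hu he with hu | ⟨u', hu', he', rfl⟩
    · have := suffix_of_head (z := []) (by simpa using hu) he (by simp)
      simp [List.suffix_nil.1 this] at he
    · obtain ⟨y, hy, v, hv, hl⟩ := hR.closed x hx u' hu' he'
      exact ⟨_, ⟨y, hy, rfl⟩, _, suffix_append_iff.2 (.inr ⟨v, hv, rfl⟩), hl.append rfl⟩

end PInc

/-! ## Cliques and tree decompositions -/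

namespace TreeDecomposition

variable {V : Type} {G : SimpleGraph V}

/-- In a tree, the path between two nodes of a connected set of nodes stays in the set. -/
theorem mem_of_mem_support {W : Type} {T : SimpleGraph W} (hT : T.IsAcyclic) {S : Set W}
    (hS : (T.induce S).Connected) {a b : W} (ha : a ∈ S) (hb : b ∈ S) {p : T.Walk a b}
    (hp : p.IsPath) {c : W} (hc : c ∈ p.support) : c ∈ S := by
  classical
  obtain ⟨q⟩ := hS.preconnected ⟨a, ha⟩ ⟨b, hb⟩
  let f := SimpleGraph.Embedding.induce (G := T) S
  have hq : (q.map f.toHom).bypass = p := by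
    have := (hT.subsingleton_path a b).elim
      ⟨(q.map f.toHom).bypass, (q.map f.toHom).bypass_isPath⟩ ⟨p, hp⟩
    exact congrArg Subtype.val this
  rw [← hq] at hc
  have := (q.map f.toHom).support_bypass_subset_support hc
  rw [SimpleGraph.Walk.support_map] at this
  obtain ⟨d, -, rfl⟩ := List.mem_map.1 this
  exact d.2

/-- Subtrees of a tree that meet pairwise have a common node. -/
theorem exists_common_node {W ι : Type} [Finite ι] [Nonempty ι] {T : SimpleGraph W}
    (hT : T.IsTree) {S : ι → Set W} (hS : ∀ i, (T.induce (S i)).Connected)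
    (hmeet : ∀ i j, (S i ∩ S j).Nonempty) : ∃ c, ∀ i, c ∈ S i := by
  classical
  -- The tree is rooted at `ρ`, and `s i` is a node of `S i` nearest to the root. The deepest of
  -- these nodes is shown to be common.
  obtain ⟨ρ⟩ := hT.1.nonempty
  have hmin : ∀ i, ∃ s ∈ S i, ∀ z ∈ S i, T.dist ρ s ≤ T.dist ρ z := by
    intro i
    obtain ⟨s, hs⟩ := hmeet i i
    exact ⟨_, Function.argminOn_mem (T.dist ρ) (S i) ⟨s, hs.1⟩,
      fun z hz => Function.argminOn_le (T.dist ρ) (S i) hz⟩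
  choose s hs hsmin using hmin
  obtain ⟨i, hi⟩ := Finite.exists_max fun i => T.dist ρ (s i)
  -- The path from the root to any node of `S j` enters `S j` at `s j`.
  have through : ∀ j z, z ∈ S j → ∃ (p : T.Walk ρ (s j)) (q : T.Walk (s j) z),
      p.length = T.dist ρ (s j) ∧ q.IsPath ∧ (p.append q).IsPath := by
    intro j z hz
    obtain ⟨p, hp, hpl⟩ := hT.1.exists_path_of_dist ρ (s j)
    obtain ⟨q, hq⟩ := hT.1.exists_isPath (s j) z
    refine ⟨p, q, hpl, hq, ?_⟩
    rw [SimpleGraph.Walk.isPath_def, SimpleGraph.Walk.support_append, List.nodup_append]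
    refine ⟨hp.support_nodup, hq.support_nodup.tail, fun a ha b hb hab => ?_⟩
    subst hab
    have haS : a ∈ S j := mem_of_mem_support hT.2 (hS j) (hs j) hz hq (List.mem_of_mem_tail hb)
    have h₁ : T.dist ρ a ≤ (p.takeUntil a ha).length := SimpleGraph.dist_le _
    have h₂ := congrArg SimpleGraph.Walk.length (p.take_spec ha)
    rw [SimpleGraph.Walk.length_append, hpl] at h₂
    have h₃ := hsmin j a haS
    have h₄ : a = s j := SimpleGraph.Walk.eq_of_length_eq_zero (p := p.dropUntil a ha) (by omega)
    subst h₄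
    have := hq.support_nodup
    rw [← SimpleGraph.Walk.cons_tail_support] at this
    exact (List.nodup_cons.1 this).1 hb
  refine ⟨s i, fun j => ?_⟩
  -- The path from the root to `z` passes through `s i` and `s j`. As `s i` is at least as deep, it
  -- lies on the part from `s j` to `z`, which stays in `S j`.
  obtain ⟨z, hzi, hzj⟩ := hmeet i j
  obtain ⟨p, q, hp, hq, hpq⟩ := through i z hzi
  obtain ⟨p', q', hp', hq', hpq'⟩ := through j z hzj
  have heq : p.append q = p'.append q' :=
    congrArg Subtype.val ((hT.2.subsingleton_path ρ z).elim ⟨_, hpq⟩ ⟨_, hpq'⟩)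
  have hmem : s i ∈ (p'.append q').support := by
    rw [← heq, SimpleGraph.Walk.mem_support_append_iff]
    exact .inl p.end_mem_support
  rcases (SimpleGraph.Walk.mem_support_append_iff _ _).1 hmem with h | h
  · have h₁ : T.dist ρ (s i) ≤ (p'.takeUntil _ h).length := SimpleGraph.dist_le _
    have h₂ := congrArg SimpleGraph.Walk.length (p'.take_spec h)
    rw [SimpleGraph.Walk.length_append, hp'] at h₂
    have h₃ := hi j
    rw [SimpleGraph.Walk.eq_of_length_eq_zero (p := p'.dropUntil _ h) (by omega)]
    exact hs j
  · exact mem_of_mem_support hT.2 (hS j) (hs j) hzj hq' h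

/-- Every clique is contained in some bag. -/
theorem exists_bag_of_isClique (D : TreeDecomposition G) {C : Finset V} (hC : G.IsClique C)
    (hne : C.Nonempty) : ∃ i, C ⊆ D.bag i := by
  have : Nonempty C := hne.to_subtype
  obtain ⟨i, hi⟩ := exists_common_node (ι := C) D.isTree (fun v => D.connected v.1) fun u v => by
    by_cases h : u = v
    · subst h
      obtain ⟨i, hi⟩ := D.cover u.1
      exact ⟨i, hi, hi⟩
    · exact D.edge _ _ (hC u.2 v.2 fun e => h (Subtype.ext e))
  exact ⟨i, fun v hv => hi ⟨v, hv⟩⟩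

/-- The decomposition with a single bag. -/
def trivial [Fintype V] (G : SimpleGraph V) : TreeDecomposition G where
  size := 1
  tree := ⊥
  isTree := .of_subsingleton
  bag _ := Finset.univ
  cover v := ⟨0, Finset.mem_univ v⟩
  edge u v _ := ⟨0, Finset.mem_univ u, Finset.mem_univ v⟩
  connected v := by
    have : Nonempty {i : Fin 1 | v ∈ (Finset.univ : Finset V)} := ⟨0, Finset.mem_univ v⟩
    exact (SimpleGraph.IsTree.of_subsingleton).1

end TreeDecomposition

/-- The size of a clique is at most the treewidth plus one. -/
theorem SimpleGraph.IsClique.card_le_treewidth {V : Type} [Finite V] {G : SimpleGraph V}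
    {C : Finset V} (hC : G.IsClique C) : C.card ≤ treewidth G + 1 := by
  have := Fintype.ofFinite V
  -- The decomposition with one bag makes the set of widths nonempty, so the infimum is attained and
  -- not a default value.
  obtain ⟨D, hD⟩ := Nat.sInf_mem (s := Set.range fun D : TreeDecomposition G => D.width)
    ⟨_, TreeDecomposition.trivial G, rfl⟩
  rcases C.eq_empty_or_nonempty with rfl | hne
  · simp
  obtain ⟨i, hi⟩ := D.exists_bag_of_isClique hC hne
  have h₁ := Finset.card_le_card hi
  have h₂ := Finset.le_sup (f := fun i => (D.bag i).card) (Finset.mem_univ i)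
  change D.width = treewidth G at hD
  rw [← hD, TreeDecomposition.width]
  omega

namespace PInc

/-- The number of variables of an inclusion atom is at most the treewidth. -/
theorem ncard_vars_le_treewidth {φ : PInc} {n : ℕ} {x y : Fin n → ℕ}
    (h : inc x y ∈ subformulas φ) : (vars (inc x y)).ncard ≤ treewidth (gaifman φ) := by
  classical
  have hv : ∀ φ : PInc, inc x y ∈ subformulas φ → vars (inc x y) ⊆ vars φ := by
    intro φ h
    induction φ with
    | top | bot | var | neg => simp [subformulas] at h
    | or φ ψ ih₁ ih₂ =>
      rcases h with h | h | h
      · cases h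
      · exact (ih₁ h).trans Set.subset_union_left
      · exact (ih₂ h).trans Set.subset_union_right
    | and φ ψ ih₁ ih₂ =>
      rcases h with h | h | h
      · cases h
      · exact (ih₁ h).trans Set.subset_union_left
      · exact (ih₂ h).trans Set.subset_union_right
    | inc x' y' => rw [show inc x y = inc x' y' from h]
  -- The atom itself belongs to the clique; it makes up for the one by which the treewidth differs
  -- from the size of a bag.
  let S : Set (carrier φ) := {u | u.1 = inc x y ∨ ∃ v ∈ vars (inc x y), u.1 = var v}
  have hclique : (gaifman φ).IsClique S := by
    rintro ⟨u, hu⟩ hu' ⟨v, hv⟩ hv' hne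
    refine (SimpleGraph.fromRel_adj _ _ _).2 ⟨hne, ?_⟩
    rcases hu' with hu' | ⟨a, ha, hu'⟩ <;> rcases hv' with hv' | ⟨b, hb, hv'⟩ <;>
      dsimp only at hu' hv' <;> subst hu' hv'
    · exact absurd rfl hne
    · exact .inl (.inr (.atom x y b h hb))
    · exact .inr (.inr (.atom x y a h ha))
    · exact .inl (.inr (.pair x y a b h ha hb))
  have hcard : (vars (inc x y)).ncard + 1 = S.ncard := by
    have himg : Subtype.val '' S = insert (inc x y) (var '' vars (inc x y)) := by
      ext u
      constructor
      · rintro ⟨u, hu | ⟨v, hv, hu⟩, rfl⟩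
        · exact .inl hu
        · exact .inr ⟨v, hv, hu.symm⟩
      · rintro (rfl | ⟨v, hv', rfl⟩)
        · exact ⟨⟨_, .inl h⟩, .inl rfl, rfl⟩
        · exact ⟨⟨_, .inr ⟨v, hv φ h hv', rfl⟩⟩, .inr ⟨v, hv', rfl⟩, rfl⟩
    rw [← Set.ncard_image_of_injective S Subtype.val_injective, himg,
      Set.ncard_insert_of_notMem (by rintro ⟨v, -, hv⟩; cases hv)
        ((finite_vars _).image _),
      Set.ncard_image_of_injective _ fun a b h => PInc.var.inj h]
  have hC : (gaifman φ).IsClique ((Set.toFinite S).toFinset : Finset (carrier φ)) := by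
    simpa using hclique
  have := hC.card_le_treewidth
  rw [← Set.ncard_eq_toFinset_card S, ← hcard] at this
  omega


/-! ## The number of rows -/

theorem suffix_map_fst_eq {r r' u u' : List Sym} (hr : r.map Prod.fst = r'.map Prod.fst)
    (hu : u <:+ r) (hu' : u' <:+ r') (h : u.length = u'.length) :
    u.map Prod.fst = u'.map Prod.fst := by
  have h₁ := hu.map Prod.fst
  have h₂ := hu'.map Prod.fst
  rw [hr] at h₁
  exact (List.suffix_of_suffix_length_le h₁ h₂ (by simp [h])).eq_of_length (by simp [h])

/-- The positions of the active inclusion atoms in the rows, with the truth values of their second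
tuples. -/
def keys (rows : List (List Sym)) : Set (ℕ × List Bool) :=
  {q | ∃ r ∈ rows, ∃ T z, (some .inc, true) :: (annPairs T ++ (some .fin, false) :: z) <:+ r ∧
    q = (((some .inc, true) :: (annPairs T ++ (some .fin, false) :: z) : List Sym).length,
      pairVals false T)}

theorem keys_mono {rows rows' : List (List Sym)} (h : rows ⊆ rows') : keys rows ⊆ keys rows' := by
  rintro q ⟨r, hr, hq⟩
  exact ⟨r, h hr, hq⟩

/-- Every row but the first contributes a new position or new truth values. -/
theorem Chain.exists_keys {φ : PInc} {rows : List (List Sym)} (h : Chain (encode φ) rows) :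
    ∃ F : Finset (ℕ × List Bool), (F : Set _) ⊆ keys rows ∧ rows.length ≤ F.card + 1 := by
  classical
  induction h with
  | nil => exact ⟨∅, by simp, by simp⟩
  | @cons rows row hc hw hk ih =>
    obtain ⟨F, hF, hcard⟩ := ih
    have hrow := (hc.cons hw hk).exists_isRow row (by simp)
    obtain ⟨t, ht⟩ := hrow
    rcases eq_or_ne rows [] with rfl | hne
    · exact ⟨∅, by simp, by simp⟩
    have hrows : ∀ r ∈ rows, ∃ V, IsRow V φ r := fun r hr =>
      (hc.exists_isRow r hr).imp' _ fun _ => id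
    have hnov := hk.2.2.resolve_left (flatten_ne_nil hne hrows)
    obtain ⟨u, hu, he, hnone⟩ := (novel_holds_eq_false_iff ht hne hrows).1 hnov
    obtain ⟨T, z, rfl, -⟩ := ht.atomAt hu he
    refine ⟨insert (((some .inc, true) :: (annPairs T ++ (some .fin, false) :: z) : List Sym).length,
      pairVals false T) F, ?_, ?_⟩
    · rw [Finset.coe_insert, Set.insert_subset_iff]
      exact ⟨⟨row, by simp, T, z, hu, rfl⟩, hF.trans (keys_mono (List.subset_cons_self _ _))⟩
    · rw [Finset.card_insert_of_notMem, List.length_cons]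
      · omega
      -- An old key at this position would come from a row in which the same atom is active with the
      -- same values, contrary to novelty.
      · intro hmem
        obtain ⟨r, hr, T', z', hu', e⟩ := hF hmem
        obtain ⟨hlen, hvals⟩ := Prod.mk.inj e
        have hl := suffix_map_fst_eq (hw.trans (hc.map_fst r hr).symm) hu hu' hlen
        obtain ⟨hvars, hz⟩ := pairVars_eq_of_map_fst_eq (List.cons.inj hl).2
        exact hnone ⟨r, hr, _, hu', T, T', z, z', rfl, rfl, hvars, hvals, hz⟩

/-- At each position there are few possible truth values. -/
theorem Chain.exists_values {φ : PInc} {rows : List (List Sym)} (h : Chain (encode φ) rows) {k : ℕ}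
    (hk : ∀ (n : ℕ) (x y : Fin n → ℕ), inc x y ∈ subformulas φ → (vars (inc x y)).ncard ≤ k)
    (m : ℕ) : ∃ F : Finset (List Bool), F.card ≤ 2 ^ k ∧ ∀ l, (m, l) ∈ keys rows → l ∈ F := by
  classical
  by_cases hm : ∃ l, (m, l) ∈ keys rows
  swap
  · exact ⟨∅, by simp, fun l hl => absurd ⟨l, hl⟩ hm⟩
  obtain ⟨l, r, hr, T, z, hu, e⟩ := hm
  obtain ⟨t, ht⟩ := h.exists_isRow r hr
  obtain ⟨T₀, z₀, e₀, -, n, x, y, hφ, -, hy⟩ := ht.atomAt hu rfl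
  obtain ⟨rfl, -⟩ := annPairs_append_inj (List.cons.inj e₀).2
  -- The values of the second tuple are determined by the set of true variables of the atom.
  -- Counting these sets gives `2 ^ k` even if tuples are long and repeat variables.
  refine ⟨(finite_vars (inc x y)).toFinset.powerset.image
    fun s => (pairVars T).map fun q => decide (q.2 ∈ s), ?_, ?_⟩
  · refine Finset.card_image_le.trans ?_
    rw [Finset.card_powerset, ← Set.ncard_eq_toFinset_card _ (finite_vars (inc x y))]
    exact Nat.pow_le_pow_right (by norm_num) (hk n x y hφ)
  · rintro l' ⟨r', hr', T', z', hu', e'⟩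
    obtain ⟨t', ht'⟩ := h.exists_isRow r' hr'
    obtain ⟨T₁, z₁, e₁, hT', -⟩ := ht'.atomAt hu' rfl
    obtain ⟨rfl, -⟩ := annPairs_append_inj (List.cons.inj e₁).2
    have hl := suffix_map_fst_eq ((h.map_fst r hr).trans (h.map_fst r' hr').symm) hu hu'
      ((Prod.mk.inj e).1.symm.trans (Prod.mk.inj e').1)
    obtain ⟨hvars, -⟩ := pairVars_eq_of_map_fst_eq (List.cons.inj hl).2
    refine Finset.mem_image.2 ⟨(finite_vars (inc x y)).toFinset.filter fun v => t' v = true,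
      Finset.mem_powerset.2 (Finset.filter_subset _ _), ?_⟩
    rw [(Prod.mk.inj e').2, hvars, pairVars, pairVals, List.map_map]
    refine List.map_congr_left fun q hq => ?_
    have hmem : q.2.1 ∈ vars (inc x y) := by
      have : q.2.1 ∈ (pairVars T').map Prod.snd := by
        rw [pairVars, List.map_map]
        exact List.mem_map_of_mem (f := fun q : (ℕ × Bool) × ℕ × Bool => q.2.1) hq
      rw [← hvars, pairVars, List.map_map] at this
      have h' : q.2.1 ∈ List.ofFn y := by rw [← hy]; exact this
      exact .inr (List.mem_ofFn.1 h')
    have hq' : t' q.2.1 = q.2.2 := (hT' q hq).2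
    simp [hmem, hq']

/-- The number of rows is bounded in terms of the numbers of variables of the inclusion atoms. -/
theorem Chain.length_le {φ : PInc} {rows : List (List Sym)} (h : Chain (encode φ) rows) {k : ℕ}
    (hk : ∀ (n : ℕ) (x y : Fin n → ℕ), inc x y ∈ subformulas φ → (vars (inc x y)).ncard ≤ k) :
    rows.length ≤ ((encode φ).length + 2) * 2 ^ k + 1 := by
  classical
  obtain ⟨F, hF, hcard⟩ := h.exists_keys
  choose A hA hmem using h.exists_values hk
  -- A position is the length of a suffix of a row, hence at most the length of the word plus one
  -- for the end mark.
  have hsub : F ⊆ (Finset.range ((encode φ).length + 2)).biUnion fun m => (A m).image (Prod.mk m) := by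
    rintro ⟨m, l⟩ hq
    have hq' := hF hq
    refine Finset.mem_biUnion.2 ⟨m, ?_, Finset.mem_image_of_mem _ (hmem m l hq')⟩
    obtain ⟨r, hr, T, z, hu, e⟩ := hq'
    have h₁ := hu.length_le
    rw [← (Prod.mk.inj e).1, length_of_map_fst (h.map_fst r hr)] at h₁
    exact Finset.mem_range.2 (by omega)
  have h₁ := Finset.card_le_card hsub
  have h₂ := Finset.card_biUnion_le_card_mul (Finset.range ((encode φ).length + 2))
    (fun m => (A m).image (Prod.mk m)) (2 ^ k) fun m _ => Finset.card_image_le.trans (hA m)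
  rw [Finset.card_range] at h₂
  omega

/-- On strings that are not formulas no row is ever kept, so the default parameter 0 does no harm.
-/
theorem Chain.length_le_param (sem : SplitSemantics) {w : List Letter} {rows : List (List Sym)}
    (h : Chain w rows) :
    rows.length ≤ (w.length + 2) * 2 ^ (satByTreewidth sem).param w + 1 := by
  rcases eq_or_ne rows [] with rfl | hne
  · simp
  · obtain ⟨φ, rfl⟩ := h.exists_encode hne
    rw [param_encode]
    exact h.length_le fun _ _ _ => ncard_vars_le_treewidth

end PInc

/-! ### Conclusion -/

theorem computable_const_pow (b : ℕ) : Computable fun n : ℕ => b ^ n := by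
  refine Primrec.to_comp ((Primrec.nat_rec₁ (f := fun _ p => p * b) 1
    (Primrec.nat_mul.comp₂ Primrec₂.right (Primrec₂.const b))).of_eq fun n => ?_)
  induction n with
  | zero => rfl
  | succ n ih => rw [pow_succ, ← ih]

open Polynomial in
theorem mainTheorem9 (sem : SplitSemantics) : (PInc.satByTreewidth sem).InParaNP := by
  -- The time is quartic in the number of rows, whence `(2 ^ k) ^ 4 = 16 ^ k`. The `4` in `X + 4`
  -- arises from `(m + 2) * 2 ^ k + 1 + 1 ≤ (m + 4) * 2 ^ k`.
  refine ⟨PInc.machine, fun k => 16 ^ k, 80 * (2 * (X + 4) * (X + 1) + 1) ^ 4,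
    computable_const_pow 16, fun w => ⟨?_, ?_⟩⟩
  · intro n c hn
    refine (PInc.machine_haltsWithin (fun _ h => h.length_le_param sem) n c hn).trans ?_
    generalize (PInc.satByTreewidth sem).param w = k
    generalize w.length = m
    have h₁ : 1 ≤ 2 ^ k := Nat.one_le_two_pow
    have h₂ : 2 * ((m + 2) * 2 ^ k + 1 + 1) * (m + 1) + 1 ≤
        2 ^ k * (2 * (m + 4) * (m + 1) + 1) := by nlinarith
    calc 80 * (2 * ((m + 2) * 2 ^ k + 1 + 1) * (m + 1) + 1) ^ 4
        ≤ 80 * (2 ^ k * (2 * (m + 4) * (m + 1) + 1)) ^ 4 :=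
          Nat.mul_le_mul_left _ (Nat.pow_le_pow_left h₂ 4)
      _ = (2 ^ 4) ^ k * (80 * (2 * (m + 4) * (m + 1) + 1) ^ 4) := by
          rw [mul_pow, ← pow_mul, ← pow_mul, mul_comm k 4]; ring
      _ = _ := by simp
  · rw [PInc.machine_accepts_iff fun _ h => h.length_le_param sem]
    constructor
    · rintro ⟨rows, hne, hc, hcl⟩
      obtain ⟨φ, rfl⟩ := hc.exists_encode hne
      exact (PInc.mem_lang_encode sem φ).2 (PInc.satisfiable_of_chain sem hne hc hcl)
    · rintro ⟨φ, rfl, h⟩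
      exact PInc.exists_chain_of_satisfiable h
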